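/- All manifolds, maps and isotopies are smooth. For a compact manifold $X$ with (possibly empty) boundary, let $\operatorname{Diff}_\partial(X)$ be the group of diffeomorphisms of $X$ that are the identity near $\partial X$. For $\rho\in\operatorname{Diff}_\partial(P)$, the open book $\mathrm{OB}(P,\rho)$ with page $P$, monodromy $\rho$ and binding $\partial P$ is the closed manifold $\mathcal{MT}(P,\rho)\cup_{\mathrm{id}}\partial P\times D^2$, where $\mathcal{MT}(P,\rho)$ is the mapping torus of $\rho$; an open book decomposition $\mathrm{OB}(P,\rho)$ of a closed manifold $M$ is an identification of $M$ with this manifold. Its fixed page is the resulting embedded copy of $P$ in $M$ at angle $0$, whose boundary, after adding the collar $\partial P\times\{re^{i0}:0\le r\le 1\}$, is the binding. For $\phi_i\in\operatorname{Diff}_\partial(\Sigma_i)$, we say that $\mathrm{OB}(\Sigma_1,\phi_1)$ spun embeds in $\mathrm{OB}(\Sigma_2,\phi_2)$ if there is a proper embedding $g:(\Sigma_1,\partial\Sigma_1)\to(\Sigma_2,\partial\Sigma_2)$ such that $g\circ\phi_1$ is isotopic to $\phi_2\circ g$, relative to the boundary and through proper embeddings; here $g$ is proper if $g^{-1}(\partial\Sigma_2)=\partial\Sigma_1$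 and $g$ is transverse to $\partial\Sigma_2$. **Lemma 4.1.** Let $n\ge 2$, let $\Sigma$ be a compact $(n+1)$-manifold with boundary, let $\phi\in\operatorname{Diff}_\partial(\Sigma)$, and let $M^n$ be a connected component of the binding $\partial\Sigma$ of $\mathrm{OB}(\Sigma,\phi)$. Let $\mathrm{OB}(P_1^{n-1},\rho_1)$ and $\mathrm{OB}(P_2^{n-1},\rho_2)$ be two open book decompositions of the closed manifold $M$, and let $g_i:P_i\to M$ be the embedding of $P_i$ as a fixed page, $i=1,2$. Let $V^{n-1}\subset M$ be a compact embedded submanifold with boundary such that $g_1(P_1)\cup g_2(P_2)\subset V$. Write $\hat\rho_i: V\to V$ for the map that equals $g_i\circ\rho_i\circ g_i^{-1}$ on $g_i(P_i)$ and the identity elsewhere. Then the group $\langle\rho_1,\rho_2\rangle$ generated by $\hat\rho_1$ and $\hat\rho_2$ is contained in $\operatorname{Diff}_\partial(V)$, and for every $\eta\in\langle\rho_1,\rho_2\rangle$ the open book $\mathrm{OB}(V,\eta)$ spun embeds in $\mathrm{OB}(\Sigma,\phi)$. -/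

import Mathlib

open Set Topology Manifold
open scoped ContDiff

noncomputable section

/-- `Diff_∂(X)`: the group of (smooth) diffeomorphisms of `X` that restrict to the identity on a
neighbourhood of the boundary `∂X`, as a group of permutations of `X` under composition. -/
def DiffBdry {E H : Type*} [NormedAddCommGroup E] [NormedSpace ℝ E] [TopologicalSpace H]
    (I : ModelWithCorners ℝ E H) (X : Type*) [TopologicalSpace X] [ChartedSpace H X] :
    Subgroup (Equiv.Perm X) where
  carrier := {f | ContMDiff I I ∞ f ∧ ContMDiff I I ∞ f.symm ∧
    ∀ᶠ x in 𝓝ˢ (I.boundary X), f x = x}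
  one_mem' := ⟨contMDiff_id, contMDiff_id, Filter.Eventually.of_forall fun _ => rfl⟩
  mul_mem' := by
    rintro f g ⟨hf, hf', hfb⟩ ⟨hg, hg', hgb⟩
    refine ⟨hf.comp hg, hg'.comp hf', ?_⟩
    filter_upwards [hfb, hgb] with x h1 h2
    rw [Equiv.Perm.mul_apply, h2, h1]
  inv_mem' := by
    rintro f ⟨hf, hf', hfb⟩
    refine ⟨hf', hf, ?_⟩
    filter_upwards [hfb] with x h
    exact Equiv.Perm.inv_eq_iff_eq.mpr h.symm

/-- A proper embedding `(X, ∂X) → (Y, ∂Y)`: a smooth embedding such that exactly the boundary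
points of `X` go to boundary points of `Y`. -/
structure IsProperEmbedding {E H E' H' : Type*} [NormedAddCommGroup E] [NormedSpace ℝ E]
    [TopologicalSpace H] [NormedAddCommGroup E'] [NormedSpace ℝ E'] [TopologicalSpace H']
    (I : ModelWithCorners ℝ E H) (J : ModelWithCorners ℝ E' H')
    {X Y : Type*} [TopologicalSpace X] [ChartedSpace H X] [TopologicalSpace Y] [ChartedSpace H' Y]
    (g : X → Y) : Prop where
  isSmoothEmbedding : IsSmoothEmbedding I J ∞ g
  preimage_boundary : g ⁻¹' J.boundary Y = I.boundary X

/-- `f₀, f₁ : X → Y` are isotopic relative to the boundary: there is a smooth family `F (·, t)`,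
`t ∈ [0, 1]`, of proper embeddings from `f₀` to `f₁` which is constant in `t` on `∂X`. -/
def IsotopicRelBoundary {E H E' H' : Type*} [NormedAddCommGroup E] [NormedSpace ℝ E]
    [TopologicalSpace H] [NormedAddCommGroup E'] [NormedSpace ℝ E'] [TopologicalSpace H']
    (I : ModelWithCorners ℝ E H) (J : ModelWithCorners ℝ E' H')
    {X Y : Type*} [TopologicalSpace X] [ChartedSpace H X] [TopologicalSpace Y] [ChartedSpace H' Y]
    (f₀ f₁ : X → Y) : Prop :=
  ∃ F : X × ℝ → Y,
    ContMDiffOn (I.prod 𝓘(ℝ, ℝ)) J ∞ F (univ ×ˢ Icc (0 : ℝ) 1) ∧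
    (∀ t ∈ Icc (0 : ℝ) 1, IsProperEmbedding I J fun x => F (x, t)) ∧
    (∀ x, F (x, 0) = f₀ x) ∧ (∀ x, F (x, 1) = f₁ x) ∧
    ∀ x ∈ I.boundary X, ∀ t ∈ Icc (0 : ℝ) 1, F (x, t) = f₀ x

/-- The abstract open book `OB(X, φ)` spun embeds in the abstract open book `OB(Y, ψ)`: there is
a proper embedding `g : (X, ∂X) → (Y, ∂Y)` such that `g ∘ φ` is isotopic to `ψ ∘ g` relative to the
boundary. -/
def SpunEmbeds {E H E' H' : Type*} [NormedAddCommGroup E] [NormedSpace ℝ E]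
    [TopologicalSpace H] [NormedAddCommGroup E'] [NormedSpace ℝ E'] [TopologicalSpace H']
    {I : ModelWithCorners ℝ E H} {J : ModelWithCorners ℝ E' H'}
    {X Y : Type*} [TopologicalSpace X] [ChartedSpace H X] [TopologicalSpace Y] [ChartedSpace H' Y]
    (φ : DiffBdry I X) (ψ : DiffBdry J Y) : Prop :=
  ∃ g : X → Y, IsProperEmbedding I J g ∧
    IsotopicRelBoundary I J (g ∘ (φ : Equiv.Perm X)) ((ψ : Equiv.Perm Y) ∘ g)

/-- An open book decomposition `M = OB(P, ρ)` with binding `B`, i.e. an identification of `M` with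
`MT(P, ρ) ∪ ∂P × D²`. Here `dim P = k + 1`, `dim B = k` and `dim M = k + 2`.

The identification is recorded by `sweep : P × ℝ → M`, where `sweep (·, t)` is the parametrization
of the page at angle `2πt` (a page contains its boundary, the binding) obtained by following the
flow of the open book from the page at angle `0`, and by a tubular neighbourhood
`tube : B × ℂ → M` of the binding (with an open disc reparametrized radially as `ℂ`), in which the
page at angle `θ` is `{arg z = θ} ∪ {z = 0}` and the flow is the rotation of the second factor. -/
structure OpenBook (k : ℕ)
    (P : Type*) [TopologicalSpace P] [ChartedSpace (EuclideanHalfSpace (k + 1)) P]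
    (ρ : DiffBdry (𝓡∂ (k + 1)) P)
    (B : Type*) [TopologicalSpace B] [ChartedSpace (EuclideanSpace ℝ (Fin k)) B]
    (M : Type*) [TopologicalSpace M] [ChartedSpace (EuclideanSpace ℝ (Fin (k + 2))) M] where
  sweep : P × ℝ → M
  tube : B × ℂ → M
  contMDiff_sweep : ContMDiff ((𝓡∂ (k + 1)).prod 𝓘(ℝ, ℝ)) (𝓡 (k + 2)) ∞ sweep
  /-- Every point lies on some page. -/
  surjective_sweep : Function.Surjective sweep
  /-- The boundary of each page is the binding, and its interior misses the binding. -/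
  mem_binding_iff : ∀ x t, (∃ b, sweep (x, t) = tube (b, 0)) ↔ x ∈ (𝓡∂ (k + 1)).boundary P
  /-- The page at angle `0` is a smoothly embedded copy of `P`. -/
  isSmoothEmbedding_page : IsSmoothEmbedding (𝓡∂ (k + 1)) (𝓡 (k + 2)) ∞ fun x => sweep (x, 0)
  /-- Going around once is the monodromy: `(x, t + 1)` and `(ρ x, t)` are identified in the
  mapping torus ... -/
  sweep_add_one : ∀ x t,
    sweep (x, t + 1) = sweep ((ρ : Equiv.Perm P) x, t)
  /-- ... and there are no further identifications over the interior of `P`. -/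
  injOn_sweep : InjOn sweep ((𝓡∂ (k + 1)).interior P ×ˢ Ico (0 : ℝ) 1)
  /-- Off the binding, `sweep` is a local diffeomorphism. -/
  injective_mfderiv_sweep : ∀ x ∈ (𝓡∂ (k + 1)).interior P, ∀ t : ℝ, Function.Injective
    (mfderiv ((𝓡∂ (k + 1)).prod 𝓘(ℝ, ℝ)) (𝓡 (k + 2)) sweep (x, t))
  isSmoothEmbedding_tube :
    IsSmoothEmbedding ((𝓡 k).prod 𝓘(ℝ, ℂ)) (𝓡 (k + 2)) ∞ tube
  /-- Near the binding the pages are the half planes `arg z = const`, rotated by the flow. -/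
  sweep_tube : ∀ (b : B) (r : ℝ), 0 ≤ r → ∃ x : P, ∀ t : ℝ,
    sweep (x, t) = tube (b, (r : ℂ) * Complex.exp (2 * Real.pi * t * Complex.I))

/-- The embedding of the page `P` in `M` as the fixed page at angle `0`. -/
def OpenBook.page {k : ℕ}
    {P : Type*} [TopologicalSpace P] [ChartedSpace (EuclideanHalfSpace (k + 1)) P]
    {ρ : DiffBdry (𝓡∂ (k + 1)) P}
    {B : Type*} [TopologicalSpace B] [ChartedSpace (EuclideanSpace ℝ (Fin k)) B]
    {M : Type*} [TopologicalSpace M] [ChartedSpace (EuclideanSpace ℝ (Fin (k + 2))) M]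
    (O : OpenBook k P ρ B M) (x : P) : M :=
  O.sweep (x, 0)

end

/-! Since `φ` is the identity near the boundary, a short collar `C : M × [0, ε] → Σ` of the binding
component `M` consists of points fixed by `φ`. Place `V` in this collar as the graph `g v = C (j v,
f v)` of a small boundary defining function `f`. Then `φ ∘ g = g`, and it remains to see that `g ∘
η` is isotopic to `g` for every `η` in the group. Isotopies can be precomposed with diffeomorphisms,
reversed and concatenated, so the `η` with this property are closed under products and inverses
(`neatlyIsotopic_comp_of_mem_closure`), and only the two generators matter.

For one open book, flowing the page once around the book returns it to itself by the monodromy.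
During this motion the page runs through the rest of `V` in `M`, and the collar direction supplies
the room to avoid a collision: raise the page (`pageHeight`), sweep it around at constant height
(`motion`), and lower it again (`neatlyIsotopic_comp_viaEmbedding`). The height is invariant under
the extended monodromy, so the sweep joins the raised copy of `V` to its composite with that
monodromy.

The delicate zone is near the binding, where rest has to be interpolated with rotation. Let `r` be
the distance to the binding in the tube. The page is raised for `r ^ 2` between 1 and 2, the
rotation is switched on for `r ^ 2` between 9/4 and 11/4, and the raised height is affine in `r ^ 2`
from 2 to 3. The interpolated motion multiplies the normal coordinate by a complex factor that
depends only on `r ^ 2` and time. The height therefore recovers `r` and the tube recovers the point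
of the binding, even where the factor vanishes; this gives injectivity (`motion_injective`) and
immersivity (`chartDeriv_eq_zero_of_turning`).

Smooth embeddings are given by normal forms in charts, whereas the construction yields injective
maps with injective differential that are transverse to the boundary. The passage between the two is
the immersion criterion at boundary points, `isImmersionAtOfComplement_of_injective_mfderiv`, which
rests on an inverse function theorem on half spaces. The same theorem shows that the collar,
obtained by composing local inward pushes, is an embedding for short time (`exists_isCollar`). -/

noncomputable section


/-! ### Inverse function theorem on half spaces. -/

section HalfSpaceInverse

variable {E E' : Type*} [NormedAddCommGroup E] [NormedSpace ℝ E]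
  [NormedAddCommGroup E'] [NormedSpace ℝ E']

/-- A continuous inverse of a smooth map with invertible derivative is smooth, within any set. -/
theorem contDiffOn_leftInverse_of_fderiv [CompleteSpace E] {f : E → E'} {g : E' → E} {s : Set E}
    {t : Set E'} {f' : E → E →L[ℝ] E'} (hf : ∀ x ∈ s, HasFDerivWithinAt f (f' x) s x)
    (hf' : ContDiffOn ℝ ∞ f' s)
    (hinv : ∀ x ∈ s, ∃ L : E ≃L[ℝ] E', (L : E →L[ℝ] E') = f' x)
    (hg : ContinuousOn g t) (hgs : MapsTo g t s) (hfg : ∀ y ∈ t, f (g y) = y) :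
    ContDiffOn ℝ ∞ g t := by
  have hder : ∀ y ∈ t, HasFDerivWithinAt g ((f' (g y)).inverse) t y := by
    intro y hy
    obtain ⟨L, hL⟩ := hinv (g y) (hgs hy)
    rw [← hL, ContinuousLinearMap.inverse_equiv]
    refine HasFDerivWithinAt.of_local_left_inverse (t := s) ((hg y hy).tendsto_nhdsWithin hgs)
      ?_ hy (Filter.eventually_of_mem self_mem_nhdsWithin hfg)
    rw [hL]
    exact hf _ (hgs hy)
  have hinverse : ContDiffOn ℝ ∞ (fun x => (f' x).inverse) s := by
    intro x hx
    obtain ⟨L, hL⟩ := hinv x hx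
    have h1 := contDiffAt_map_inverse (𝕜 := ℝ) (n := ∞) L
    rw [hL] at h1
    exact h1.comp_contDiffWithinAt x (hf' x hx)
  -- Bootstrap: the derivative of `g` is inversion composed with `f' ∘ g`, hence as regular as `g`
  -- itself, and `g` gains one derivative at a time.
  rw [contDiffOn_infty]
  intro n
  induction n with
  | zero => simpa using hg
  | succ n ih =>
    push_cast
    rw [contDiffOn_succ_iff_hasFDerivWithinAt (by simp)]
    intro y hy
    refine ⟨t, by simpa [insert_eq_of_mem hy] using self_mem_nhdsWithin, by simp, _, hder, ?_⟩
    exact (hinverse.of_le (by exact_mod_cast le_top)).comp ih hgs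

theorem uniqueDiffOn_inter_halfSpace (ℓ : E →L[ℝ] ℝ) {e : E} (he : ℓ e = 1) {u : Set E}
    (hu : IsOpen u) : UniqueDiffOn ℝ ({x | 0 ≤ ℓ x} ∩ u) := by
  refine UniqueDiffOn.inter (uniqueDiffOn_convex ?_ ⟨e, ?_⟩) hu
  · exact convex_halfSpace_ge ℓ.isLinear 0
  · have h : IsOpen {x | 0 < ℓ x} := isOpen_lt continuous_const ℓ.continuous
    exact interior_maximal (fun x (hx : 0 < ℓ x) => le_of_lt hx) h
      (show 0 < ℓ e by rw [he]; exact one_pos)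

/-- The retraction onto the half space `{ℓ ≥ 0}` along `e`. -/
def halfSpaceRetraction (ℓ : E →L[ℝ] ℝ) (e : E) (x : E) : E := x + max (-ℓ x) 0 • e

theorem apply_halfSpaceRetraction {ℓ : E →L[ℝ] ℝ} {e : E} (he : ℓ e = 1) (x : E) :
    ℓ (halfSpaceRetraction ℓ e x) = max 0 (ℓ x) := by
  simp only [halfSpaceRetraction, map_add, map_smul, he, smul_eq_mul, mul_one]
  rcases le_total 0 (ℓ x) with h | h
  · rw [max_eq_right (by linarith), max_eq_right h, add_zero]
  · rw [max_eq_left (by linarith), max_eq_left h, add_neg_cancel]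

theorem halfSpaceRetraction_of_nonneg {ℓ : E →L[ℝ] ℝ} {e x : E} (hx : 0 ≤ ℓ x) :
    halfSpaceRetraction ℓ e x = x := by
  simp [halfSpaceRetraction, hx]

theorem norm_halfSpaceRetraction_sub_le (ℓ : E →L[ℝ] ℝ) (e x y : E) :
    ‖halfSpaceRetraction ℓ e x - halfSpaceRetraction ℓ e y‖ ≤ (1 + ‖ℓ‖ * ‖e‖) * ‖x - y‖ := by
  have h1 : halfSpaceRetraction ℓ e x - halfSpaceRetraction ℓ e y
      = (x - y) + (max (-ℓ x) 0 - max (-ℓ y) 0) • e := by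
    simp only [halfSpaceRetraction, sub_smul]; abel
  have h2 : |max (-ℓ x) 0 - max (-ℓ y) 0| ≤ ‖ℓ‖ * ‖x - y‖ := by
    refine (abs_max_sub_max_le_abs _ _ _).trans ?_
    rw [neg_sub_neg, abs_sub_comm, ← map_sub]
    exact ℓ.le_opNorm _
  rw [h1]
  calc _ ≤ ‖x - y‖ + |max (-ℓ x) 0 - max (-ℓ y) 0| * ‖e‖ := by
        refine (norm_add_le _ _).trans ?_
        rw [norm_smul, Real.norm_eq_abs]
    _ ≤ ‖x - y‖ + (‖ℓ‖ * ‖x - y‖) * ‖e‖ := by gcongr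
    _ = _ := by ring

/-- The inverse function theorem on a half space. -/
theorem exists_halfSpace_localInverse [CompleteSpace E] (ℓ : E →L[ℝ] ℝ) {e : E} (he : ℓ e = 1)
    (ℓ' : E' →L[ℝ] ℝ) {f : E → E'} {U : Set E} {x₀ : E} (hU : U ∈ 𝓝 x₀) (hx₀ : 0 ≤ ℓ x₀)
    (hf : ContDiffOn ℝ ∞ f ({x | 0 ≤ ℓ x} ∩ U)) (L : E ≃L[ℝ] E')
    (hL : HasFDerivWithinAt f (L : E →L[ℝ] E') {x | 0 ≤ ℓ x} x₀)
    (hb : ∀ x ∈ U, 0 ≤ ℓ x → 0 ≤ ℓ' (f x) ∧ (ℓ' (f x) = 0 ↔ ℓ x = 0))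
    (hpos : ℓ x₀ = 0 → 0 < ℓ' (L e)) :
    ∃ Φ : OpenPartialHomeomorph E E', x₀ ∈ Φ.source ∧ Φ.source ⊆ U ∧
      (∀ x ∈ Φ.source, 0 ≤ ℓ x → Φ x = f x) ∧
      (∀ x ∈ Φ.source, 0 ≤ ℓ' (Φ x) ↔ 0 ≤ ℓ x) ∧
      ContDiffOn ℝ ∞ Φ.symm (Φ.target ∩ {y | 0 ≤ ℓ' y}) := by
  have : Nontrivial E := ⟨e, 0, fun h => by simp [h] at he⟩
  -- `K` is a Lipschitz constant of the retraction onto the half space. The constant `c` makes `c *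
  -- K` smaller than `N⁻¹`, the bound under which a perturbation of `L` is still a homeomorphism
  -- onto an open set.
  set K : NNReal := 1 + ‖ℓ‖₊ * ‖e‖₊ with hK
  have hKpos : 0 < K := by positivity
  set N : NNReal := ‖(L.symm : E' →L[ℝ] E)‖₊ with hN
  have hNpos : 0 < N := by
    simpa [hN] using L.norm_symm_pos
  set c : NNReal := (2 * (K * N))⁻¹ with hc
  have hcpos : 0 < c := by positivity
  -- first neighbourhood
  obtain ⟨δ₀, hδ₀, hδ₀U⟩ := Metric.mem_nhds_iff.1 hU
  have huniq₀ := uniqueDiffOn_inter_halfSpace ℓ he (u := Metric.ball x₀ δ₀) Metric.isOpen_ball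
  have hf₀ : ContDiffOn ℝ ∞ f ({x | 0 ≤ ℓ x} ∩ Metric.ball x₀ δ₀) :=
    hf.mono (inter_subset_inter_right _ hδ₀U)
  set s₀ := {x | 0 ≤ ℓ x} ∩ Metric.ball x₀ δ₀ with hs₀
  have hx₀s : x₀ ∈ s₀ := ⟨hx₀, Metric.mem_ball_self hδ₀⟩
  set f' := fderivWithin ℝ f s₀ with hf'
  have hf'smooth : ContDiffOn ℝ ∞ f' s₀ := hf₀.fderivWithin huniq₀ (by simp)
  have hder : ∀ x ∈ s₀, HasFDerivWithinAt f (f' x) s₀ x := fun x hx =>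
    (hf₀.differentiableOn (by simp) x hx).hasFDerivWithinAt
  have hf'x₀ : f' x₀ = L := (hL.mono inter_subset_left).fderivWithin (huniq₀ _ hx₀s)
  have hcont : ContinuousWithinAt f' s₀ x₀ := hf'smooth.continuousOn x₀ hx₀s
  have hev1 : ∀ᶠ x in 𝓝[s₀] x₀, ‖f' x - L‖ ≤ c := by
    have : ∀ᶠ T in 𝓝 (f' x₀), ‖T - (L : E →L[ℝ] E')‖ ≤ c := by
      rw [hf'x₀]
      filter_upwards [Metric.closedBall_mem_nhds (L : E →L[ℝ] E') (ε := c) (by exact_mod_cast hcpos)]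
        with T hT
      simpa [dist_eq_norm] using hT
    exact hcont.eventually this
  have hev2 : ∀ᶠ x in 𝓝[s₀] x₀, f' x ∈ range ((↑) : (E ≃L[ℝ] E') → E →L[ℝ] E') := by
    have : ∀ᶠ T in 𝓝 (f' x₀), T ∈ range ((↑) : (E ≃L[ℝ] E') → E →L[ℝ] E') := by
      rw [hf'x₀]
      exact L.nhds
    exact hcont.eventually this
  obtain ⟨δ₁, hδ₁, hδ₁s⟩ := Metric.mem_nhdsWithin_iff.1 (hev1.and hev2)
  -- second neighbourhood
  set δ₂ := min δ₀ δ₁ with hδ₂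
  have hδ₂pos : 0 < δ₂ := lt_min hδ₀ hδ₁
  set s₂ := {x | 0 ≤ ℓ x} ∩ Metric.ball x₀ δ₂ with hs₂
  have hs₂s₀ : s₂ ⊆ s₀ := inter_subset_inter_right _ (Metric.ball_subset_ball (min_le_left _ _))
  have hs₂1 : ∀ x ∈ s₂, ‖f' x - L‖ ≤ c ∧ f' x ∈ range ((↑) : (E ≃L[ℝ] E') → E →L[ℝ] E') :=
    fun x hx => hδ₁s ⟨Metric.ball_subset_ball (min_le_right _ _) hx.2, hs₂s₀ hx⟩
  have hconv : Convex ℝ s₂ := (convex_halfSpace_ge ℓ.isLinear 0).inter (convex_ball _ _)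
  have hmv : ∀ x ∈ s₂, ∀ y ∈ s₂, ‖f x - f y - L (x - y)‖ ≤ c * ‖x - y‖ := fun x hx y hy =>
    Convex.norm_image_sub_le_of_norm_hasFDerivWithin_le' (φ := (L : E →L[ℝ] E'))
      (fun z hz => (hder z (hs₂s₀ hz)).mono hs₂s₀) (fun z hz => (hs₂1 z hz).1) hconv hy hx
  -- third neighbourhood
  obtain ⟨δ₃, hδ₃, hδ₃lt, hδ₃int⟩ : ∃ δ₃ > 0, K * δ₃ ≤ δ₂ ∧
      ((∀ x ∈ Metric.ball x₀ δ₃, 0 ≤ ℓ x) ∨ ℓ x₀ = 0) := by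
    rcases hx₀.eq_or_lt with h0 | h0
    · refine ⟨δ₂ / K, by positivity, ?_, Or.inr h0.symm⟩
      rw [mul_div_cancel₀]
      exact_mod_cast hKpos.ne'
    · obtain ⟨δ, hδ, hδs⟩ := Metric.mem_nhds_iff.1
        (ℓ.continuous.continuousAt.eventually (lt_mem_nhds h0))
      refine ⟨min (δ₂ / K) δ, by positivity, ?_, Or.inl fun x hx => ?_⟩
      · calc (K : ℝ) * min (δ₂ / K) δ ≤ K * (δ₂ / K) := by gcongr; exact min_le_left _ _
          _ = δ₂ := by
            rw [mul_div_cancel₀]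
            exact_mod_cast hKpos.ne'
      · exact (show 0 < ℓ x from hδs (Metric.ball_subset_ball (min_le_right _ _) hx)).le
  set π := halfSpaceRetraction ℓ e with hπ
  have hπ₀ : π x₀ = x₀ := halfSpaceRetraction_of_nonneg hx₀
  have hπlip : ∀ x y, ‖π x - π y‖ ≤ K * ‖x - y‖ := fun x y => by
    simpa [hK] using norm_halfSpaceRetraction_sub_le ℓ e x y
  have hK1 : (1 : ℝ) ≤ K := by simp [hK]; positivity
  have hπs : ∀ x ∈ Metric.ball x₀ δ₃, π x ∈ s₂ := by
    intro x hx
    refine ⟨by simp [hπ, apply_halfSpaceRetraction he], ?_⟩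
    rw [mem_ball_iff_norm] at hx ⊢
    calc ‖π x - x₀‖ = ‖π x - π x₀‖ := by rw [hπ₀]
      _ ≤ K * ‖x - x₀‖ := hπlip _ _
      _ < K * δ₃ := by gcongr
      _ ≤ δ₂ := hδ₃lt
  -- `f` is extended across the wall by the linear term `L` in the direction that the retraction
  -- collapses. The extension is only Lipschitz, but it is close enough to `L` to be a local
  -- homeomorphism. Smoothness of the inverse is needed only over the half space, where `F` agrees
  -- with `f`.
  set F : E → E' := fun x => f (π x) + L (x - π x) with hF
  have happrox : ApproximatesLinearOn F (L : E →L[ℝ] E') (Metric.ball x₀ δ₃) (c * K) := by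
    intro x hx y hy
    have h1 : F x - F y - L (x - y) = f (π x) - f (π y) - L (π x - π y) := by
      simp only [hF, map_sub]; abel
    have h2 := hmv _ (hπs x hx) _ (hπs y hy)
    rw [ContinuousLinearEquiv.coe_coe, h1]
    refine h2.trans ?_
    push_cast
    rw [mul_assoc]
    gcongr
    exact hπlip _ _
  have hcK : c * K < N⁻¹ := by
    rw [NNReal.lt_inv_iff_mul_lt hNpos.ne', hc, mul_inv, mul_assoc, mul_assoc,
      inv_mul_cancel₀ (by positivity), mul_one]
    exact inv_lt_one_of_one_lt₀ (by norm_num)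
  set Φ := happrox.toOpenPartialHomeomorph F _ (Or.inr hcK) Metric.isOpen_ball with hΦ
  have hΦs : Φ.source = Metric.ball x₀ δ₃ := rfl
  have hΦF : ∀ x, Φ x = F x := fun x => rfl
  have hball : Metric.ball x₀ δ₃ ⊆ Metric.ball x₀ δ₂ := by
    refine Metric.ball_subset_ball (le_trans ?_ hδ₃lt)
    nlinarith
  have hsU : Φ.source ⊆ U := by
    rw [hΦs]
    exact (hball.trans (Metric.ball_subset_ball (min_le_left _ _))).trans hδ₀U
  have hFf : ∀ x, 0 ≤ ℓ x → F x = f x := fun x hx => by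
    have : π x = x := halfSpaceRetraction_of_nonneg hx
    simp [hF, this]
  have hsign : ∀ x ∈ Φ.source, 0 ≤ ℓ' (Φ x) ↔ 0 ≤ ℓ x := by
    intro x hx
    constructor
    · intro h
      by_contra! hneg
      rcases hδ₃int with hint | h0
      · exact absurd (hint x hx) (not_le.2 hneg)
      have hπx := hπs x hx
      -- Below the half space `π x` lies on the wall, so `ℓ' (F x) = ℓ x * ℓ' (L e)`, which is
      -- negative by `hpos`.
      have hℓπ : ℓ (π x) = 0 := by
        rw [hπ, apply_halfSpaceRetraction he, max_eq_left hneg.le]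
      have h1 : ℓ' (f (π x)) = 0 :=
        ((hb (π x) (hδ₀U (hs₂s₀ hπx).2) hℓπ.ge).2).2 hℓπ
      have h2 : x - π x = ℓ x • e := by
        simp only [hπ, halfSpaceRetraction, max_eq_left (neg_nonneg.2 hneg.le), neg_smul]
        abel
      rw [hΦF] at h
      simp only [hF, map_add, h1, h2, map_smul, zero_add, smul_eq_mul] at h
      nlinarith [hpos h0]
    · intro h
      rw [hΦF, hFf x h]
      exact (hb x (hsU hx) h).1
  refine ⟨Φ, Metric.mem_ball_self hδ₃, hsU, fun x _ hx => hFf x hx, hsign, ?_⟩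
  have hmaps : MapsTo Φ.symm (Φ.target ∩ {y | 0 ≤ ℓ' y}) s₂ := by
    rintro y ⟨hy, hy'⟩
    have hy1 := Φ.map_target hy
    refine ⟨?_, hball hy1⟩
    rw [mem_ofPred_eq, ← hsign _ hy1, Φ.right_inv hy]
    exact hy'
  refine contDiffOn_leftInverse_of_fderiv (f := f) (f' := f') (s := s₂)
    (fun x hx => (hder x (hs₂s₀ hx)).mono hs₂s₀) (hf'smooth.mono hs₂s₀)
    (fun x hx => (hs₂1 x hx).2) (Φ.continuousOn_symm.mono inter_subset_left) hmaps ?_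
  rintro y ⟨hy, hy'⟩
  rw [← hFf _ (hmaps ⟨hy, hy'⟩).1, ← hΦF, Φ.right_inv hy]

end HalfSpaceInverse


/-! ### Linear algebra: completing an injection and matching half spaces. -/

section LinearAlgebra

variable {E E' F : Type*} [NormedAddCommGroup E] [NormedSpace ℝ E] [FiniteDimensional ℝ E]
  [NormedAddCommGroup E'] [NormedSpace ℝ E'] [FiniteDimensional ℝ E']
  [NormedAddCommGroup F] [NormedSpace ℝ F] [FiniteDimensional ℝ F]

/-- An injective linear map extends to an isomorphism by a linear map into a submodule that spans
together with its range. -/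
theorem exists_equiv_extending_injective (L : E →L[ℝ] E') (hL : Function.Injective L)
    (hdim : Module.finrank ℝ E + Module.finrank ℝ F = Module.finrank ℝ E')
    (W : Submodule ℝ E') (hW : L.toLinearMap.range ⊔ W = ⊤) :
    ∃ (A : F →L[ℝ] E') (T : (E × F) ≃L[ℝ] E'), (∀ u, A u ∈ W) ∧ ∀ x u, T (x, u) = L x + A u := by
  -- A complement of `range L ⊓ W`, intersected with `W`, is by modularity a complement of the range
  -- of `L`.
  obtain ⟨C', hC'⟩ := (L.toLinearMap.range ⊓ W).exists_isCompl
  set R := L.toLinearMap.range with hR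
  have hdisj : R ⊓ (C' ⊓ W) = ⊥ := by
    rw [show R ⊓ (C' ⊓ W) = (R ⊓ W) ⊓ C' by ac_rfl]
    exact hC'.inf_eq_bot
  have hsup : R ⊔ (C' ⊓ W) = ⊤ := by
    rw [eq_top_iff, ← hW]
    refine sup_le le_sup_left ?_
    have h1 : W = (R ⊓ W) ⊔ C' ⊓ W := by
      rw [← sup_inf_assoc_of_le C' (inf_le_right : R ⊓ W ≤ W), hC'.sup_eq_top, top_inf_eq]
    calc W ≤ (R ⊓ W) ⊔ C' ⊓ W := h1.le
      _ ≤ _ := sup_le_sup_right inf_le_left _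
  have hcompl : IsCompl R (C' ⊓ W) := ⟨disjoint_iff.2 hdisj, codisjoint_iff.2 hsup⟩
  have hRdim : Module.finrank ℝ R = Module.finrank ℝ E := LinearMap.finrank_range_of_inj hL
  have hCdim : Module.finrank ℝ F = Module.finrank ℝ (C' ⊓ W : Submodule ℝ E') := by
    have := Submodule.finrank_add_eq_of_isCompl hcompl
    omega
  set a : F ≃ₗ[ℝ] (C' ⊓ W : Submodule ℝ E') := LinearEquiv.ofFinrankEq _ _ hCdim
  set A : F →ₗ[ℝ] E' := (C' ⊓ W).subtype ∘ₗ a.toLinearMap with hA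
  have hAmem : ∀ u, A u ∈ C' ⊓ W := fun u => (a u).2
  have hinj : Function.Injective (L.toLinearMap.coprod A) := by
    rw [injective_iff_map_eq_zero]
    rintro ⟨x, u⟩ h
    rw [LinearMap.coprod_apply] at h
    have h1 : L x = - A u := eq_neg_of_add_eq_zero_left h
    have h2 : L x ∈ R ⊓ (C' ⊓ W) := by
      refine ⟨⟨x, rfl⟩, ?_⟩
      rw [h1]
      exact neg_mem (hAmem u)
    rw [hdisj, Submodule.mem_bot] at h2
    have hx : x = 0 := hL (by rw [h2, map_zero])
    have hu : a u = 0 := by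
      have : A u = 0 := by rw [h2] at h1; simpa using h1.symm
      exact Subtype.ext this
    rw [hx, (a.map_eq_zero_iff).1 hu]
    rfl
  refine ⟨LinearMap.toContinuousLinearMap A,
    (LinearMap.linearEquivOfInjective _ hinj
      (by rw [Module.finrank_prod]; exact hdim)).toContinuousLinearEquiv,
    fun u => (hAmem u).2, fun x u => ?_⟩
  simp

/-- The kernels of the two functionals have equal dimension; an isomorphism between them extends by
`e ↦ e'`. This identifies a half space in a product with the model half space. -/
theorem exists_equiv_intertwining (hdim : Module.finrank ℝ E = Module.finrank ℝ E')
    {ℓ : E →L[ℝ] ℝ} {ℓ' : E' →L[ℝ] ℝ} {e : E} {e' : E'} (he : ℓ e = 1) (he' : ℓ' e' = 1) :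
    ∃ T : E ≃L[ℝ] E', ∀ x, ℓ' (T x) = ℓ x := by
  have h1 : ℓ.toLinearMap ≠ 0 := fun h => by
    have := congrArg (fun f => f e) h
    simp [he] at this
  have h2 : ℓ'.toLinearMap ≠ 0 := fun h => by
    have := congrArg (fun f => f e') h
    simp [he'] at this
  have h3 := Module.Dual.finrank_ker_add_one_of_ne_zero h1
  have h4 := Module.Dual.finrank_ker_add_one_of_ne_zero h2
  obtain ⟨k⟩ : Nonempty (LinearMap.ker ℓ.toLinearMap ≃ₗ[ℝ] LinearMap.ker ℓ'.toLinearMap) :=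
    ⟨LinearEquiv.ofFinrankEq _ _ (by omega)⟩
  set p : E →ₗ[ℝ] LinearMap.ker ℓ.toLinearMap :=
    LinearMap.codRestrict _ (LinearMap.id - ℓ.toLinearMap.smulRight e) (fun x => by simp [he])
  have hp : ∀ x, (p x : E) = x - ℓ x • e := fun x => rfl
  set g : E →ₗ[ℝ] E' := (LinearMap.ker ℓ'.toLinearMap).subtype ∘ₗ k.toLinearMap ∘ₗ p
    + ℓ.toLinearMap.smulRight e' with hg
  have hgx : ∀ x, g x = (k (p x) : E') + ℓ x • e' := fun x => by simp [hg]
  have hk : ∀ y, ℓ' (k y : E') = 0 := fun y => (k y).2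
  have hℓ : ∀ x, ℓ' (g x) = ℓ x := fun x => by simp [hgx, hk, he']
  have hinj : Function.Injective g := by
    rw [injective_iff_map_eq_zero]
    intro x hx
    have h0 : ℓ x = 0 := by rw [← hℓ, hx, map_zero]
    have h5 : k (p x) = 0 := by
      apply Subtype.ext
      simpa [hgx, h0] using hx
    have h6 : p x = 0 := (k.map_eq_zero_iff).1 h5
    have h7 := hp x
    rw [h6, h0] at h7
    simpa using h7.symm
  exact ⟨(LinearMap.linearEquivOfInjective g hinj hdim).toContinuousLinearEquiv,
    fun x => by simpa using hℓ x⟩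

end LinearAlgebra

/-! ### Differentials, immersions and local inverses on manifolds. -/

section Differentials

variable {E E' E'' : Type*} [NormedAddCommGroup E] [NormedSpace ℝ E]
  [NormedAddCommGroup E'] [NormedSpace ℝ E'] [NormedAddCommGroup E''] [NormedSpace ℝ E'']
  {H H' H'' : Type*} [TopologicalSpace H] [TopologicalSpace H'] [TopologicalSpace H'']
  {I : ModelWithCorners ℝ E H} {J : ModelWithCorners ℝ E' H'} {J' : ModelWithCorners ℝ E'' H''}
  {M N N' : Type*} [TopologicalSpace M] [ChartedSpace H M] [TopologicalSpace N] [ChartedSpace H' N]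
  [TopologicalSpace N'] [ChartedSpace H'' N']

theorem hasMFDerivAt_of_comp_within {F : M → N} {G : N → N'} {K : M → N'} {u : Set N} {x : M}
    (hF : MDifferentiableAt I J F x) (hG : MDifferentiableWithinAt J J' G u (F x))
    (hu : ∀ᶠ x' in 𝓝 x, F x' ∈ u) (hK : ∀ᶠ x' in 𝓝 x, G (F x') = K x') :
    HasMFDerivAt I J' K x ((mfderivWithin J J' G u (F x)).comp (mfderiv I J F x)) := by
  have h1 : HasMFDerivWithinAt I J' (G ∘ F) (F ⁻¹' u) x _ :=
    HasMFDerivWithinAt.comp x hG.hasMFDerivWithinAt hF.hasMFDerivAt.hasMFDerivWithinAt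
      (subset_refl _)
  have h2 := h1.hasMFDerivAt hu
  exact h2.congr_of_eventuallyEq (by
    filter_upwards [hK] with y hy
    exact hy.symm)

variable (I J) in
/-- The differential of a map, as a map between the model vector spaces. -/
def chartDeriv (F : M → N) (x : M) : E →L[ℝ] E' := mfderiv I J F x

theorem chartDeriv_apply_of_comp_within {F : M → N} {G : N → N'} {K : M → N'} {u : Set N} {x : M}
    (hF : MDifferentiableAt I J F x) (hG : MDifferentiableWithinAt J J' G u (F x))
    (hu : ∀ᶠ x' in 𝓝 x, F x' ∈ u) (hK : ∀ᶠ x' in 𝓝 x, G (F x') = K x') (w : E) :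
    chartDeriv I J' K x w
      = (show E' →L[ℝ] E'' from mfderivWithin J J' G u (F x)) (chartDeriv I J F x w) := by
  rw [chartDeriv, (hasMFDerivAt_of_comp_within hF hG hu hK).mfderiv]
  rfl

theorem chartDeriv_apply_of_comp {F : M → N} {G : N → N'} {K : M → N'} {x : M}
    (hF : MDifferentiableAt I J F x) (hG : MDifferentiableAt J J' G (F x))
    (hK : ∀ᶠ x' in 𝓝 x, G (F x') = K x') (w : E) :
    chartDeriv I J' K x w = chartDeriv J J' G (F x) (chartDeriv I J F x w) := by
  rw [chartDeriv_apply_of_comp_within (u := univ) hF hG.mdifferentiableWithinAt (by simp) hK,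
    mfderivWithin_univ]
  rfl

theorem chartDeriv_apply_eq_zero_of_comp {F : M → N} {G : N → N'} {K : M → N'} {x : M}
    (hF : MDifferentiableAt I J F x) (hG : MDifferentiableAt J J' G (F x))
    (hK : ∀ᶠ x' in 𝓝 x, G (F x') = K x') {w : E} (hw : chartDeriv I J F x w = 0) :
    chartDeriv I J' K x w = 0 := by
  rw [chartDeriv_apply_of_comp hF hG hK, hw, map_zero]

theorem chartDeriv_clm (ℓ : E →L[ℝ] E') (z : E) : chartDeriv 𝓘(ℝ, E) 𝓘(ℝ, E') ℓ z = ℓ := by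
  rw [chartDeriv, mfderiv_eq_fderiv, ContinuousLinearMap.fderiv]

theorem Filter.EventuallyEq.chartDeriv_eq {F G : M → N} {x : M} (h : F =ᶠ[𝓝 x] G) :
    chartDeriv I J F x = chartDeriv I J G x := h.mfderiv_eq

/-- A map with a differentiable left inverse up to a map with injective differential has injective
differential. -/
theorem injective_mfderiv_of_comp_within {F : M → N} {G : N → N'} {K : M → N'} {u : Set N} {x : M}
    (hF : MDifferentiableAt I J F x) (hG : MDifferentiableWithinAt J J' G u (F x))
    (hu : ∀ᶠ x' in 𝓝 x, F x' ∈ u) (hK : ∀ᶠ x' in 𝓝 x, G (F x') = K x')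
    (hinj : Function.Injective (mfderiv I J' K x)) : Function.Injective (mfderiv I J F x) := by
  intro a b hab
  apply hinj
  have h1 := chartDeriv_apply_of_comp_within (I := I) hF hG hu hK
  exact (h1 a).trans ((congrArg _ hab).trans (h1 b).symm)

theorem injective_mfderiv_iff {F : M → N} {x : M} : Function.Injective (mfderiv I J F x) ↔
    ∀ w : E, chartDeriv I J F x w = 0 → w = 0 :=
  injective_iff_map_eq_zero (chartDeriv I J F x)

theorem OpenPartialHomeomorph.injective_mfderiv_extend {e : OpenPartialHomeomorph M H}
    (he : e ∈ IsManifold.maximalAtlas I ∞ M) {x : M} (hx : x ∈ e.source) :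
    Function.Injective (mfderiv I 𝓘(ℝ, E) (e.extend I) x) := by
  have hev : ∀ᶠ x' in 𝓝 x, x' ∈ e.source := e.open_source.mem_nhds hx
  have hmem : ∀ x' ∈ e.source, e.extend I x' ∈ I '' e.target := fun x' hx' =>
    ⟨e x', e.map_source hx', rfl⟩
  refine injective_mfderiv_of_comp_within (G := (e.extend I).symm) (K := id) (u := I '' e.target)
    (J' := I) ((e.contMDiffAt_extend he hx).mdifferentiableAt (by simp))
    ((contMDiffOn_extend_symm he _ (hmem x hx)).mdifferentiableWithinAt (by simp)) ?_ ?_ ?_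
  · filter_upwards [hev] with x' hx' using hmem x' hx'
  · filter_upwards [hev] with x' hx'
    exact e.extend_left_inv hx'
  · rw [mfderiv_id]
    exact Function.injective_id

/-- In immersion charts the map is a linear inclusion into a product, so the codomain chart followed
by the projection to the first factor recovers the domain chart. -/
theorem Manifold.IsImmersionAt.injective_mfderiv {f : M → N} {x : M}
    (hf : IsImmersionAt I J ∞ f x) : Function.Injective (mfderiv I J f x) := by
  have hxs : x ∈ hf.domChart.source := hf.mem_domChart_source
  have hev : ∀ᶠ x' in 𝓝 x, x' ∈ hf.domChart.source := hf.domChart.open_source.mem_nhds hxs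
  set A : E' →L[ℝ] E := (ContinuousLinearMap.fst ℝ E hf.complement).comp
    (hf.equiv.symm : E' →L[ℝ] E × hf.complement)
  have hG : ContMDiffAt J 𝓘(ℝ, E) ∞ (fun y => A (hf.codChart.extend J y)) (f x) :=
    A.contMDiff.contMDiffAt.comp _ (hf.codChart.contMDiffAt_extend hf.codChart_mem_maximalAtlas
      hf.mem_codChart_source)
  refine injective_mfderiv_of_comp_within (u := univ) (K := hf.domChart.extend I)
    (hf.contMDiffAt.mdifferentiableAt (by simp))
    (hG.mdifferentiableAt (by simp)).mdifferentiableWithinAt (by simp) ?_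
    (hf.domChart.injective_mfderiv_extend hf.domChart_mem_maximalAtlas hxs)
  filter_upwards [hev] with x' hx'
  have h1 : hf.domChart.extend I x' ∈ (hf.domChart.extend I).target :=
    (hf.domChart.extend I).map_source (by rwa [hf.domChart.extend_source])
  have h2 := hf.writtenInCharts h1
  simp only [Function.comp_apply, hf.domChart.extend_left_inv hx'] at h2
  rw [h2]
  simp [A]

theorem Manifold.IsSmoothEmbedding.injective_mfderiv {f : M → N}
    (hf : IsSmoothEmbedding I J ∞ f) (x : M) : Function.Injective (mfderiv I J f x) :=
  (hf.isImmersion.isImmersionAt x).injective_mfderiv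

/-- The inverse function theorem on manifolds, at interior points. -/
theorem exists_localInverse_of_bijective_mfderiv [CompleteSpace E] [CompleteSpace E']
    [IsManifold I ∞ M] [IsManifold J ∞ N] {f : M → N} {x : M}
    (hf : ContMDiffAt I J ∞ f x) (hx : I.IsInteriorPoint x)
    (hbij : Function.Bijective (mfderiv I J f x)) :
    ∃ G : N → M, ContMDiffAt J I ∞ G (f x) ∧ G (f x) = x ∧ (∀ᶠ y in 𝓝 (f x), f (G y) = y) ∧
      ∀ᶠ x' in 𝓝 x, G (f x') = x' := by
  have hmd : MDifferentiableAt I J f x := hf.mdifferentiableAt (by simp)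
  have hfx : J.IsInteriorPoint (f x) := hmd.isInteriorPoint_of_surjective_mfderiv hbij.2 hx
  set fh := writtenInExtChartAt I J x f with hfh
  set φ := extChartAt I x
  set ψ := extChartAt J (f x)
  have hfs : ContDiffAt ℝ ∞ fh (φ x) :=
    (contMDiffAt_iff.1 hf).2.contDiffAt (range_mem_nhds_isInteriorPoint hx)
  set L : E ≃L[ℝ] E' := ContinuousLinearEquiv.ofBijective
    (show E →L[ℝ] E' from mfderiv I J f x) (LinearMap.ker_eq_bot.2 hbij.1)
    (LinearMap.range_eq_top.2 hbij.2)
  have hL : HasFDerivAt fh (L : E →L[ℝ] E') (φ x) :=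
    hmd.hasMFDerivAt.2.hasFDerivAt (range_mem_nhds_isInteriorPoint hx)
  have hstrict := hfs.hasStrictFDerivAt' hL (by simp)
  set g := hfs.localInverse hL (by simp) with hg
  have hgs : ContDiffAt ℝ ∞ g (fh (φ x)) := hfs.to_localInverse hL (by simp)
  have hfhx : fh (φ x) = ψ (f x) := by
    simp [hfh, writtenInExtChartAt, φ, ψ]
  have hgx : g (ψ (f x)) = φ x := by
    rw [← hfhx]
    exact hstrict.localInverse_apply_image
  have hgr : ∀ᶠ y in 𝓝 (ψ (f x)), fh (g y) = y := hfhx ▸ hstrict.eventually_right_inverse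
  have hgl : ∀ᶠ z in 𝓝 (φ x), g (fh z) = z := hstrict.eventually_left_inverse
  rw [hfhx] at hgs
  have hψ : ContMDiffAt J 𝓘(ℝ, E') ∞ ψ (f x) := contMDiffAt_extChartAt
  have hφ : ContMDiffAt I 𝓘(ℝ, E) ∞ φ x := contMDiffAt_extChartAt
  have htarget : φ.target ∈ 𝓝 (φ x) :=
    mem_interior_iff_mem_nhds.1 (I.isInteriorPoint_iff.1 hx)
  have hφs : ContMDiffAt 𝓘(ℝ, E) I ∞ φ.symm (φ x) :=
    (contMDiffOn_extChartAt_symm x).contMDiffAt htarget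
  have hφφ : φ.symm (φ x) = x := extChartAt_to_inv x
  have hc1 : ContMDiffAt J 𝓘(ℝ, E) ∞ (g ∘ ψ) (f x) := hgs.contMDiffAt.comp (f x) hψ
  have hG : ContMDiffAt J I ∞ (φ.symm ∘ (g ∘ ψ)) (f x) := by
    refine ContMDiffAt.comp (f x) ?_ hc1
    rw [Function.comp_apply, hgx]
    exact hφs
  refine ⟨φ.symm ∘ (g ∘ ψ), hG, by simp [hgx, hφφ], ?_, ?_⟩
  · have e1 : ∀ᶠ y in 𝓝 (f x), fh (g (ψ y)) = ψ y := hψ.continuousAt.eventually hgr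
    have e2 : ∀ᶠ y in 𝓝 (f x), y ∈ ψ.source := extChartAt_source_mem_nhds _
    have e3 : ∀ᶠ y in 𝓝 (f x), f ((φ.symm ∘ (g ∘ ψ)) y) ∈ ψ.source := by
      have hcont : ContinuousAt (fun y => f ((φ.symm ∘ (g ∘ ψ)) y)) (f x) := by
        refine ContinuousAt.comp (g := f) ?_ hG.continuousAt
        simpa [hgx, hφφ] using hf.continuousAt
      refine hcont.eventually ?_
      have hff : f ((φ.symm ∘ (g ∘ ψ)) (f x)) = f x := by simp [hgx, hφφ]
      change ∀ᶠ y in 𝓝 (f ((φ.symm ∘ (g ∘ ψ)) (f x))), y ∈ ψ.source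
      rw [hff]
      exact extChartAt_source_mem_nhds (I := J) (f x)
    filter_upwards [e1, e2, e3] with y h1 h2 h3
    exact ψ.injOn h3 h2 h1
  · have e1 : ∀ᶠ x' in 𝓝 x, g (fh (φ x')) = φ x' := hφ.continuousAt.eventually hgl
    have e2 : ∀ᶠ x' in 𝓝 x, x' ∈ φ.source := extChartAt_source_mem_nhds _
    filter_upwards [e1, e2] with x' h1 h2
    have h3 : φ.symm (φ x') = x' := φ.left_inv h2
    have h4 : fh (φ x') = ψ (f x') := by
      simp only [hfh, writtenInExtChartAt, Function.comp_apply]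
      rw [h3]
    simp only [Function.comp_apply]
    rw [← h4, h1, h3]

end Differentials


/-! ### Boundary defining functions. -/

section HalfSpaceManifold

/-- The coordinate of `ℝⁿ` that is nonnegative on the Euclidean half space. -/
def halfSpaceCoord (n : ℕ) [NeZero n] : EuclideanSpace ℝ (Fin n) →L[ℝ] ℝ :=
  EuclideanSpace.proj 0

/-- The inward normal of the Euclidean half space. -/
def inwardNormal (n : ℕ) [NeZero n] : EuclideanSpace ℝ (Fin n) := EuclideanSpace.single 0 1

variable {n : ℕ} [NeZero n]

@[simp] theorem halfSpaceCoord_inwardNormal : halfSpaceCoord n (inwardNormal n) = 1 := by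
  simp [halfSpaceCoord, inwardNormal]

theorem range_halfSpace_eq : range (𝓡∂ n) = {x | 0 ≤ halfSpaceCoord n x} :=
  range_modelWithCornersEuclideanHalfSpace n

/-- At a minimum on the wall the derivative is nonnegative in every direction that does not leave
the half space. Tangential directions occur with both signs, so it vanishes on them and only the
normal component is left. -/
theorem hasFDerivWithinAt_boundary_min {g : EuclideanSpace ℝ (Fin n) → ℝ}
    {g' : EuclideanSpace ℝ (Fin n) →L[ℝ] ℝ} {z : EuclideanSpace ℝ (Fin n)}
    (hg : HasFDerivWithinAt g g' {z | 0 ≤ halfSpaceCoord n z} z) (hz : halfSpaceCoord n z = 0)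
    (hmin : IsLocalMinOn g {z | 0 ≤ halfSpaceCoord n z} z) :
    0 ≤ g' (inwardNormal n) ∧ ∀ w, g' w = halfSpaceCoord n w * g' (inwardNormal n) := by
  have hpos : ∀ w, 0 ≤ halfSpaceCoord n w → 0 ≤ g' w := by
    intro w hw
    refine hmin.hasFDerivWithinAt_nonneg hg (mem_posTangentConeAt_of_segment_subset ?_)
    refine (convex_halfSpace_ge (halfSpaceCoord n).isLinear 0).segment_subset ?_ ?_
    · exact hz.ge
    · change 0 ≤ halfSpaceCoord n (z + w)
      rw [map_add, hz, zero_add]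
      exact hw
  refine ⟨hpos _ (by rw [halfSpaceCoord_inwardNormal]; exact zero_le_one), fun w => ?_⟩
  have h0 : ∀ w, halfSpaceCoord n w = 0 → g' w = 0 := fun w hw => by
    refine le_antisymm ?_ (hpos w hw.ge)
    have := hpos (-w) (by rw [map_neg, hw, neg_zero])
    rw [map_neg] at this
    linarith
  have h1 := h0 (w - halfSpaceCoord n w • inwardNormal n) (by simp)
  rw [map_sub, map_smul, smul_eq_mul, sub_eq_zero] at h1
  exact h1

variable {X : Type*} [TopologicalSpace X] [ChartedSpace (EuclideanHalfSpace n) X]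

theorem halfSpaceCoord_extChartAt_nonneg (y x : X) :
    0 ≤ halfSpaceCoord n (extChartAt (𝓡∂ n) y x) := by
  have : extChartAt (𝓡∂ n) y x ∈ range (𝓡∂ n) := ⟨chartAt _ y x, rfl⟩
  rwa [range_halfSpace_eq] at this

theorem mem_interior_iff_halfSpaceCoord_pos [IsManifold (𝓡∂ n) ∞ X] {x y : X}
    (hx : x ∈ (chartAt (EuclideanHalfSpace n) y).source) :
    x ∈ (𝓡∂ n).interior X ↔ 0 < halfSpaceCoord n (extChartAt (𝓡∂ n) y x) := by
  have h1 := (𝓡∂ n).isInteriorPoint_iff_of_mem_atlas (n := ∞) (M := X) (by simp)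
    (chart_mem_atlas (EuclideanHalfSpace n) y) hx
  have h2 : {y : EuclideanSpace ℝ (Fin n) | 0 < y 0} = {y | 0 < halfSpaceCoord n y} := rfl
  rw [ModelWithCorners.interior, mem_ofPred_eq, h1]
  constructor
  · intro h
    have h3 := OpenPartialHomeomorph.interior_extend_target_subset_interior_range _ h
    rw [interior_range_modelWithCornersEuclideanHalfSpace] at h3
    exact h3
  · intro h
    refine OpenPartialHomeomorph.mem_interior_extend_target _
      ((chartAt (EuclideanHalfSpace n) y).map_source hx) ?_
    rw [interior_range_modelWithCornersEuclideanHalfSpace]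
    exact h

theorem mem_boundary_iff_halfSpaceCoord_eq_zero [IsManifold (𝓡∂ n) ∞ X] {x y : X}
    (hx : x ∈ (chartAt (EuclideanHalfSpace n) y).source) :
    x ∈ (𝓡∂ n).boundary X ↔ halfSpaceCoord n (extChartAt (𝓡∂ n) y x) = 0 := by
  rw [← (𝓡∂ n).compl_interior, mem_compl_iff, mem_interior_iff_halfSpaceCoord_pos hx, not_lt]
  exact ⟨fun h => le_antisymm h (halfSpaceCoord_extChartAt_nonneg _ _), fun h => h.le⟩

/-- At a boundary minimum, a function has a differential that is a nonnegative multiple of the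
inward conormal. -/
theorem mfderiv_eq_of_boundary_min {D : X → ℝ} {x : X} [IsManifold (𝓡∂ n) ∞ X]
    (hD : MDifferentiableAt (𝓡∂ n) 𝓘(ℝ, ℝ) D x) (hx : x ∈ (𝓡∂ n).boundary X)
    (hmin : ∀ᶠ y in 𝓝 x, D x ≤ D y) :
    0 ≤ chartDeriv (𝓡∂ n) 𝓘(ℝ, ℝ) D x (inwardNormal n) ∧
    ∀ w : EuclideanSpace ℝ (Fin n), chartDeriv (𝓡∂ n) 𝓘(ℝ, ℝ) D x w
      = halfSpaceCoord n w *
        chartDeriv (𝓡∂ n) 𝓘(ℝ, ℝ) D x (inwardNormal n) := by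
  set D' : EuclideanSpace ℝ (Fin n) →L[ℝ] ℝ := mfderiv (𝓡∂ n) 𝓘(ℝ, ℝ) D x with hD'
  have hder := hD.hasMFDerivAt.2
  rw [range_halfSpace_eq] at hder
  set φ := extChartAt (𝓡∂ n) x with hφ
  have hx0 : halfSpaceCoord n (φ x) = 0 :=
    (mem_boundary_iff_halfSpaceCoord_eq_zero (mem_chart_source _ x)).1 hx
  have hwr : writtenInExtChartAt (𝓡∂ n) 𝓘(ℝ, ℝ) x D = D ∘ φ.symm := by
    rfl
  rw [hwr] at hder
  have hφx : φ.symm (φ x) = x := extChartAt_to_inv x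
  have hlm : IsLocalMinOn (D ∘ φ.symm) {z | 0 ≤ halfSpaceCoord n z} (φ x) := by
    have h1 : ∀ᶠ z in 𝓝 (φ x), D x ≤ D (φ.symm z) := by
      have h2 : ContinuousAt φ.symm (φ x) := continuousAt_extChartAt_symm x
      exact h2.eventually (by rw [hφx]; exact hmin)
    refine Filter.Eventually.filter_mono nhdsWithin_le_nhds ?_
    simpa [hφx] using h1
  exact hasFDerivWithinAt_boundary_min hder hx0 hlm

/-- The defining properties of a boundary defining function, with positivity tested on `s`. -/
def IsBoundaryDefiningOn (n : ℕ) [NeZero n] {X : Type*} [TopologicalSpace X]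
    [ChartedSpace (EuclideanHalfSpace n) X] (d : X → ℝ) (s : Set X) : Prop :=
  ContMDiff (𝓡∂ n) 𝓘(ℝ, ℝ) ∞ d ∧ (∀ x, 0 ≤ d x) ∧ (∀ x ∈ (𝓡∂ n).boundary X, d x = 0) ∧
    (∀ x ∈ s, x ∈ (𝓡∂ n).interior X → 0 < d x) ∧
    ∀ x ∈ s, x ∈ (𝓡∂ n).boundary X →
      0 < chartDeriv (𝓡∂ n) 𝓘(ℝ, ℝ) d x (inwardNormal n)

theorem IsBoundaryDefiningOn.mfderiv_nonneg [IsManifold (𝓡∂ n) ∞ X] {d : X → ℝ} {s : Set X}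
    (hd : IsBoundaryDefiningOn n d s) {x : X} (hx : x ∈ (𝓡∂ n).boundary X) :
    0 ≤ chartDeriv (𝓡∂ n) 𝓘(ℝ, ℝ) d x (inwardNormal n) ∧
    ∀ w : EuclideanSpace ℝ (Fin n), chartDeriv (𝓡∂ n) 𝓘(ℝ, ℝ) d x w
      = halfSpaceCoord n w *
        chartDeriv (𝓡∂ n) 𝓘(ℝ, ℝ) d x (inwardNormal n) :=
  mfderiv_eq_of_boundary_min (hd.1.contMDiffAt.mdifferentiableAt (by simp)) hx
    (Filter.Eventually.of_forall fun y => by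
      simpa [hd.2.2.1 x hx] using hd.2.1 y)

/-- At a boundary point both differentials are nonnegative on the inward normal, so a positive one
is not cancelled in the sum. -/
theorem IsBoundaryDefiningOn.union [IsManifold (𝓡∂ n) ∞ X] {d d' : X → ℝ} {s s' : Set X}
    (hd : IsBoundaryDefiningOn n d s) (hd' : IsBoundaryDefiningOn n d' s') :
    IsBoundaryDefiningOn n (d + d') (s ∪ s') := by
  refine ⟨hd.1.add hd'.1, fun x => add_nonneg (hd.2.1 x) (hd'.2.1 x),
    fun x hx => by rw [Pi.add_apply, hd.2.2.1 x hx, hd'.2.2.1 x hx, add_zero], ?_, ?_⟩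
  · rintro x (hx | hx) hi
    · exact add_pos_of_pos_of_nonneg (hd.2.2.2.1 x hx hi) (hd'.2.1 x)
    · exact add_pos_of_nonneg_of_pos (hd.2.1 x) (hd'.2.2.2.1 x hx hi)
  · intro x hx hb
    have h1 := (hd.mfderiv_nonneg hb).1
    have h2 := (hd'.mfderiv_nonneg hb).1
    have h3 : chartDeriv (𝓡∂ n) 𝓘(ℝ, ℝ) (d + d') x (inwardNormal n)
      = chartDeriv (𝓡∂ n) 𝓘(ℝ, ℝ) d x (inwardNormal n)
      + chartDeriv (𝓡∂ n) 𝓘(ℝ, ℝ) d' x (inwardNormal n) := by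
      rw [chartDeriv, mfderiv_add (hd.1.contMDiffAt.mdifferentiableAt (by simp))
        (hd'.1.contMDiffAt.mdifferentiableAt (by simp))]
      rfl
    rw [h3]
    rcases hx with hx | hx
    · exact add_pos_of_pos_of_nonneg (hd.2.2.2.2 x hx hb) h2
    · exact add_pos_of_nonneg_of_pos h1 (hd'.2.2.2.2 x hx hb)

/-- The chart is centred at `y`, whereas the normal at `x` is read in the chart centred at `x`. The
coordinate has a minimum at `x`, so its differential is a nonnegative multiple of the conormal; it
is nonzero because the differential of a chart is invertible. -/
theorem mfderiv_halfSpaceCoord_extChartAt_pos [IsManifold (𝓡∂ n) ∞ X] {x y : X}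
    (hx : x ∈ (chartAt (EuclideanHalfSpace n) y).source) (hb : x ∈ (𝓡∂ n).boundary X) :
    0 < chartDeriv (𝓡∂ n) 𝓘(ℝ, ℝ) (fun z => halfSpaceCoord n (extChartAt (𝓡∂ n) y z)) x (inwardNormal n) := by
  have hψ : MDifferentiableAt (𝓡∂ n) 𝓘(ℝ, EuclideanSpace ℝ (Fin n)) (extChartAt (𝓡∂ n) y) x :=
    (contMDiffAt_extChartAt' (n := ∞) hx).mdifferentiableAt (by simp)
  have hc : MDifferentiableAt 𝓘(ℝ, EuclideanSpace ℝ (Fin n)) 𝓘(ℝ, ℝ) (halfSpaceCoord n)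
      (extChartAt (𝓡∂ n) y x) := (halfSpaceCoord n).differentiableAt.mdifferentiableAt
  have hD := hc.comp x hψ
  have h1 := mfderiv_eq_of_boundary_min hD hb (Filter.Eventually.of_forall fun z => by
    have := (mem_boundary_iff_halfSpaceCoord_eq_zero hx).1 hb
    simp only [Function.comp_apply]
    rw [this]
    exact halfSpaceCoord_extChartAt_nonneg _ _)
  have : IsManifold (𝓡∂ n) 1 X := IsManifold.of_le (n := ∞) (by simp)
  obtain ⟨w, hw⟩ : ∃ w, chartDeriv (𝓡∂ n) 𝓘(ℝ, EuclideanSpace ℝ (Fin n))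
      (extChartAt (𝓡∂ n) y) x w = inwardNormal n := by
    obtain ⟨A, hA⟩ := isInvertible_mfderiv_extChartAt (I := 𝓡∂ n) (x := y) (y := x)
      (by rwa [extChartAt_source])
    exact ⟨A.symm (inwardNormal n),
      (congrArg (fun T => T (A.symm (inwardNormal n))) hA.symm).trans (A.apply_symm_apply _)⟩
  have h2 : chartDeriv (𝓡∂ n) 𝓘(ℝ, ℝ) (halfSpaceCoord n ∘ extChartAt (𝓡∂ n) y) x w = 1 := by
    rw [chartDeriv_apply_of_comp (K := halfSpaceCoord n ∘ extChartAt (𝓡∂ n) y) hψ hc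
      (Filter.Eventually.of_forall fun _ => rfl), hw,
      chartDeriv_clm, halfSpaceCoord_inwardNormal]
  refine lt_of_le_of_ne h1.1 fun h0 => ?_
  rw [h1.2, show chartDeriv (𝓡∂ n) 𝓘(ℝ, ℝ) (halfSpaceCoord n ∘ extChartAt (𝓡∂ n) y) x
    (inwardNormal n) = 0 from h0.symm, mul_zero] at h2
  exact zero_ne_one h2

/-- Normal coordinates of charts, cut off by bump functions, are nonnegative and vanish on the
boundary. Finitely many of them can be added without losing positivity, and compactness does the
rest. -/
theorem exists_boundaryDefining (n : ℕ) [NeZero n] (X : Type*) [TopologicalSpace X]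
    [ChartedSpace (EuclideanHalfSpace n) X] [IsManifold (𝓡∂ n) ∞ X] [T2Space X] [CompactSpace X] :
    ∃ d : X → ℝ, IsBoundaryDefiningOn n d univ := by
  refine isCompact_univ.induction_on (p := fun s => ∃ d : X → ℝ, IsBoundaryDefiningOn n d s)
    ⟨fun _ => 0, contMDiff_const, by simp, by simp, by simp, by simp⟩ ?_ ?_ ?_
  · rintro s t hst ⟨d, h1, h2, h3, h4, h5⟩
    exact ⟨d, h1, h2, h3, fun x hx => h4 x (hst hx), fun x hx => h5 x (hst hx)⟩
  · rintro s t ⟨d, hd⟩ ⟨d', hd'⟩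
    exact ⟨_, hd.union hd'⟩
  · intro y _
    obtain ⟨f⟩ : Nonempty (SmoothBumpFunction (𝓡∂ n) y) := inferInstance
    set c : X → ℝ := fun z => halfSpaceCoord n (extChartAt (𝓡∂ n) y z) with hc
    have hcs : ContMDiffOn (𝓡∂ n) 𝓘(ℝ, ℝ) ∞ c (chartAt (EuclideanHalfSpace n) y).source :=
      (halfSpaceCoord n).contMDiff.comp_contMDiffOn (contMDiffOn_extChartAt (x := y))
    have hfc : ContMDiff (𝓡∂ n) 𝓘(ℝ, ℝ) ∞ fun x => f x • c x := f.contMDiff_smul hcs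
    set s : Set X := {x | x ∈ (chartAt (EuclideanHalfSpace n) y).source ∧ ∀ᶠ z in 𝓝 x, f z = 1}
    have hs : s ∈ 𝓝 y := by
      have h1 : ∀ᶠ x in 𝓝 y, x ∈ (chartAt (EuclideanHalfSpace n) y).source :=
        (chartAt _ y).open_source.mem_nhds (mem_chart_source _ y)
      have h2 : ∀ᶠ x in 𝓝 y, ∀ᶠ z in 𝓝 x, f z = 1 :=
        f.eventuallyEq_one.eventually_nhds
      exact h1.and h2
    refine ⟨s, by rwa [nhdsWithin_univ], fun x => f x • c x, hfc, fun x => ?_, fun x hx => ?_, ?_, ?_⟩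
    · exact smul_nonneg f.nonneg (halfSpaceCoord_extChartAt_nonneg _ _)
    · by_cases hxs : x ∈ (chartAt (EuclideanHalfSpace n) y).source
      · change f x • c x = 0
        rw [show c x = 0 from (mem_boundary_iff_halfSpaceCoord_eq_zero hxs).1 hx, smul_zero]
      · have : f x = 0 := by
          by_contra h
          exact hxs (f.support_subset_source h)
        change f x • c x = 0
        rw [this, zero_smul]
    · rintro x ⟨hxs, hx1⟩ hi
      change 0 < f x • c x
      rw [hx1.self_of_nhds, one_smul]
      exact (mem_interior_iff_halfSpaceCoord_pos hxs).1 hi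
    · rintro x ⟨hxs, hx1⟩ hb
      have h1 : (fun x => f x • c x) =ᶠ[𝓝 x] c := by
        filter_upwards [hx1] with z hz
        rw [hz, one_smul]
      rw [h1.chartDeriv_eq]
      exact mfderiv_halfSpaceCoord_extChartAt_pos hxs hb

end HalfSpaceManifold


/-! ### Changing charts by homeomorphisms that respect the model half space. -/

section ModelHomeomorph

variable {E H : Type*} [NormedAddCommGroup E] [NormedSpace ℝ E] [TopologicalSpace H]

/-- A partial homeomorphism of the model vector space preserving the range of the model with
corners induces a partial homeomorphism of the model space. -/
def ModelWithCorners.inducedHomeomorph (I : ModelWithCorners ℝ E H)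
    (Θ : OpenPartialHomeomorph E E) (h : ∀ y ∈ Θ.source, y ∈ range I → Θ y ∈ range I)
    (h' : ∀ y ∈ Θ.target, y ∈ range I → Θ.symm y ∈ range I) : OpenPartialHomeomorph H H where
  toFun p := I.symm (Θ (I p))
  invFun p := I.symm (Θ.symm (I p))
  source := I ⁻¹' Θ.source
  target := I ⁻¹' Θ.target
  map_source' p hp := by
    rw [mem_preimage, I.right_inv (h _ hp ⟨p, rfl⟩)]
    exact Θ.map_source hp
  map_target' p hp := by
    rw [mem_preimage, I.right_inv (h' _ hp ⟨p, rfl⟩)]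
    exact Θ.map_target hp
  left_inv' p hp := by
    rw [I.right_inv (h _ hp ⟨p, rfl⟩), Θ.left_inv hp, I.left_inv]
  right_inv' p hp := by
    rw [I.right_inv (h' _ hp ⟨p, rfl⟩), Θ.right_inv hp, I.left_inv]
  open_source := Θ.open_source.preimage I.continuous
  open_target := Θ.open_target.preimage I.continuous
  continuousOn_toFun := I.continuous_symm.comp_continuousOn
    (Θ.continuousOn.comp I.continuous.continuousOn fun _ hp => hp)
  continuousOn_invFun := I.continuous_symm.comp_continuousOn
    (Θ.continuousOn_symm.comp I.continuous.continuousOn fun _ hp => hp)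

theorem ModelWithCorners.contMDiffOn_induced (I : ModelWithCorners ℝ E H) {f : E → E} {s : Set E}
    (hf : ContDiffOn ℝ ∞ f (s ∩ range I)) (h : ∀ y ∈ s, y ∈ range I → f y ∈ range I) :
    ContMDiffOn I I ∞ (fun p => I.symm (f (I p))) (I ⁻¹' s) := by
  have h1 : ContMDiffOn I 𝓘(ℝ, E) ∞ (fun p => f (I p)) (I ⁻¹' s) :=
    hf.contMDiffOn.comp I.contMDiff.contMDiffOn fun p hp => ⟨hp, p, rfl⟩
  exact I.contMDiffOn_symm.comp h1 fun p hp => h _ hp ⟨p, rfl⟩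

theorem ModelWithCorners.trans_inducedHomeomorph_mem_maximalAtlas (I : ModelWithCorners ℝ E H)
    {M : Type*} [TopologicalSpace M] [ChartedSpace H M] [IsManifold I ∞ M]
    (Θ : OpenPartialHomeomorph E E) (h : ∀ y ∈ Θ.source, y ∈ range I → Θ y ∈ range I)
    (h' : ∀ y ∈ Θ.target, y ∈ range I → Θ.symm y ∈ range I)
    (hs : ContDiffOn ℝ ∞ Θ (Θ.source ∩ range I))
    (hs' : ContDiffOn ℝ ∞ Θ.symm (Θ.target ∩ range I))
    {e : OpenPartialHomeomorph M H} (he : e ∈ IsManifold.maximalAtlas I ∞ M) :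
    e.trans (I.inducedHomeomorph Θ h h') ∈ IsManifold.maximalAtlas I ∞ M := by
  apply OpenPartialHomeomorph.mem_maximalAtlas_of_contMDiffOn
  · exact (I.contMDiffOn_induced hs h).comp' (contMDiffOn_of_mem_maximalAtlas he) |>.mono
      fun x hx => hx
  · refine (contMDiffOn_symm_of_mem_maximalAtlas he).comp' (I.contMDiffOn_induced hs' h') |>.mono
      fun x hx => hx

end ModelHomeomorph

/-! ### The immersion criterion for manifolds with boundary. -/

section ImmersionCriterion

variable {n n' : ℕ} [NeZero n] [NeZero n']
  {X : Type*} [TopologicalSpace X] [ChartedSpace (EuclideanHalfSpace n) X]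
  [IsManifold (𝓡∂ n) ∞ X]
  {Y : Type*} [TopologicalSpace Y] [ChartedSpace (EuclideanHalfSpace n') Y]
  [IsManifold (𝓡∂ n') ∞ Y]

/-- In charts, extend `F` to `(z, u) ↦ F z + A u`, where `A` fills a complement of the range of the
differential, and invert this map. At a boundary point `A` has to be tangent to the boundary for the
extended map to respect the half spaces. Transversality provides such an `A`, and it is also the
sign condition in the inverse function theorem on half spaces. -/
theorem isImmersionAtOfComplement_of_injective_mfderiv (hnn : n ≤ n') {F : X → Y} {x : X}
    (hF : ContMDiff (𝓡∂ n) (𝓡∂ n') ∞ F) (hb : F ⁻¹' (𝓡∂ n').boundary Y = (𝓡∂ n).boundary X)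
    (hinj : Function.Injective (mfderiv (𝓡∂ n) (𝓡∂ n') F x))
    (htr : x ∈ (𝓡∂ n).boundary X →
      0 < halfSpaceCoord n' (chartDeriv (𝓡∂ n) (𝓡∂ n') F x (inwardNormal n))) :
    IsImmersionAtOfComplement (EuclideanSpace ℝ (Fin (n' - n))) (𝓡∂ n) (𝓡∂ n') ∞ F x := by
  set L := chartDeriv (𝓡∂ n) (𝓡∂ n') F x with hLdef
  set ℓ := halfSpaceCoord n
  set ℓ' := halfSpaceCoord n'
  set φ := extChartAt (𝓡∂ n) x with hφ
  set ψ := extChartAt (𝓡∂ n') (F x) with hψ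
  have hxb : x ∈ (𝓡∂ n).boundary X ↔ ℓ (φ x) = 0 :=
    mem_boundary_iff_halfSpaceCoord_eq_zero (mem_chart_source _ x)
  -- a complement of the range, tangent to the boundary if `x` is a boundary point
  obtain ⟨A, T, hAW, hT⟩ : ∃ (A : EuclideanSpace ℝ (Fin (n' - n)) →L[ℝ] EuclideanSpace ℝ (Fin n'))
      (T : (EuclideanSpace ℝ (Fin n) × EuclideanSpace ℝ (Fin (n' - n))) ≃L[ℝ]
        EuclideanSpace ℝ (Fin n')),
      (x ∈ (𝓡∂ n).boundary X → ∀ u, ℓ' (A u) = 0) ∧ ∀ w u, T (w, u) = L w + A u := by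
    have hdim : Module.finrank ℝ (EuclideanSpace ℝ (Fin n)) +
        Module.finrank ℝ (EuclideanSpace ℝ (Fin (n' - n)))
        = Module.finrank ℝ (EuclideanSpace ℝ (Fin n')) := by
      simp only [finrank_euclideanSpace, Fintype.card_fin]; omega
    by_cases hxB : x ∈ (𝓡∂ n).boundary X
    · obtain ⟨A, T, h1, h2⟩ := exists_equiv_extending_injective L hinj hdim ℓ'.toLinearMap.ker (by
        rw [eq_top_iff]
        rintro y -
        have hc := htr hxB
        -- By transversality `a` is not tangent to the boundary, so every vector is a multiple of
        -- `a` plus a tangential one.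
        set a := L (inwardNormal n)
        have h3 : y = (ℓ' y / ℓ' a) • a + (y - (ℓ' y / ℓ' a) • a) := by abel
        rw [h3]
        refine Submodule.add_mem_sup (Submodule.smul_mem _ _ ⟨_, rfl⟩) ?_
        rw [LinearMap.mem_ker]
        simp [div_mul_cancel₀ _ hc.ne'])
      exact ⟨A, T, fun _ u => h1 u, h2⟩
    · obtain ⟨A, T, h1, h2⟩ := exists_equiv_extending_injective L hinj hdim ⊤ (by simp)
      exact ⟨A, T, fun h => absurd h hxB, h2⟩
  set Ex := EuclideanSpace ℝ (Fin n) × EuclideanSpace ℝ (Fin (n' - n)) with hEx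
  set ℓ₁ : Ex →L[ℝ] ℝ := ℓ.comp (ContinuousLinearMap.fst ℝ _ _) with hℓ₁
  have hℓ₁v : ∀ p : Ex, ℓ₁ p = ℓ p.1 := fun p => rfl
  have he₁ : ℓ₁ (inwardNormal n, 0) = 1 := by simp [hℓ₁v, ℓ]
  set fh : EuclideanSpace ℝ (Fin n) → EuclideanSpace ℝ (Fin n') := ψ ∘ F ∘ φ.symm with hfh
  set f : Ex → EuclideanSpace ℝ (Fin n') := fun p => fh p.1 + A p.2 with hf
  have hφx : φ.symm (φ x) = x := extChartAt_to_inv x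
  have hfhx : fh (φ x) = ψ (F x) := by simp [hfh, hφx]
  -- smoothness in charts
  have hfhs : ContDiffOn ℝ ∞ fh (φ.target ∩ φ.symm ⁻¹' (F ⁻¹' ψ.source)) :=
    (contMDiff_iff.1 hF).2 x (F x)
  have hdomev : ∀ᶠ z in 𝓝 (φ x), 0 ≤ ℓ z → z ∈ φ.target ∩ φ.symm ⁻¹' (F ⁻¹' ψ.source) := by
    have h1 : ∀ᶠ z in 𝓝[range (𝓡∂ n)] (φ x), z ∈ φ.target := extChartAt_target_mem_nhdsWithin x
    rw [eventually_nhdsWithin_iff, range_halfSpace_eq] at h1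
    have h2 : ContinuousAt φ.symm (φ x) := continuousAt_extChartAt_symm x
    have h3 : ∀ᶠ z in 𝓝 (φ x), F (φ.symm z) ∈ ψ.source := by
      have : ContinuousAt (fun z => F (φ.symm z)) (φ x) :=
        ContinuousAt.comp (g := F) hF.continuous.continuousAt h2
      refine this.eventually ?_
      change ∀ᶠ y in 𝓝 (F (φ.symm (φ x))), y ∈ ψ.source
      rw [hφx]
      exact extChartAt_source_mem_nhds _
    filter_upwards [h1, h3] with z hz1 hz3 hz
    exact ⟨hz1 hz, hz3⟩
  -- At a boundary point `A` does not contribute to `ℓ'`, and the claim is `hb` read in charts. At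
  -- an interior point both coordinates are positive nearby and nothing else has to be checked.
  have hsign : ∀ᶠ p in 𝓝 ((φ x, 0) : Ex), 0 ≤ ℓ₁ p → 0 ≤ ℓ' (f p) ∧ (ℓ' (f p) = 0 ↔ ℓ₁ p = 0) := by
    have hfst : Filter.Tendsto Prod.fst (𝓝 ((φ x, 0) : Ex)) (𝓝 (φ x)) := continuousAt_fst
    by_cases hxB : x ∈ (𝓡∂ n).boundary X
    · filter_upwards [hfst.eventually hdomev] with p hp hp0
      obtain ⟨hp1, hp2⟩ := hp hp0
      have e1 : ℓ' (f p) = ℓ' (ψ (F (φ.symm p.1))) := by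
        simp [hf, hfh, hAW hxB]
      rw [e1]
      refine ⟨halfSpaceCoord_extChartAt_nonneg _ _, ?_⟩
      have hs : φ.symm p.1 ∈ (chartAt (EuclideanHalfSpace n) x).source := by
        rw [← extChartAt_source (𝓡∂ n)]
        exact φ.map_target hp1
      have hs' : F (φ.symm p.1) ∈ (chartAt (EuclideanHalfSpace n') (F x)).source := by
        rw [← extChartAt_source (𝓡∂ n')]
        exact hp2
      rw [← mem_boundary_iff_halfSpaceCoord_eq_zero hs', ← mem_preimage, hb,
        mem_boundary_iff_halfSpaceCoord_eq_zero hs, hℓ₁v]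
      change ℓ (φ (φ.symm p.1)) = 0 ↔ _
      rw [φ.right_inv hp1]
    · have hx1 : 0 < ℓ (φ x) := lt_of_le_of_ne (halfSpaceCoord_extChartAt_nonneg _ _)
        fun h => hxB (hxb.2 h.symm)
      have hy1 : 0 < ℓ' (ψ (F x)) := by
        refine lt_of_le_of_ne (halfSpaceCoord_extChartAt_nonneg _ _) fun h => hxB ?_
        rw [← hb]
        exact (mem_boundary_iff_halfSpaceCoord_eq_zero (mem_chart_source _ (F x))).2 h.symm
      have hmem : ∀ᶠ z in 𝓝 (φ x), z ∈ φ.target ∩ φ.symm ⁻¹' (F ⁻¹' ψ.source) := by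
        filter_upwards [hdomev, ℓ.continuous.continuousAt.eventually (lt_mem_nhds hx1)]
          with z hz hz' using hz (le_of_lt hz')
      have hfhc : ContinuousAt fh (φ x) := (hfhs.continuousOn).continuousAt hmem
      have hfc : ContinuousAt f (φ x, 0) := by
        refine ContinuousAt.add ?_ (A.continuous.comp continuous_snd).continuousAt
        exact ContinuousAt.comp (g := fh) (f := Prod.fst) (x := ((φ x, 0) : Ex)) hfhc continuousAt_fst
      have hpos : 0 < ℓ' (f (φ x, 0)) := by
        simpa [hf, hfhx] using hy1
      have hev : ∀ᶠ p in 𝓝 ((φ x, 0) : Ex), 0 < ℓ' (f p) :=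
        (ℓ'.continuous.continuousAt.comp hfc).eventually (lt_mem_nhds hpos)
      have hev2 : ∀ᶠ p in 𝓝 ((φ x, 0) : Ex), 0 < ℓ₁ p :=
        ℓ₁.continuous.continuousAt.eventually (lt_mem_nhds (by simpa [hℓ₁v] using hx1))
      filter_upwards [hev, hev2] with p h1 h2 _
      exact ⟨h1.le, fun h => absurd h h1.ne', fun h => absurd h h2.ne'⟩
  have hfst : Filter.Tendsto Prod.fst (𝓝 ((φ x, 0) : Ex)) (𝓝 (φ x)) := continuousAt_fst
  have hUev := (hfst.eventually hdomev).and hsign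
  set U : Set Ex := {p | (0 ≤ ℓ p.1 → p.1 ∈ φ.target ∩ φ.symm ⁻¹' (F ⁻¹' ψ.source)) ∧
    (0 ≤ ℓ₁ p → 0 ≤ ℓ' (f p) ∧ (ℓ' (f p) = 0 ↔ ℓ₁ p = 0))} with hU
  have hfs : ContDiffOn ℝ ∞ f ({p | 0 ≤ ℓ₁ p} ∩ U) := by
    refine ContDiffOn.add (hfhs.comp contDiff_fst.contDiffOn ?_)
      (A.contDiff.comp contDiff_snd).contDiffOn
    rintro p ⟨hp, hp'⟩
    exact hp'.1 hp
  have hfd : HasFDerivWithinAt f (T : Ex →L[ℝ] EuclideanSpace ℝ (Fin n')) {p | 0 ≤ ℓ₁ p}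
      (φ x, 0) := by
    have h1 : HasFDerivWithinAt fh L {z | 0 ≤ ℓ z} (φ x) := by
      have h2 := (hF.contMDiffAt (x := x)).mdifferentiableAt (by simp) |>.hasMFDerivAt.2
      rw [range_halfSpace_eq] at h2
      exact h2
    have h3 : HasFDerivWithinAt (fun p : Ex => fh p.1)
        (L.comp (ContinuousLinearMap.fst ℝ _ _)) {p | 0 ≤ ℓ₁ p} (φ x, 0) :=
      HasFDerivWithinAt.comp (g := fh) (φ x, 0) h1 hasFDerivWithinAt_fst fun p hp => hp
    have h4 := h3.add (A.comp (ContinuousLinearMap.snd ℝ _ _)).hasFDerivWithinAt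
    refine h4.congr_fderiv ?_
    ext p <;> simp [hT]
  obtain ⟨Φ, hΦx, hΦU, hΦf, hΦsign, hΦs⟩ := exists_halfSpace_localInverse ℓ₁ he₁ ℓ' hUev
    (halfSpaceCoord_extChartAt_nonneg x x) hfs T hfd (fun p hp => hp.2)
    (by
      intro h0
      rw [hT, map_zero, add_zero]
      exact htr (hxb.2 h0))
  obtain ⟨K, hK⟩ := exists_equiv_intertwining (ℓ := ℓ₁) (ℓ' := ℓ') (by
    rw [Module.finrank_prod]
    simp only [finrank_euclideanSpace, Fintype.card_fin]; omega) he₁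
    (halfSpaceCoord_inwardNormal (n := n'))
  -- `K` carries the half space of the product to the model half space. Thus `Θ` is a change of
  -- coordinates on the model, after which `F` reads `z ↦ K (z, 0)`.
  set Θ : OpenPartialHomeomorph (EuclideanSpace ℝ (Fin n')) (EuclideanSpace ℝ (Fin n')) :=
    Φ.symm.trans K.toHomeomorph.toOpenPartialHomeomorph with hΘ
  have hΘv : ∀ y, Θ y = K (Φ.symm y) := fun y => rfl
  have hΘsv : ∀ y, Θ.symm y = Φ (K.symm y) := fun y => rfl
  have hΘs : Θ.source = Φ.target := by simp [hΘ]
  have hΘt : ∀ y, y ∈ Θ.target ↔ K.symm y ∈ Φ.source := fun y => by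
    simp [hΘ]
  have hK' : ∀ y, ℓ₁ (K.symm y) = ℓ' y := fun y => by rw [← hK, K.apply_symm_apply]
  have hr1 : ∀ y ∈ Θ.source, y ∈ range (𝓡∂ n') → Θ y ∈ range (𝓡∂ n') := by
    intro y hy hyr
    rw [range_halfSpace_eq] at hyr ⊢
    rw [hΘs] at hy
    change 0 ≤ ℓ' (Θ y)
    rw [hΘv, hK, ← hΦsign _ (Φ.map_target hy), Φ.right_inv hy]
    exact hyr
  have hr2 : ∀ y ∈ Θ.target, y ∈ range (𝓡∂ n') → Θ.symm y ∈ range (𝓡∂ n') := by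
    intro y hy hyr
    rw [range_halfSpace_eq] at hyr ⊢
    rw [hΘt] at hy
    change 0 ≤ ℓ' (Θ.symm y)
    rw [hΘsv, hΦsign _ hy, hK']
    exact hyr
  have hsm1 : ContDiffOn ℝ ∞ Θ (Θ.source ∩ range (𝓡∂ n')) := by
    rw [hΘs, range_halfSpace_eq]
    exact K.contDiff.comp_contDiffOn hΦs
  have hsm2 : ContDiffOn ℝ ∞ Θ.symm (Θ.target ∩ range (𝓡∂ n')) := by
    have h1 : ContDiffOn ℝ ∞ Φ (Φ.source ∩ {p | 0 ≤ ℓ₁ p}) :=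
      (hfs.mono fun p hp => ⟨hp.2, hΦU hp.1⟩).congr fun p hp => hΦf p hp.1 hp.2
    refine h1.comp K.symm.contDiff.contDiffOn ?_
    rintro y ⟨hy, hyr⟩
    rw [range_halfSpace_eq] at hyr
    refine ⟨(hΘt y).1 hy, ?_⟩
    change 0 ≤ ℓ₁ (K.symm y)
    rw [hK']
    exact hyr
  set T' := (𝓡∂ n').inducedHomeomorph Θ hr1 hr2 with hT'
  have hφ0 : 0 ≤ ℓ (φ x) := halfSpaceCoord_extChartAt_nonneg x x
  -- the shrunk chart of the source
  have hO : ∀ᶠ x' in 𝓝 x, x' ∈ (chartAt (EuclideanHalfSpace n) x).source ∧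
      ((φ x', 0) : Ex) ∈ Φ.source := by
    refine Filter.Eventually.and
      ((chartAt (EuclideanHalfSpace n) x).open_source.mem_nhds (mem_chart_source _ x)) ?_
    have h1 : ContinuousAt (fun x' => ((φ x', 0) : Ex)) x :=
      (continuousAt_extChartAt x).prodMk continuousAt_const
    exact h1.eventually (Φ.open_source.mem_nhds hΦx)
  obtain ⟨O, hOs, hOo, hxO⟩ := eventually_nhds_iff.1 hO
  have hval : ∀ z ∈ φ.target, φ.symm z ∈ O → ψ (F (φ.symm z)) = Φ (z, 0) ∧
      ((z, 0) : Ex) ∈ Φ.source ∧ F (φ.symm z) ∈ ψ.source := by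
    intro z hz hzO
    have h1 := (hOs _ hzO).2
    rw [φ.right_inv hz] at h1
    have h0 : 0 ≤ ℓ z := by
      rw [← φ.right_inv hz]
      exact halfSpaceCoord_extChartAt_nonneg _ _
    refine ⟨?_, h1, ((hΦU h1).1 h0).2⟩
    rw [hΦf _ h1 h0]
    simp [hf, hfh]
  have hxval := hval (φ x) (mem_extChartAt_target x) (by rw [hφx]; exact hxO)
  rw [hφx] at hxval
  refine IsImmersionAtOfComplement.mk_of_continuousAt hF.continuous.continuousAt K
    ((chartAt (EuclideanHalfSpace n) x).restr O) ((chartAt (EuclideanHalfSpace n') (F x)).trans T')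
    ?_ ?_ ?_ ?_ ?_
  · rw [OpenPartialHomeomorph.restr_source, hOo.interior_eq]
    exact ⟨mem_chart_source _ x, hxO⟩
  · refine ⟨mem_chart_source _ (F x), ?_⟩
    change ψ (F x) ∈ Θ.source
    rw [hΘs, hxval.1]
    exact Φ.map_source hxval.2.1
  · exact restr_mem_maximalAtlas (contDiffGroupoid ∞ (𝓡∂ n))
      (IsManifold.chart_mem_maximalAtlas x) hOo
  · exact (𝓡∂ n').trans_inducedHomeomorph_mem_maximalAtlas Θ hr1 hr2 hsm1 hsm2
      (IsManifold.chart_mem_maximalAtlas (F x))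
  · intro z hz
    have hz' : (𝓡∂ n).symm z ∈ ((chartAt (EuclideanHalfSpace n) x).restr O).target ∧
        z ∈ range (𝓡∂ n) := by
      rw [OpenPartialHomeomorph.extend_target] at hz
      exact hz
    have hsrc := ((chartAt (EuclideanHalfSpace n) x).restr O).map_target hz'.1
    rw [OpenPartialHomeomorph.restr_source, hOo.interior_eq] at hsrc
    have hzt : z ∈ φ.target := by
      rw [hφ, extChartAt, OpenPartialHomeomorph.extend_target]
      exact ⟨(chartAt (EuclideanHalfSpace n) x).restr_target _ ▸ hz'.1 |>.1, hz'.2⟩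
    obtain ⟨h1, h2, h3⟩ := hval z hzt hsrc.2
    have h4 : (𝓡∂ n') (T' (chartAt (EuclideanHalfSpace n') (F x) (F (φ.symm z))))
        = Θ (ψ (F (φ.symm z))) := by
      refine (𝓡∂ n').right_inv (hr1 _ ?_ ⟨_, rfl⟩)
      change ψ (F (φ.symm z)) ∈ Θ.source
      rw [hΘs, h1]
      exact Φ.map_source h2
    refine h4.trans ?_
    rw [h1, hΘv, Φ.left_inv h2]
    rfl

end ImmersionCriterion


/-! ### Neat immersions and isotopy relative to the boundary. -/

section NeatIsotopy

variable {n n' : ℕ} [NeZero n] [NeZero n']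
  {X : Type*} [TopologicalSpace X] [ChartedSpace (EuclideanHalfSpace n) X]
  {Y : Type*} [TopologicalSpace Y] [ChartedSpace (EuclideanHalfSpace n') Y]

/-- A smooth injective immersion of manifolds with boundary that is neat: exactly the boundary goes
to the boundary, and it is transverse to the boundary. -/
structure IsNeatImmersion (n n' : ℕ) [NeZero n] [NeZero n']
    {X : Type*} [TopologicalSpace X] [ChartedSpace (EuclideanHalfSpace n) X]
    {Y : Type*} [TopologicalSpace Y] [ChartedSpace (EuclideanHalfSpace n') Y]
    (F : X → Y) : Prop where
  contMDiff : ContMDiff (𝓡∂ n) (𝓡∂ n') ∞ F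
  injective : Function.Injective F
  injective_mfderiv : ∀ x, Function.Injective (mfderiv (𝓡∂ n) (𝓡∂ n') F x)
  preimage_boundary : F ⁻¹' (𝓡∂ n').boundary Y = (𝓡∂ n).boundary X
  transverse : ∀ x ∈ (𝓡∂ n).boundary X,
    0 < halfSpaceCoord n' (chartDeriv (𝓡∂ n) (𝓡∂ n') F x (inwardNormal n))

/-- The immersion criterion applies at every point with the same complement, and a continuous
injection from a compact space to a Hausdorff space is a closed embedding. -/
theorem IsNeatImmersion.isProperEmbedding [IsManifold (𝓡∂ n) ∞ X] [IsManifold (𝓡∂ n') ∞ Y]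
    [CompactSpace X] [T2Space Y] (hnn : n ≤ n') {F : X → Y} (hF : IsNeatImmersion n n' F) :
    IsProperEmbedding (𝓡∂ n) (𝓡∂ n') F where
  isSmoothEmbedding :=
    ⟨⟨_, inferInstance, inferInstance, fun x =>
      isImmersionAtOfComplement_of_injective_mfderiv hnn hF.contMDiff hF.preimage_boundary
        (hF.injective_mfderiv x) (hF.transverse x)⟩,
      (hF.contMDiff.continuous.isClosedEmbedding hF.injective).isEmbedding⟩
  preimage_boundary := hF.preimage_boundary

theorem DiffBdry.apply_of_mem_boundary {η : Equiv.Perm X} (hη : η ∈ DiffBdry (𝓡∂ n) X) {x : X}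
    (hx : x ∈ (𝓡∂ n).boundary X) : η x = x :=
  hη.2.2.self_of_nhdsSet x hx

theorem DiffBdry.apply_mem_boundary_iff {η : Equiv.Perm X} (hη : η ∈ DiffBdry (𝓡∂ n) X) {x : X} :
    η x ∈ (𝓡∂ n).boundary X ↔ x ∈ (𝓡∂ n).boundary X := by
  constructor
  · intro h
    have h1 := DiffBdry.apply_of_mem_boundary hη h
    rwa [η.injective h1] at h
  · intro h
    rwa [DiffBdry.apply_of_mem_boundary hη h]

theorem DiffBdry.injective_mfderiv {η : Equiv.Perm X} (hη : η ∈ DiffBdry (𝓡∂ n) X) (x : X) :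
    Function.Injective (mfderiv (𝓡∂ n) (𝓡∂ n) η x) := by
  refine injective_mfderiv_of_comp_within (G := η.symm) (K := id) (J' := 𝓡∂ n) (u := univ)
    (hη.1.contMDiffAt.mdifferentiableAt (by simp))
    (hη.2.1.contMDiffAt.mdifferentiableAt (by simp)).mdifferentiableWithinAt (by simp) (by simp) ?_
  rw [mfderiv_id]
  exact Function.injective_id

theorem IsNeatImmersion.comp_diffBdry {F : X → Y} (hF : IsNeatImmersion n n' F)
    {η : Equiv.Perm X} (hη : η ∈ DiffBdry (𝓡∂ n) X) : IsNeatImmersion n n' (F ∘ η) where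
  contMDiff := hF.contMDiff.comp hη.1
  injective := hF.injective.comp η.injective
  injective_mfderiv x := by
    rw [mfderiv_comp x (hF.contMDiff.contMDiffAt.mdifferentiableAt (by simp))
      (hη.1.contMDiffAt.mdifferentiableAt (by simp))]
    exact (hF.injective_mfderiv (η x)).comp (DiffBdry.injective_mfderiv hη x)
  preimage_boundary := by
    rw [preimage_comp, hF.preimage_boundary]
    ext x
    exact DiffBdry.apply_mem_boundary_iff hη
  transverse x hx := by
    have h1 : F ∘ η =ᶠ[𝓝 x] F := by
      filter_upwards [hη.2.2.filter_mono (nhds_le_nhdsSet hx)] with y hy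
      rw [Function.comp_apply, hy]
    rw [h1.chartDeriv_eq]
    exact hF.transverse x hx

/-- Isotopy relative to the boundary through neat immersions, parametrized by the real line. -/
def NeatlyIsotopic (n n' : ℕ) [NeZero n] [NeZero n']
    {X : Type*} [TopologicalSpace X] [ChartedSpace (EuclideanHalfSpace n) X]
    {Y : Type*} [TopologicalSpace Y] [ChartedSpace (EuclideanHalfSpace n') Y]
    (f₀ f₁ : X → Y) : Prop :=
  ∃ F : X × ℝ → Y, ContMDiff ((𝓡∂ n).prod 𝓘(ℝ, ℝ)) (𝓡∂ n') ∞ F ∧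
    (∀ t, IsNeatImmersion n n' fun x => F (x, t)) ∧
    (∀ x, F (x, 0) = f₀ x) ∧ (∀ x, F (x, 1) = f₁ x) ∧
    ∀ x ∈ (𝓡∂ n).boundary X, ∀ t, F (x, t) = f₀ x

theorem NeatlyIsotopic.refl {f : X → Y} (hf : IsNeatImmersion n n' f) :
    NeatlyIsotopic n n' f f :=
  ⟨fun p => f p.1, hf.contMDiff.comp contMDiff_fst, fun _ => hf, fun _ => rfl, fun _ => rfl,
    fun _ _ _ => rfl⟩

theorem contMDiff_time_reparam {F : X × ℝ → Y}
    (hF : ContMDiff ((𝓡∂ n).prod 𝓘(ℝ, ℝ)) (𝓡∂ n') ∞ F) {a : ℝ → ℝ} (ha : ContDiff ℝ ∞ a) :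
    ContMDiff ((𝓡∂ n).prod 𝓘(ℝ, ℝ)) (𝓡∂ n') ∞ fun p : X × ℝ => F (p.1, a p.2) :=
  hF.comp (contMDiff_fst.prodMk (ha.contMDiff.comp contMDiff_snd))

theorem NeatlyIsotopic.symm {f₀ f₁ : X → Y} (h : NeatlyIsotopic n n' f₀ f₁) :
    NeatlyIsotopic n n' f₁ f₀ := by
  obtain ⟨F, h1, h2, h3, h4, h5⟩ := h
  refine ⟨fun p => F (p.1, 1 - p.2),
    contMDiff_time_reparam h1 (a := fun t => 1 - t) (by fun_prop), fun t => h2 (1 - t),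
    fun x => by simp [h4], fun x => by simp [h3], fun x hx t => ?_⟩
  change F (x, 1 - t) = f₁ x
  rw [h5 x hx, ← h4, h5 x hx]

theorem NeatlyIsotopic.trans {f₀ f₁ f₂ : X → Y} (h : NeatlyIsotopic n n' f₀ f₁)
    (h' : NeatlyIsotopic n n' f₁ f₂) : NeatlyIsotopic n n' f₀ f₂ := by
  obtain ⟨F, h1, h2, h3, h4, h5⟩ := h
  obtain ⟨G, g1, g2, g3, g4, g5⟩ := h'
  -- The reparametrized first isotopy has arrived at `f₁` by time 1/3 and the second does not leave
  -- it before time 2/3. They agree in between, so switching at time 1/2 is smooth.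
  set S := Real.smoothTransition
  set A : X × ℝ → Y := fun p => F (p.1, S (3 * p.2)) with hA
  set B : X × ℝ → Y := fun p => G (p.1, S (3 * p.2 - 2)) with hB
  have hAs : ContMDiff ((𝓡∂ n).prod 𝓘(ℝ, ℝ)) (𝓡∂ n') ∞ A :=
    contMDiff_time_reparam h1 (a := fun t => S (3 * t))
      (Real.smoothTransition.contDiff.comp (by fun_prop))
  have hBs : ContMDiff ((𝓡∂ n).prod 𝓘(ℝ, ℝ)) (𝓡∂ n') ∞ B :=
    contMDiff_time_reparam g1 (a := fun t => S (3 * t - 2))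
      (Real.smoothTransition.contDiff.comp (by fun_prop))
  have hAB : ∀ x t, 1 / 3 ≤ t → t ≤ 2 / 3 → A (x, t) = B (x, t) := fun x t ht ht' => by
    simp only [hA, hB, S]
    rw [Real.smoothTransition.one_of_one_le (by linarith),
      Real.smoothTransition.zero_of_nonpos (by linarith), h4, g3]
  refine ⟨fun p => if p.2 < 1 / 2 then A p else B p, ?_, ?_, ?_, ?_, ?_⟩
  · rintro ⟨x, t⟩
    rcases lt_or_ge t (7 / 12) with ht | ht
    · refine (hAs (x, t)).congr_of_eventuallyEq ?_
      have : ∀ᶠ p : X × ℝ in 𝓝 (x, t), p.2 < 2 / 3 :=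
        continuous_snd.continuousAt.eventually (gt_mem_nhds (by
          change t < 2 / 3; linarith))
      filter_upwards [this] with p hp
      split_ifs with h0
      · rfl
      · exact (hAB p.1 p.2 (by linarith) hp.le).symm
    · refine (hBs (x, t)).congr_of_eventuallyEq ?_
      have : ∀ᶠ p : X × ℝ in 𝓝 (x, t), 1 / 3 < p.2 :=
        continuous_snd.continuousAt.eventually (lt_mem_nhds (by
          change 1 / 3 < t; linarith))
      filter_upwards [this] with p hp
      split_ifs with h0
      · exact hAB p.1 p.2 hp.le (by linarith)
      · rfl
  · intro t
    by_cases ht : t < 1 / 2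
    · simpa only [ht, if_true] using h2 (S (3 * t))
    · simpa only [ht, if_false] using g2 (S (3 * t - 2))
  · intro x
    simp [hA, S, h3]
  · intro x
    have h0 : ¬ ((1 : ℝ) < 1 / 2) := by norm_num
    simp only [h0, if_false, hB, S]
    rw [Real.smoothTransition.one_of_one_le (by norm_num), g4]
  · intro x hx t
    simp only [hA, hB]
    split_ifs
    · exact h5 x hx _
    · rw [g5 x hx, ← h4, h5 x hx]

theorem NeatlyIsotopic.comp_diffBdry {f₀ f₁ : X → Y} (h : NeatlyIsotopic n n' f₀ f₁)
    {η : Equiv.Perm X} (hη : η ∈ DiffBdry (𝓡∂ n) X) :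
    NeatlyIsotopic n n' (f₀ ∘ η) (f₁ ∘ η) := by
  obtain ⟨F, h1, h2, h3, h4, h5⟩ := h
  refine ⟨fun p => F (η p.1, p.2),
    h1.comp ((hη.1.comp contMDiff_fst).prodMk contMDiff_snd),
    fun t => (h2 t).comp_diffBdry hη, fun x => h3 _, fun x => h4 _, fun x hx t => ?_⟩
  exact h5 _ ((DiffBdry.apply_mem_boundary_iff hη).2 hx) t

theorem NeatlyIsotopic.isotopicRelBoundary [IsManifold (𝓡∂ n) ∞ X] [IsManifold (𝓡∂ n') ∞ Y]
    [CompactSpace X] [T2Space Y] (hnn : n ≤ n') {f₀ f₁ : X → Y}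
    (h : NeatlyIsotopic n n' f₀ f₁) : IsotopicRelBoundary (𝓡∂ n) (𝓡∂ n') f₀ f₁ := by
  obtain ⟨F, h1, h2, h3, h4, h5⟩ := h
  exact ⟨F, h1.contMDiffOn, fun t _ => (h2 t).isProperEmbedding hnn, h3, h4,
    fun x hx t _ => h5 x hx t⟩

/-- The diffeomorphisms that are absorbed by an embedding up to isotopy form a subgroup. -/
theorem neatlyIsotopic_comp_of_mem_closure {g : X → Y} (hg : IsNeatImmersion n n' g)
    {s : Set (Equiv.Perm X)} (hs : s ⊆ DiffBdry (𝓡∂ n) X)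
    (h : ∀ η ∈ s, NeatlyIsotopic n n' (g ∘ η) g) {η : Equiv.Perm X} (hη : η ∈ Subgroup.closure s) :
    NeatlyIsotopic n n' (g ∘ η) g := by
  have hle : Subgroup.closure s ≤ DiffBdry (𝓡∂ n) X := (Subgroup.closure_le _).2 hs
  -- For a product, `g ∘ (a * b) = (g ∘ a) ∘ b` is isotopic to `g ∘ b` and then to `g`. For an
  -- inverse, the isotopy from `g ∘ a` to `g` is precomposed with `a⁻¹` and reversed.
  induction hη using Subgroup.closure_induction with
  | mem η hη => exact h η hη
  | one => exact NeatlyIsotopic.refl hg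
  | mul a b ha hb iha ihb => exact (iha.comp_diffBdry (hle hb)).trans ihb
  | inv a ha iha =>
    have h1 := (iha.comp_diffBdry (inv_mem (hle ha))).symm
    have h2 : (g ∘ a) ∘ (a⁻¹ : Equiv.Perm X) = g := by
      ext x
      simp
    rwa [h2] at h1

end NeatIsotopy


/-! ### Pushing a manifold off its boundary. -/

section Collar

variable {n : ℕ} [NeZero n]
  {Y : Type*} [TopologicalSpace Y] [ChartedSpace (EuclideanHalfSpace n) Y]

/-- A smooth family of self-maps, starting at the identity, which pushes the points of `K` off the
boundary at positive speed, as measured by the boundary defining function `d`. -/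
structure IsInwardPush (n : ℕ) [NeZero n] {Y : Type*} [TopologicalSpace Y]
    [ChartedSpace (EuclideanHalfSpace n) Y] (d : Y → ℝ) (K : Set Y) (ε : ℝ) (Θ : Y × ℝ → Y) :
    Prop where
  pos : 0 < ε
  contMDiffOn : ContMDiffOn ((𝓡∂ n).prod 𝓘(ℝ, ℝ)) (𝓡∂ n) ∞ Θ (univ ×ˢ Icc 0 ε)
  zero : ∀ x, Θ (x, 0) = x
  eq_of_mem_boundary : ∀ x, ∀ t ∈ Icc 0 ε, Θ (x, t) ∈ (𝓡∂ n).boundary Y → Θ (x, t) = x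
  mem_interior : ∀ x ∈ K, ∀ t ∈ Ioc 0 ε, Θ (x, t) ∈ (𝓡∂ n).interior Y
  deriv : ∀ x ∈ (𝓡∂ n).boundary Y, ∃ c, 0 ≤ c ∧
    HasDerivWithinAt (fun t => d (Θ (x, t))) c (Icc 0 ε) 0 ∧ (x ∈ K → 0 < c)

theorem HasMFDerivWithinAt.hasDerivWithinAt {f : ℝ → ℝ} {L : ℝ →L[ℝ] ℝ} {s : Set ℝ} {x : ℝ}
    (h : HasMFDerivWithinAt 𝓘(ℝ, ℝ) 𝓘(ℝ, ℝ) f s x L) : HasDerivWithinAt f (L 1) s x :=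
  (show HasFDerivWithinAt f L s x from hasMFDerivWithinAt_iff_hasFDerivWithinAt.1 h).hasDerivWithinAt

variable {d : Y → ℝ}

theorem IsInwardPush.mono {K K' : Set Y} {ε ε' : ℝ} {Θ : Y × ℝ → Y}
    (h : IsInwardPush n d K ε Θ) (hK : K' ⊆ K) (hε : 0 < ε') (hε' : ε' ≤ ε) :
    IsInwardPush n d K' ε' Θ where
  pos := hε
  contMDiffOn := h.contMDiffOn.mono (prod_mono_right (Icc_subset_Icc_right hε'))
  zero := h.zero
  eq_of_mem_boundary x t ht := h.eq_of_mem_boundary x t ⟨ht.1, ht.2.trans hε'⟩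
  mem_interior x hx t ht := h.mem_interior x (hK hx) t ⟨ht.1, ht.2.trans hε'⟩
  deriv x hx := by
    obtain ⟨c, h1, h2, h3⟩ := h.deriv x hx
    exact ⟨c, h1, h2.mono (Icc_subset_Icc_right hε'), fun hxK => h3 (hK hxK)⟩

theorem isInwardPush_empty (d : Y → ℝ) : IsInwardPush n d ∅ 1 (fun p => p.1) where
  pos := one_pos
  contMDiffOn := contMDiff_fst.contMDiffOn
  zero _ := rfl
  eq_of_mem_boundary _ _ _ _ := rfl
  mem_interior x hx := absurd hx (notMem_empty x)
  deriv x _ := ⟨0, le_rfl, hasDerivWithinAt_const (0 : ℝ) (Icc 0 1) (d x), fun h => absurd h (notMem_empty x)⟩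

/-- The composite can meet the boundary only at a point where both pushes stand still, hence a push
off `K` and a push off `K'` combine. By the chain rule the initial speeds of `d` add; both are
nonnegative, so neither undoes the other. -/
theorem IsInwardPush.comp {K K' : Set Y} {ε : ℝ} {Θ Θ' : Y × ℝ → Y}
    (hd : IsBoundaryDefiningOn n d univ)
    (h : IsInwardPush n d K ε Θ) (h' : IsInwardPush n d K' ε Θ') :
    IsInwardPush n d (K ∪ K') ε (fun p => Θ (Θ' p, p.2)) where
  pos := h.pos
  contMDiffOn := h.contMDiffOn.comp (h'.contMDiffOn.prodMk contMDiffOn_snd)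
    fun p hp => ⟨mem_univ _, hp.2⟩
  zero x := by rw [h'.zero, h.zero]
  eq_of_mem_boundary x t ht hb := by
    have h1 := h.eq_of_mem_boundary _ t ht hb
    change Θ (Θ' (x, t), t) = x
    rw [h1]
    refine h'.eq_of_mem_boundary x t ht ?_
    rw [← h1]
    exact hb
  mem_interior x hx t ht := by
    have ht' : t ∈ Icc 0 ε := ⟨ht.1.le, ht.2⟩
    rw [← (𝓡∂ n).compl_boundary]
    intro hb
    have h1 := h.eq_of_mem_boundary _ t ht' hb
    have hb' : Θ' (x, t) ∈ (𝓡∂ n).boundary Y := h1 ▸ hb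
    have h2 := h'.eq_of_mem_boundary _ t ht' hb'
    rcases hx with hx | hx
    · have h3 := h.mem_interior x hx t ht
      rw [← (𝓡∂ n).compl_boundary] at h3
      rw [h2] at hb
      exact h3 hb
    · have h3 := h'.mem_interior x hx t ht
      rw [← (𝓡∂ n).compl_boundary] at h3
      exact h3 hb'
  deriv x hx := by
    obtain ⟨c, hc, hdc, hcK⟩ := h.deriv x hx
    obtain ⟨c', hc', hdc', hcK'⟩ := h'.deriv x hx
    refine ⟨c' + c, by positivity, ?_, ?_⟩
    swap
    · rintro (hx | hx)
      · linarith [hcK hx]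
      · linarith [hcK' hx]
    have h0 : (0 : ℝ) ∈ Icc 0 ε := ⟨le_rfl, h.pos.le⟩
    have huniq : UniqueDiffWithinAt ℝ (Icc 0 ε) 0 := uniqueDiffOn_Icc h.pos 0 h0
    set s : Set (Y × ℝ) := univ ×ˢ Icc 0 ε with hs
    -- the function `u = d ∘ Θ` and its differential
    have hu : MDifferentiableWithinAt ((𝓡∂ n).prod 𝓘(ℝ, ℝ)) 𝓘(ℝ, ℝ) (fun p => d (Θ p)) s (x, 0) :=
      ((hd.1.comp_contMDiffOn h.contMDiffOn) (x, 0) ⟨mem_univ _, h0⟩).mdifferentiableWithinAt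
        (by simp)
    set U : EuclideanSpace ℝ (Fin n) × ℝ →L[ℝ] ℝ :=
      mfderivWithin ((𝓡∂ n).prod 𝓘(ℝ, ℝ)) 𝓘(ℝ, ℝ) (fun p => d (Θ p)) s (x, 0) with hU
    have hUd : HasMFDerivWithinAt ((𝓡∂ n).prod 𝓘(ℝ, ℝ)) 𝓘(ℝ, ℝ) (fun p => d (Θ p)) s (x, 0) U :=
      hu.hasMFDerivWithinAt
    -- The chain rule along `t ↦ (γ t, t)`. The constant curve gives the time part of `U`, and the
    -- curve `Θ' (x, t)` gives the speed of the composite. The space part of `U` is the differential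
    -- of `d`, because `Θ` is the identity at time 0.
    have key : ∀ (γ : ℝ → Y) (γ' : ℝ →L[ℝ] EuclideanSpace ℝ (Fin n)), γ 0 = x →
        HasMFDerivWithinAt 𝓘(ℝ, ℝ) (𝓡∂ n) γ (Icc 0 ε) 0 γ' →
        HasDerivWithinAt (fun t => d (Θ (γ t, t))) (U (γ' 1, 1)) (Icc 0 ε) 0 := by
      intro γ γ' hγ0 hγ
      have h1 : HasMFDerivWithinAt 𝓘(ℝ, ℝ) ((𝓡∂ n).prod 𝓘(ℝ, ℝ)) (fun t : ℝ => (γ t, t)) (Icc 0 ε) 0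
          (γ'.prod (ContinuousLinearMap.id ℝ ℝ)) :=
        hγ.prodMk (hasMFDerivWithinAt_id _ _)
      have h2 : HasMFDerivWithinAt ((𝓡∂ n).prod 𝓘(ℝ, ℝ)) 𝓘(ℝ, ℝ) (fun p => d (Θ p)) s
          ((fun t : ℝ => (γ t, t)) 0) U := by
        change HasMFDerivWithinAt ((𝓡∂ n).prod 𝓘(ℝ, ℝ)) 𝓘(ℝ, ℝ) (fun p => d (Θ p)) s (γ 0, 0) U
        rw [hγ0]
        exact hUd
      have h3 := HasMFDerivWithinAt.comp (f := fun t : ℝ => (γ t, t)) (g := fun p => d (Θ p))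
        (0 : ℝ) h2 h1 fun t ht => ⟨mem_univ _, ht⟩
      exact HasMFDerivWithinAt.hasDerivWithinAt
        (L := U.comp (γ'.prod (ContinuousLinearMap.id ℝ ℝ))) h3
    have hU1 : U (0, 1) = c := by
      have h1 := key (fun _ => x) 0 rfl (hasMFDerivWithinAt_const _ _ _)
      exact huniq.eq_deriv _ h1 hdc
    have hU2 : ∀ w, U (w, 0) = chartDeriv (𝓡∂ n) 𝓘(ℝ, ℝ) d x w := by
      intro w
      have h1 : HasMFDerivAt (𝓡∂ n) ((𝓡∂ n).prod 𝓘(ℝ, ℝ)) (fun y : Y => (y, (0 : ℝ))) x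
          ((ContinuousLinearMap.id ℝ (EuclideanSpace ℝ (Fin n))).prod 0) :=
        (hasMFDerivAt_id x).prodMk (hasMFDerivAt_const 0 x)
      have h2 := HasMFDerivWithinAt.comp (f := fun y : Y => (y, (0 : ℝ))) (g := fun p => d (Θ p))
        x hUd (h1.hasMFDerivWithinAt (s := univ)) fun y _ => ⟨mem_univ _, h0⟩
      have h3 : (fun p => d (Θ p)) ∘ (fun y : Y => (y, (0 : ℝ))) = d := by
        ext y
        simp [h.zero]
      rw [h3] at h2
      rw [chartDeriv, (hasMFDerivWithinAt_univ.1 h2).mfderiv]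
      rfl
    have hγ : MDifferentiableWithinAt 𝓘(ℝ, ℝ) (𝓡∂ n) (fun t => Θ' (x, t)) (Icc 0 ε) 0 := by
      have h1 : ContMDiffOn 𝓘(ℝ, ℝ) (𝓡∂ n) ∞ (fun t => Θ' (x, t)) (Icc 0 ε) :=
        h'.contMDiffOn.comp (contMDiff_const.prodMk contMDiff_id).contMDiffOn
          fun t ht => ⟨mem_univ _, ht⟩
      exact (h1 0 h0).mdifferentiableWithinAt (by simp)
    set γ' : ℝ →L[ℝ] EuclideanSpace ℝ (Fin n) :=
      mfderivWithin 𝓘(ℝ, ℝ) (𝓡∂ n) (fun t => Θ' (x, t)) (Icc 0 ε) 0 with hγ'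
    have hγd : HasMFDerivWithinAt 𝓘(ℝ, ℝ) (𝓡∂ n) (fun t => Θ' (x, t)) (Icc 0 ε) 0 γ' :=
      hγ.hasMFDerivWithinAt
    have h1 := key _ γ' (h'.zero x) hγd
    have h2 : chartDeriv (𝓡∂ n) 𝓘(ℝ, ℝ) d x (γ' 1) = c' := by
      have hdd : HasMFDerivAt (𝓡∂ n) 𝓘(ℝ, ℝ) d (Θ' (x, 0)) (chartDeriv (𝓡∂ n) 𝓘(ℝ, ℝ) d x) := by
        rw [h'.zero]
        exact (hd.1.contMDiffAt.mdifferentiableAt (by simp)).hasMFDerivAt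
      have h3 := HasMFDerivWithinAt.comp (0 : ℝ) (hdd.hasMFDerivWithinAt (s := univ)) hγd
        fun t _ => mem_univ _
      have h4 : HasDerivWithinAt (fun t => d (Θ' (x, t)))
          (chartDeriv (𝓡∂ n) 𝓘(ℝ, ℝ) d x (γ' 1)) (Icc 0 ε) 0 :=
        HasMFDerivWithinAt.hasDerivWithinAt (L := (chartDeriv (𝓡∂ n) 𝓘(ℝ, ℝ) d x).comp γ') h3
      exact huniq.eq_deriv _ h4 hdc'
    have h4 : U (γ' 1, 1) = c' + c := by
      rw [← h2, ← hU1, ← hU2, ← map_add]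
      simp
    rw [h4] at h1
    exact h1

/-- In a chart, translate along the inward normal by `t` times a bump function, and do nothing
outside the chart. The support of the bump is compact, so the translates stay in the chart for short
time, and the normal coordinate grows by exactly `t * f x`. -/
theorem exists_isInwardPush_nhds [IsManifold (𝓡∂ n) ∞ Y] [T2Space Y] [CompactSpace Y]
    (hd : IsBoundaryDefiningOn n d univ) (y : Y) :
    ∃ K ∈ 𝓝 y, ∃ ε Θ, IsInwardPush n d K ε Θ := by
  obtain ⟨f⟩ : Nonempty (SmoothBumpFunction (𝓡∂ n) y) := inferInstance
  set φ := extChartAt (𝓡∂ n) y with hφ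
  set e := inwardNormal n with he
  have hsrc : φ.source = (chartAt (EuclideanHalfSpace n) y).source := extChartAt_source _ _
  set q : Y × ℝ → EuclideanSpace ℝ (Fin n) := fun p => φ p.1 + (p.2 * f p.1) • e with hq
  have hφs : ContMDiffOn (𝓡∂ n) 𝓘(ℝ, EuclideanSpace ℝ (Fin n)) ∞ (φ : Y → _) φ.source := by
    rw [hsrc]; exact contMDiffOn_extChartAt (x := y)
  have hqs : ContMDiffOn ((𝓡∂ n).prod 𝓘(ℝ, ℝ)) 𝓘(ℝ, EuclideanSpace ℝ (Fin n)) ∞ q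
      (φ.source ×ˢ univ) := by
    have h1 : ContMDiffOn ((𝓡∂ n).prod 𝓘(ℝ, ℝ)) 𝓘(ℝ, EuclideanSpace ℝ (Fin n)) ∞
        (fun p : Y × ℝ => φ p.1) (φ.source ×ˢ univ) :=
      ContMDiffOn.comp (f := Prod.fst) hφs contMDiffOn_fst fun p hp => hp.1
    have h2 : ContMDiff ((𝓡∂ n).prod 𝓘(ℝ, ℝ)) 𝓘(ℝ, EuclideanSpace ℝ (Fin n)) ∞
        (fun p : Y × ℝ => (p.2 * f p.1) • e) :=
      (contMDiff_snd.mul (f.contMDiff.comp contMDiff_fst)).smul contMDiff_const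
    exact h1.add h2.contMDiffOn
  have hqc : ∀ p : Y × ℝ, halfSpaceCoord n (q p) = halfSpaceCoord n (φ p.1) + p.2 * f p.1 := by
    intro p
    simp [hq, he]
  obtain ⟨ε, hε, hεt⟩ : ∃ ε > 0, ∀ x ∈ φ.source, ∀ t ∈ Icc 0 ε, q (x, t) ∈ φ.target := by
    have htar : φ.target = (𝓡∂ n).symm ⁻¹' (chartAt (EuclideanHalfSpace n) y).target ∩
        range (𝓡∂ n) := extChartAt_target _ _
    set O := (𝓡∂ n).symm ⁻¹' (chartAt (EuclideanHalfSpace n) y).target with hO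
    have hOo : IsOpen O := (chartAt _ y).open_target.preimage (𝓡∂ n).continuous_symm
    have hK : IsCompact (tsupport f) := (isClosed_tsupport f).isCompact
    have h1 : ∀ᶠ t in 𝓝 (0 : ℝ), ∀ x ∈ tsupport f, q (x, t) ∈ O := by
      refine hK.eventually_forall_of_forall_eventually fun x hx => ?_
      have hxs : x ∈ φ.source := by
        rw [hsrc]; exact f.tsupport_subset_chartAt_source hx
      have h2 : ContinuousAt q (x, 0) :=
        (hqs.continuousOn.continuousAt (((isOpen_extChartAt_source y).prod isOpen_univ).mem_nhds
          ⟨hxs, mem_univ _⟩))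
      have h3 : q (x, 0) ∈ O := by
        have : q (x, 0) = φ x := by simp [hq]
        rw [this]
        exact (htar ▸ φ.map_source hxs).1
      have h4 : ContinuousAt (fun z : ℝ × Y => q (z.2, z.1)) (0, x) :=
        ContinuousAt.comp (g := q) (f := Prod.swap) h2 continuous_swap.continuousAt
      exact h4.eventually (hOo.mem_nhds h3)
    obtain ⟨ε, hε, h2⟩ := Metric.eventually_nhds_iff.1 h1
    refine ⟨ε / 2, by positivity, fun x hx t ht => ?_⟩
    by_cases hxt : x ∈ tsupport f
    · rw [htar]
      refine ⟨h2 (y := t) ?_ x hxt, ?_⟩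
      · rw [Real.dist_eq, sub_zero, abs_of_nonneg ht.1]
        linarith [ht.2]
      · rw [range_halfSpace_eq]
        change 0 ≤ halfSpaceCoord n (q (x, t))
        rw [hqc]
        exact add_nonneg (halfSpaceCoord_extChartAt_nonneg _ _) (mul_nonneg ht.1 f.nonneg)
    · have : q (x, t) = φ x := by simp [hq, image_eq_zero_of_notMem_tsupport hxt]
      rw [this]
      exact φ.map_source hx
  classical
  set Θ : Y × ℝ → Y := fun p => if p.1 ∈ φ.source then φ.symm (q p) else p.1 with hΘ
  have hΘs : ∀ x ∈ φ.source, ∀ t, Θ (x, t) = φ.symm (q (x, t)) := fun x hx t => if_pos hx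
  have hΘn : ∀ x ∉ φ.source, ∀ t, Θ (x, t) = x := fun x hx t => if_neg hx
  have hΘ0 : ∀ x t, t * f x = 0 → Θ (x, t) = x := by
    intro x t h0
    by_cases hx : x ∈ φ.source
    · rw [hΘs x hx]
      have : q (x, t) = φ x := by simp only [hq, h0, zero_smul, add_zero]
      rw [this, φ.left_inv hx]
    · exact hΘn x hx t
  have hcoord : ∀ x ∈ φ.source, ∀ t ∈ Icc 0 ε, Θ (x, t) ∈ φ.source ∧
      halfSpaceCoord n (φ (Θ (x, t))) = halfSpaceCoord n (φ x) + t * f x := by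
    intro x hx t ht
    rw [hΘs x hx]
    exact ⟨φ.map_target (hεt x hx t ht), by rw [φ.right_inv (hεt x hx t ht), hqc]⟩
  refine ⟨{x | x ∈ φ.source ∧ 0 < f x}, ?_, ε, Θ, hε, ?_, ?_, ?_, ?_, ?_⟩
  · have h1 : ∀ᶠ x in 𝓝 y, x ∈ φ.source := extChartAt_source_mem_nhds y
    have h2 : ∀ᶠ x in 𝓝 y, f x = 1 := f.eventuallyEq_one
    filter_upwards [h1, h2] with x h1 h2
    exact ⟨h1, by rw [h2]; exact one_pos⟩
  · rintro ⟨x, t⟩ ⟨-, ht⟩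
    by_cases hx : x ∈ tsupport f
    · have hxs : x ∈ φ.source := by
        rw [hsrc]; exact f.tsupport_subset_chartAt_source hx
      have h1 : ContMDiffOn ((𝓡∂ n).prod 𝓘(ℝ, ℝ)) (𝓡∂ n) ∞ (fun p => φ.symm (q p))
          (φ.source ×ˢ Icc 0 ε) :=
        (contMDiffOn_extChartAt_symm y).comp (hqs.mono (prod_mono_right (subset_univ _)))
          fun p hp => hεt p.1 hp.1 p.2 hp.2
      have h2 : ContMDiffOn ((𝓡∂ n).prod 𝓘(ℝ, ℝ)) (𝓡∂ n) ∞ Θ (φ.source ×ˢ Icc 0 ε) :=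
        h1.congr fun p hp => hΘs p.1 hp.1 p.2
      refine (h2 (x, t) ⟨hxs, ht⟩).mono_of_mem_nhdsWithin ?_
      have h3 : φ.source ×ˢ (univ : Set ℝ) ∈ 𝓝 (x, t) :=
        ((isOpen_extChartAt_source y).prod isOpen_univ).mem_nhds ⟨hxs, mem_univ _⟩
      filter_upwards [self_mem_nhdsWithin, mem_nhdsWithin_of_mem_nhds h3] with p hp hp'
      exact ⟨hp'.1, hp.2⟩
    · have h1 : ∀ᶠ p : Y × ℝ in 𝓝 (x, t), Θ p = p.1 := by
        have h2 : ∀ᶠ p : Y × ℝ in 𝓝 (x, t), p.1 ∈ (tsupport f)ᶜ :=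
          continuous_fst.continuousAt.eventually
            ((isClosed_tsupport f).isOpen_compl.mem_nhds hx)
        filter_upwards [h2] with p hp
        exact hΘ0 p.1 p.2 (by rw [image_eq_zero_of_notMem_tsupport hp, mul_zero])
      exact (contMDiffAt_fst.congr_of_eventuallyEq h1).contMDiffWithinAt
  · exact fun x => hΘ0 x 0 (zero_mul _)
  · intro x t ht hb
    by_cases hx : x ∈ φ.source
    · obtain ⟨h1, h2⟩ := hcoord x hx t ht
      rw [mem_boundary_iff_halfSpaceCoord_eq_zero (hsrc ▸ h1)] at hb
      refine hΘ0 x t ?_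
      have h3 := halfSpaceCoord_extChartAt_nonneg (n := n) y x
      have h4 : 0 ≤ t * f x := mul_nonneg ht.1 f.nonneg
      have h5 : halfSpaceCoord n (φ (Θ (x, t))) = 0 := hb
      have h6 : 0 ≤ halfSpaceCoord n (φ x) := h3
      linarith
    · exact hΘn x hx t
  · rintro x ⟨hx, hfx⟩ t ht
    obtain ⟨h1, h2⟩ := hcoord x hx t ⟨ht.1.le, ht.2⟩
    rw [mem_interior_iff_halfSpaceCoord_pos (hsrc ▸ h1)]
    change 0 < halfSpaceCoord n (φ (Θ (x, t)))
    rw [h2]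
    exact add_pos_of_nonneg_of_pos (halfSpaceCoord_extChartAt_nonneg _ _) (mul_pos ht.1 hfx)
  · intro x hx
    by_cases hxs : x ∈ φ.source
    swap
    · refine ⟨0, le_rfl, ?_, fun h => absurd h.1 hxs⟩
      have : (fun t => d (Θ (x, t))) = fun _ => d x := by
        ext t
        rw [hΘn x hxs]
      rw [this]
      exact hasDerivWithinAt_const _ _ _
    set D : EuclideanSpace ℝ (Fin n) → ℝ := fun z => d (φ.symm z) with hD
    have hDs : ContDiffOn ℝ ∞ D φ.target :=
      contMDiffOn_iff_contDiffOn.1 (hd.1.comp_contMDiffOn (contMDiffOn_extChartAt_symm y))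
    have hzt : φ x ∈ φ.target := φ.map_source hxs
    set R : Set (EuclideanSpace ℝ (Fin n)) := {z | 0 ≤ halfSpaceCoord n z} with hR
    have htR : φ.target ∈ 𝓝[R] (φ x) := by
      rw [hR, ← range_halfSpace_eq]
      exact extChartAt_target_mem_nhdsWithin' hxs
    have hDd : HasFDerivWithinAt D (fderivWithin ℝ D R (φ x)) R (φ x) := by
      have h1 : DifferentiableWithinAt ℝ D φ.target (φ x) :=
        (hDs _ hzt).differentiableWithinAt (by simp)
      exact (h1.mono_of_mem_nhdsWithin htR).hasFDerivWithinAt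
    set D' := fderivWithin ℝ D R (φ x) with hD'
    have hz0 : halfSpaceCoord n (φ x) = 0 :=
      (mem_boundary_iff_halfSpaceCoord_eq_zero (hsrc ▸ hxs)).1 hx
    have hmin : IsLocalMinOn D R (φ x) := by
      refine Filter.Eventually.of_forall fun z => ?_
      change d (φ.symm (φ x)) ≤ d (φ.symm z)
      rw [φ.left_inv hxs, hd.2.2.1 x hx]
      exact hd.2.1 _
    obtain ⟨hnn, hform⟩ := hasFDerivWithinAt_boundary_min hDd hz0 hmin
    -- If `D' e` were zero, all of `D'` would vanish, and with it the differential of `d = D ∘ φ`,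
    -- against its positivity on the inward normal.
    have hpos : 0 < D' e := by
      refine lt_of_le_of_ne hnn fun h0 => ?_
      have h1 := hd.2.2.2.2 x (mem_univ _) hx
      have h2 := chartDeriv_apply_of_comp_within (I := 𝓡∂ n)
        (J := 𝓘(ℝ, EuclideanSpace ℝ (Fin n))) (J' := 𝓘(ℝ, ℝ)) (F := φ) (G := D) (K := d) (u := R)
        (x := x) ((contMDiffAt_extChartAt' (n := ∞) (hsrc ▸ hxs)).mdifferentiableAt (by simp))
        hDd.differentiableWithinAt.mdifferentiableWithinAt
        (Filter.Eventually.of_forall fun z => halfSpaceCoord_extChartAt_nonneg _ _)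
        (by
          filter_upwards [(isOpen_extChartAt_source y).mem_nhds hxs] with z hz
          change d (φ.symm (φ z)) = d z
          rw [φ.left_inv hz]) e
      rw [h2] at h1
      have h3 : ∀ w, (show EuclideanSpace ℝ (Fin n) →L[ℝ] ℝ from
          mfderivWithin 𝓘(ℝ, EuclideanSpace ℝ (Fin n)) 𝓘(ℝ, ℝ) D R (φ x)) w = 0 := by
        intro w
        rw [mfderivWithin_eq_fderivWithin]
        change D' w = 0
        rw [hform, ← h0, mul_zero]
      rw [h3] at h1
      exact lt_irrefl _ h1
    refine ⟨f x * D' e, mul_nonneg f.nonneg hnn, ?_, fun h => mul_pos h.2 hpos⟩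
    have hc : HasDerivWithinAt (fun t : ℝ => q (x, t)) (f x • e) (Icc 0 ε) 0 := by
      have h1 : HasDerivAt (fun t : ℝ => φ x + (t * f x) • e) ((1 * f x) • e) 0 :=
        (((hasDerivAt_id (0 : ℝ)).mul_const (f x)).smul_const e).const_add (φ x)
      rw [one_mul] at h1
      exact h1.hasDerivWithinAt
    have hq0 : q (x, 0) = φ x := by simp [hq]
    have h1 : HasDerivWithinAt (fun t : ℝ => D (q (x, t))) (D' (f x • e)) (Icc 0 ε) 0 := by
      refine HasFDerivWithinAt.comp_hasDerivWithinAt (l := D) (l' := D') (t := R) (0 : ℝ) ?_ hc ?_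
      · rw [hq0]
        exact hDd
      · intro t ht
        change 0 ≤ halfSpaceCoord n (q (x, t))
        rw [hqc]
        exact add_nonneg (halfSpaceCoord_extChartAt_nonneg _ _) (mul_nonneg ht.1 f.nonneg)
    rw [map_smul, smul_eq_mul] at h1
    refine h1.congr_of_mem (fun t ht => ?_) ⟨le_rfl, hε.le⟩
    rw [hΘs x hxs]

/-- Composing finitely many local pushes takes the place of integrating an inward vector field. -/
theorem exists_isInwardPush [IsManifold (𝓡∂ n) ∞ Y] [T2Space Y] [CompactSpace Y]
    (hd : IsBoundaryDefiningOn n d univ) : ∃ ε Θ, IsInwardPush n d univ ε Θ := by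
  refine isCompact_univ.induction_on (p := fun s => ∃ ε Θ, IsInwardPush n d s ε Θ)
    ⟨_, _, isInwardPush_empty d⟩ ?_ ?_ ?_
  · rintro s t hst ⟨ε, Θ, h⟩
    exact ⟨ε, Θ, h.mono hst h.pos le_rfl⟩
  · rintro s t ⟨ε, Θ, h⟩ ⟨ε', Θ', h'⟩
    exact ⟨_, _, (h.mono subset_rfl (lt_min h.pos h'.pos) (min_le_left _ _)).comp hd
      (h'.mono subset_rfl (lt_min h.pos h'.pos) (min_le_right _ _))⟩
  · intro y _
    obtain ⟨K, hK, ε, Θ, h⟩ := exists_isInwardPush_nhds hd y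
    exact ⟨K, by rwa [nhdsWithin_univ], ε, Θ, h⟩

end Collar


/-! ### Collars of a boundary component. -/

section Collar

variable {m n : ℕ} [NeZero n]
  {M : Type*} [TopologicalSpace M] [ChartedSpace (EuclideanSpace ℝ (Fin m)) M]
  {Y : Type*} [TopologicalSpace Y] [ChartedSpace (EuclideanHalfSpace n) Y]

/-- A collar of length `ε` on a closed manifold `M` embedded in the boundary of `Y` by `ι`. -/
structure IsCollar (m n : ℕ) [NeZero n]
    {M : Type*} [TopologicalSpace M] [ChartedSpace (EuclideanSpace ℝ (Fin m)) M]
    {Y : Type*} [TopologicalSpace Y] [ChartedSpace (EuclideanHalfSpace n) Y]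
    (ι : M → Y) (ε : ℝ) (C : M × ℝ → Y) : Prop where
  pos : 0 < ε
  contMDiffOn : ContMDiffOn ((𝓡 m).prod 𝓘(ℝ, ℝ)) (𝓡∂ n) ∞ C (univ ×ˢ Icc 0 ε)
  zero : ∀ x, C (x, 0) = ι x
  injOn : InjOn C (univ ×ˢ Icc 0 ε)
  mem_interior : ∀ x, ∀ t ∈ Ioc 0 ε, C (x, t) ∈ (𝓡∂ n).interior Y
  injective_deriv : ∀ p ∈ (univ : Set M) ×ˢ Icc 0 ε,
    ∃ C' : EuclideanSpace ℝ (Fin m) × ℝ →L[ℝ] EuclideanSpace ℝ (Fin n),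
      HasMFDerivWithinAt ((𝓡 m).prod 𝓘(ℝ, ℝ)) (𝓡∂ n) C (univ ×ˢ Icc 0 ε) p C' ∧
      Function.Injective C'
  transverse : ∀ x : M, ∃ C' : EuclideanSpace ℝ (Fin m) × ℝ →L[ℝ] EuclideanSpace ℝ (Fin n),
      HasMFDerivWithinAt ((𝓡 m).prod 𝓘(ℝ, ℝ)) (𝓡∂ n) C (univ ×ˢ Icc 0 ε) (x, 0) C' ∧
      ∃ c > 0, ∀ p, halfSpaceCoord n (C' p) = c * p.2

variable [IsManifold (𝓡∂ n) ∞ Y]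
  {d : Y → ℝ} {ε : ℝ} {Θ : Y × ℝ → Y} {ι : M → Y}

/-- The function `d` vanishes along `ι`, so the directions of `M` map to tangent vectors of the
boundary, while the time direction has positive normal speed. The differential is block triangular
with injective diagonal blocks. -/
theorem IsInwardPush.exists_deriv_comp (hd : IsBoundaryDefiningOn n d univ)
    (hΘ : IsInwardPush n d univ ε Θ) (hι : ContMDiff (𝓡 m) (𝓡∂ n) ∞ ι)
    (hιb : ∀ x, ι x ∈ (𝓡∂ n).boundary Y) {x : M}
    (hιd : Function.Injective (mfderiv (𝓡 m) (𝓡∂ n) ι x)) :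
    ∃ C' : EuclideanSpace ℝ (Fin m) × ℝ →L[ℝ] EuclideanSpace ℝ (Fin n),
      HasMFDerivWithinAt ((𝓡 m).prod 𝓘(ℝ, ℝ)) (𝓡∂ n) (fun p : M × ℝ => Θ (ι p.1, p.2))
        (univ ×ˢ Icc 0 ε) (x, 0) C' ∧ Function.Injective C' ∧
      ∃ c > 0, ∀ p, halfSpaceCoord n (C' p) = c * p.2 := by
  set C : M × ℝ → Y := fun p => Θ (ι p.1, p.2) with hC
  set s : Set (M × ℝ) := univ ×ˢ Icc 0 ε with hs
  have h0 : (0 : ℝ) ∈ Icc 0 ε := ⟨le_rfl, hΘ.pos.le⟩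
  have huniq : UniqueDiffWithinAt ℝ (Icc 0 ε) 0 := uniqueDiffOn_Icc hΘ.pos 0 h0
  have hCs : ContMDiffOn ((𝓡 m).prod 𝓘(ℝ, ℝ)) (𝓡∂ n) ∞ C s :=
    hΘ.contMDiffOn.comp ((hι.comp contMDiff_fst).prodMk contMDiff_snd).contMDiffOn
      fun p hp => ⟨mem_univ _, hp.2⟩
  have hC0 : ∀ y, C (y, 0) = ι y := fun y => hΘ.zero _
  set C' : EuclideanSpace ℝ (Fin m) × ℝ →L[ℝ] EuclideanSpace ℝ (Fin n) :=
    mfderivWithin ((𝓡 m).prod 𝓘(ℝ, ℝ)) (𝓡∂ n) C s (x, 0) with hC'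
  have hCd : HasMFDerivWithinAt ((𝓡 m).prod 𝓘(ℝ, ℝ)) (𝓡∂ n) C s (x, 0) C' :=
    ((hCs (x, 0) ⟨mem_univ _, h0⟩).mdifferentiableWithinAt (by simp)).hasMFDerivWithinAt
  have hM : ∀ w, C' (w, 0) = chartDeriv (𝓡 m) (𝓡∂ n) ι x w := by
    intro w
    have h1 : HasMFDerivAt (𝓡 m) ((𝓡 m).prod 𝓘(ℝ, ℝ)) (fun y : M => (y, (0 : ℝ))) x
        ((ContinuousLinearMap.id ℝ (EuclideanSpace ℝ (Fin m))).prod 0) :=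
      (hasMFDerivAt_id x).prodMk (hasMFDerivAt_const 0 x)
    have h2 := HasMFDerivWithinAt.comp (f := fun y : M => (y, (0 : ℝ))) (g := C)
      x hCd (h1.hasMFDerivWithinAt (s := univ)) fun y _ => ⟨mem_univ _, h0⟩
    rw [show C ∘ (fun y : M => (y, (0 : ℝ))) = ι from funext hC0] at h2
    rw [chartDeriv, (hasMFDerivWithinAt_univ.1 h2).mfderiv]
    rfl
  have hdx := hd.mfderiv_nonneg (hιb x)
  set a := chartDeriv (𝓡∂ n) 𝓘(ℝ, ℝ) d (ι x) (inwardNormal n) with ha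
  have hapos : 0 < a := hd.2.2.2.2 _ (mem_univ _) (hιb x)
  have htan : ∀ w, halfSpaceCoord n (chartDeriv (𝓡 m) (𝓡∂ n) ι x w) = 0 := by
    intro w
    have h1 := chartDeriv_apply_of_comp (I := 𝓡 m) (J := 𝓡∂ n) (J' := 𝓘(ℝ, ℝ)) (F := ι) (G := d)
      (K := fun _ => (0 : ℝ)) (x := x) (hι.contMDiffAt.mdifferentiableAt (by simp))
      (hd.1.contMDiffAt.mdifferentiableAt (by simp))
      (Filter.Eventually.of_forall fun y => hd.2.2.1 _ (hιb y)) w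
    have h2 : chartDeriv (𝓡 m) 𝓘(ℝ, ℝ) (fun _ : M => (0 : ℝ)) x w = 0 := by
      rw [chartDeriv, mfderiv_const]
      rfl
    rw [h2, hdx.2] at h1
    exact (mul_eq_zero.1 h1.symm).resolve_right hapos.ne'
  have hnor : 0 < halfSpaceCoord n (C' (0, 1)) := by
    obtain ⟨c, -, hc, hcpos⟩ := hΘ.deriv (ι x) (hιb x)
    have h1 : HasMFDerivWithinAt 𝓘(ℝ, ℝ) ((𝓡 m).prod 𝓘(ℝ, ℝ)) (fun t : ℝ => (x, t)) (Icc 0 ε) 0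
        ((0 : ℝ →L[ℝ] EuclideanSpace ℝ (Fin m)).prod (ContinuousLinearMap.id ℝ ℝ)) :=
      (hasMFDerivWithinAt_const _ _ _).prodMk (hasMFDerivWithinAt_id _ _)
    have h2 := HasMFDerivWithinAt.comp (f := fun t : ℝ => (x, t)) (g := C) (0 : ℝ) hCd h1
      fun t ht => ⟨mem_univ _, ht⟩
    have hdd : HasMFDerivAt (𝓡∂ n) 𝓘(ℝ, ℝ) d (C (x, 0)) (chartDeriv (𝓡∂ n) 𝓘(ℝ, ℝ) d (ι x)) := by
      rw [hC0]
      exact (hd.1.contMDiffAt.mdifferentiableAt (by simp)).hasMFDerivAt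
    have h3 := HasMFDerivWithinAt.comp (f := C ∘ fun t : ℝ => (x, t)) (g := d) (0 : ℝ)
      (hdd.hasMFDerivWithinAt (s := univ)) h2 fun t _ => mem_univ _
    have h4 : HasDerivWithinAt (fun t => d (Θ (ι x, t)))
        (chartDeriv (𝓡∂ n) 𝓘(ℝ, ℝ) d (ι x) (C' (0, 1))) (Icc 0 ε) 0 :=
      HasMFDerivWithinAt.hasDerivWithinAt (L := (chartDeriv (𝓡∂ n) 𝓘(ℝ, ℝ) d (ι x)).comp
        (C'.comp ((0 : ℝ →L[ℝ] EuclideanSpace ℝ (Fin m)).prod (ContinuousLinearMap.id ℝ ℝ)))) h3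
    have h5 := huniq.eq_deriv _ h4 hc
    rw [hdx.2] at h5
    exact pos_of_mul_pos_left (h5 ▸ hcpos (mem_univ _)) hapos.le
  have hform : ∀ p, halfSpaceCoord n (C' p) = halfSpaceCoord n (C' (0, 1)) * p.2 := by
    rintro ⟨w, t⟩
    have h1 : ((w, t) : EuclideanSpace ℝ (Fin m) × ℝ) = (w, 0) + t • (0, 1) := by simp
    rw [h1, map_add, map_add, hM, htan, map_smul, map_smul, smul_eq_mul]
    simp [mul_comm]
  refine ⟨C', hCd, ?_, _, hnor, hform⟩
  rw [injective_iff_map_eq_zero]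
  rintro ⟨w, t⟩ hp
  have h1 := hform (w, t)
  rw [hp, map_zero] at h1
  have ht : t = 0 := (mul_eq_zero.1 h1.symm).resolve_left hnor.ne'
  subst ht
  rw [hM] at hp
  rw [injective_mfderiv_iff.1 hιd w hp]
  rfl

/-- The inverse function theorem on half spaces in charts, with time as the coordinate that is
nonnegative on the source. A left inverse at times `≥ 0` is enough for injectivity of the collar
near `(x, 0)` and of its differentials there. -/
theorem exists_leftInverse_collar [IsManifold (𝓡 m) ∞ M] (hmn : m + 1 = n) {C : M × ℝ → Y} (hε : 0 < ε)
    (hC : ContMDiffOn ((𝓡 m).prod 𝓘(ℝ, ℝ)) (𝓡∂ n) ∞ C (univ ×ˢ Icc 0 ε))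
    (hCb : ∀ x, C (x, 0) ∈ (𝓡∂ n).boundary Y)
    (hCi : ∀ x, ∀ t ∈ Ioc 0 ε, C (x, t) ∈ (𝓡∂ n).interior Y) (x : M)
    {C' : EuclideanSpace ℝ (Fin m) × ℝ →L[ℝ] EuclideanSpace ℝ (Fin n)}
    (hC' : HasMFDerivWithinAt ((𝓡 m).prod 𝓘(ℝ, ℝ)) (𝓡∂ n) C (univ ×ˢ Icc 0 ε) (x, 0) C')
    (hinj : Function.Injective C') {c : ℝ} (hc : 0 < c)
    (htr : ∀ p, halfSpaceCoord n (C' p) = c * p.2) :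
    ∃ (G : Y → M × ℝ) (u : Set Y), MDifferentiableOn (𝓡∂ n) ((𝓡 m).prod 𝓘(ℝ, ℝ)) G u ∧
      ∀ᶠ p in 𝓝 (x, (0 : ℝ)), 0 ≤ p.2 → C p ∈ u ∧ G (C p) = p := by
  set s : Set (M × ℝ) := univ ×ˢ Icc 0 ε with hs
  have h0 : (0 : ℝ) ∈ Icc 0 ε := ⟨le_rfl, hε.le⟩
  set ψ := extChartAt (𝓡 m) x with hψ
  set φ := extChartAt (𝓡∂ n) (C (x, 0)) with hφ
  have hφsrc : φ.source = (chartAt (EuclideanHalfSpace n) (C (x, 0))).source := extChartAt_source _ _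
  set f : EuclideanSpace ℝ (Fin m) × ℝ → EuclideanSpace ℝ (Fin n) :=
    fun z => φ (C (ψ.symm z.1, z.2)) with hf
  set ℓ : EuclideanSpace ℝ (Fin m) × ℝ →L[ℝ] ℝ := ContinuousLinearMap.snd ℝ _ _ with hℓ
  set z₀ : EuclideanSpace ℝ (Fin m) × ℝ := (ψ x, 0) with hz₀
  have hψo : IsOpen ψ.target := isOpen_extChartAt_target x
  have hψx : ψ x ∈ ψ.target := mem_extChartAt_target x
  -- a neighbourhood on which everything is written in charts
  obtain ⟨W, hWo, hxW, hW⟩ : ∃ W : Set (M × ℝ), IsOpen W ∧ (x, (0 : ℝ)) ∈ W ∧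
      ∀ p ∈ W ∩ s, C p ∈ φ.source := by
    have h1 : ∀ᶠ p in 𝓝[s] (x, (0 : ℝ)), C p ∈ φ.source :=
      (hC.continuousOn (x, 0) ⟨mem_univ _, h0⟩).eventually (extChartAt_source_mem_nhds _)
    exact mem_nhdsWithin.1 h1
  set κ : EuclideanSpace ℝ (Fin m) × ℝ → M × ℝ := fun z => (ψ.symm z.1, z.2) with hκ
  have hκs : ContMDiffOn 𝓘(ℝ, EuclideanSpace ℝ (Fin m) × ℝ) ((𝓡 m).prod 𝓘(ℝ, ℝ)) ∞ κ
      (ψ.target ×ˢ univ) :=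
    ContMDiffOn.prodMk ((contMDiffOn_extChartAt_symm x).comp contDiff_fst.contMDiff.contMDiffOn
      fun z hz => hz.1) contDiff_snd.contMDiff.contMDiffOn
  have hκz : κ z₀ = (x, 0) := by
    simp only [hκ, hz₀]
    rw [extChartAt_to_inv]
  set U : Set (EuclideanSpace ℝ (Fin m) × ℝ) :=
    (ψ.target ×ˢ univ) ∩ κ ⁻¹' W ∩ {z | z.2 < ε} with hU
  have hUo : IsOpen U :=
    (hκs.continuousOn.isOpen_inter_preimage (hψo.prod isOpen_univ) hWo).inter
      (isOpen_lt continuous_snd continuous_const)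
  have hzU : z₀ ∈ U := by
    refine ⟨⟨⟨hψx, mem_univ _⟩, ?_⟩, hε⟩
    change κ z₀ ∈ W
    rwa [hκz]
  have hUs : ∀ z ∈ U, 0 ≤ ℓ z → κ z ∈ s ∧ C (κ z) ∈ φ.source := by
    intro z hz hz0
    have h1 : κ z ∈ s := ⟨mem_univ _, hz0, le_of_lt hz.2⟩
    exact ⟨h1, hW _ ⟨hz.1.2, h1⟩⟩
  have hfs : ContDiffOn ℝ ∞ f ({z | 0 ≤ ℓ z} ∩ U) := by
    refine contMDiffOn_iff_contDiffOn.1 ?_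
    have h1 : ContMDiffOn 𝓘(ℝ, EuclideanSpace ℝ (Fin m) × ℝ) (𝓡∂ n) ∞ (C ∘ κ)
        ({z | 0 ≤ ℓ z} ∩ U) :=
      hC.comp (hκs.mono fun z hz => hz.2.1.1) fun z hz => (hUs z hz.2 hz.1).1
    have h2 : ContMDiffOn (𝓡∂ n) 𝓘(ℝ, EuclideanSpace ℝ (Fin n)) ∞ φ φ.source := by
      rw [hφsrc]; exact contMDiffOn_extChartAt (x := C (x, 0))
    exact h2.comp h1 fun z hz => (hUs z hz.2 hz.1).2
  have hdim : Module.finrank ℝ (EuclideanSpace ℝ (Fin m) × ℝ)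
      = Module.finrank ℝ (EuclideanSpace ℝ (Fin n)) := by
    rw [Module.finrank_prod]
    simp [hmn]
  set L : (EuclideanSpace ℝ (Fin m) × ℝ) ≃L[ℝ] EuclideanSpace ℝ (Fin n) :=
    (LinearEquiv.ofInjectiveOfFinrankEq (C' : _ →ₗ[ℝ] _) hinj hdim).toContinuousLinearEquiv with hL
  have hLC : (L : _ →L[ℝ] _) = C' := ContinuousLinearMap.ext fun z => rfl
  have hfd : HasFDerivWithinAt f (L : _ →L[ℝ] _) {z | 0 ≤ ℓ z} z₀ := by
    rw [hLC]
    have h1 : HasFDerivWithinAt f C' _ z₀ := hC'.2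
    refine h1.mono_of_mem_nhdsWithin ?_
    filter_upwards [self_mem_nhdsWithin, mem_nhdsWithin_of_mem_nhds (hUo.mem_nhds hzU)] with z hz hzU'
    refine ⟨(hUs z hzU' hz).1, ?_⟩
    simp
  obtain ⟨Φ, hΦz, hΦU, hΦf, -, hΦs⟩ := exists_halfSpace_localInverse ℓ
    (e := ((0, 1) : EuclideanSpace ℝ (Fin m) × ℝ)) rfl (halfSpaceCoord n) (hUo.mem_nhds hzU)
    (le_refl (0 : ℝ)) hfs L hfd
    (by
      intro z hz hz0
      refine ⟨halfSpaceCoord_extChartAt_nonneg _ _, ?_⟩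
      have h1 := (hUs z hz hz0).2
      change halfSpaceCoord n (φ (C (κ z))) = 0 ↔ ℓ z = 0
      rw [← mem_boundary_iff_halfSpaceCoord_eq_zero (hφsrc ▸ h1)]
      constructor
      · intro hb
        by_contra hne
        have h2 := hCi (ψ.symm z.1) z.2 ⟨lt_of_le_of_ne hz0 (Ne.symm hne), le_of_lt hz.2⟩
        rw [← (𝓡∂ n).compl_boundary] at h2
        exact h2 hb
      · intro hz1
        have h2 : κ z = (ψ.symm z.1, 0) := Prod.ext rfl hz1
        rw [h2]
        exact hCb _)
    (fun _ => by
      have : halfSpaceCoord n (C' (0, 1)) = c := by rw [htr, mul_one]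
      change 0 < halfSpaceCoord n (C' (0, 1))
      rwa [this])
  refine ⟨fun y => κ (Φ.symm (φ y)), {y | y ∈ φ.source ∧ φ y ∈ Φ.target}, ?_, ?_⟩
  · have h1 : ContMDiffOn (𝓡∂ n) 𝓘(ℝ, EuclideanSpace ℝ (Fin m) × ℝ) ∞ (fun y => Φ.symm (φ y))
        {y | y ∈ φ.source ∧ φ y ∈ Φ.target} := by
      have h2 : ContMDiffOn (𝓡∂ n) 𝓘(ℝ, EuclideanSpace ℝ (Fin n)) ∞ φ φ.source := by
        rw [hφsrc]; exact contMDiffOn_extChartAt (x := C (x, 0))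
      exact hΦs.contMDiffOn.comp (h2.mono fun y hy => hy.1)
        fun y hy => ⟨hy.2, halfSpaceCoord_extChartAt_nonneg _ _⟩
    exact (hκs.comp h1 fun y hy => (hΦU (Φ.map_target hy.2)).1.1).mdifferentiableOn (by simp)
  · have h1 : ContinuousAt (fun p : M × ℝ => ((ψ p.1, p.2) : EuclideanSpace ℝ (Fin m) × ℝ))
        (x, (0 : ℝ)) :=
      (ContinuousAt.comp (g := ψ) (f := Prod.fst) (x := (x, (0 : ℝ)))
        (continuousAt_extChartAt (I := 𝓡 m) x) continuous_fst.continuousAt).prodMk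
        continuous_snd.continuousAt
    have h2 : ∀ᶠ p : M × ℝ in 𝓝 (x, (0 : ℝ)), (ψ p.1, p.2) ∈ Φ.source :=
      h1.eventually (Φ.open_source.mem_nhds hΦz)
    have h3 : ∀ᶠ p : M × ℝ in 𝓝 (x, (0 : ℝ)), p.1 ∈ ψ.source :=
      continuous_fst.continuousAt.eventually (extChartAt_source_mem_nhds x)
    filter_upwards [h2, h3] with p hp hp' hp0
    have hκp : κ (ψ p.1, p.2) = p := Prod.ext (ψ.left_inv hp') rfl
    have h4 := hΦf _ hp hp0
    have h5 : f (ψ p.1, p.2) = φ (C p) := by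
      change φ (C (κ (ψ p.1, p.2))) = _
      rw [hκp]
    have h6 := (hUs _ (hΦU hp) hp0).2
    rw [hκp] at h6
    refine ⟨⟨h6, ?_⟩, ?_⟩
    · rw [← h5, ← h4]
      exact Φ.map_source hp
    · rw [← h5, ← h4, Φ.left_inv hp, hκp]

/-- A closed manifold embedded in the boundary with codimension zero has collars, which are moreover
contained in any neighbourhood of the boundary. -/
theorem exists_isCollar [IsManifold (𝓡 m) ∞ M] [T2Space Y] [CompactSpace Y] [CompactSpace M] (hmn : m + 1 = n)
    (hι : ContMDiff (𝓡 m) (𝓡∂ n) ∞ ι) (hιi : Function.Injective ι)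
    (hιb : ∀ x, ι x ∈ (𝓡∂ n).boundary Y)
    (hιd : ∀ x, Function.Injective (mfderiv (𝓡 m) (𝓡∂ n) ι x))
    {N : Set Y} (hN : N ∈ 𝓝ˢ ((𝓡∂ n).boundary Y)) :
    ∃ ε C, IsCollar m n ι ε C ∧ ∀ x, ∀ t ∈ Icc 0 ε, C (x, t) ∈ N := by
  obtain ⟨d, hd⟩ := exists_boundaryDefining n Y
  obtain ⟨ε, Θ, hΘ⟩ := exists_isInwardPush hd
  set C : M × ℝ → Y := fun p => Θ (ι p.1, p.2) with hC
  have hCs : ContMDiffOn ((𝓡 m).prod 𝓘(ℝ, ℝ)) (𝓡∂ n) ∞ C (univ ×ˢ Icc 0 ε) :=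
    hΘ.contMDiffOn.comp ((hι.comp contMDiff_fst).prodMk contMDiff_snd).contMDiffOn
      fun p hp => ⟨mem_univ _, hp.2⟩
  have hC0 : ∀ y, C (y, 0) = ι y := fun y => hΘ.zero _
  have hCi : ∀ x, ∀ t ∈ Ioc 0 ε, C (x, t) ∈ (𝓡∂ n).interior Y := fun x t ht =>
    hΘ.mem_interior _ (mem_univ _) t ht
  have hder := fun x => hΘ.exists_deriv_comp hd hι hιb (hιd x)
  have hinv : ∀ x, ∃ (G : Y → M × ℝ) (u : Set Y),
      MDifferentiableOn (𝓡∂ n) ((𝓡 m).prod 𝓘(ℝ, ℝ)) G u ∧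
      ∀ᶠ p in 𝓝 (x, (0 : ℝ)), 0 ≤ p.2 → C p ∈ u ∧ G (C p) = p := by
    intro x
    obtain ⟨C', h1, h2, c, h3, h4⟩ := hder x
    exact exists_leftInverse_collar hmn hΘ.pos hCs (fun y => by rw [hC0]; exact hιb y) hCi x h1 h2 h3 h4
  -- a continuous extension of the collar
  set Q : ℝ × M → Y := fun p => C (p.2, max 0 (min p.1 ε)) with hQ
  have hQc : Continuous Q := by
    refine hCs.continuousOn.comp_continuous (by fun_prop) fun p => ⟨mem_univ _, ?_, ?_⟩
    · exact le_max_left _ _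
    · exact max_le hΘ.pos.le (min_le_right _ _)
  have hQC : ∀ x, ∀ t ∈ Icc 0 ε, Q (t, x) = C (x, t) := fun x t ht => by
    simp only [hQ]
    rw [min_eq_left ht.2, max_eq_right ht.1]
  have h0 : (0 : ℝ) ∈ Icc 0 ε := ⟨le_rfl, hΘ.pos.le⟩
  have e1 : ∀ᶠ t in 𝓝 (0 : ℝ), ∀ x ∈ (univ : Set M), Q (t, x) ∈ interior N := by
    refine isCompact_univ.eventually_forall_of_forall_eventually fun x _ => ?_
    refine hQc.continuousAt.eventually (isOpen_interior.mem_nhds ?_)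
    rw [hQC x 0 h0, hC0]
    exact subset_interior_iff_mem_nhdsSet.2 hN (hιb x)
  -- The left inverse around `(x, 0)` is differentiable on `u`, so the chain rule makes the
  -- differential of `C` injective at all nearby collar points. Compactness of `M` makes the time
  -- uniform.
  have e2 : ∀ᶠ t in 𝓝 (0 : ℝ), ∀ x ∈ (univ : Set M), 0 ≤ t → t ≤ ε →
      ∃ C' : EuclideanSpace ℝ (Fin m) × ℝ →L[ℝ] EuclideanSpace ℝ (Fin n),
        HasMFDerivWithinAt ((𝓡 m).prod 𝓘(ℝ, ℝ)) (𝓡∂ n) C (univ ×ˢ Icc 0 ε) (x, t) C' ∧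
        Function.Injective C' := by
    refine isCompact_univ.eventually_forall_of_forall_eventually fun x _ => ?_
    obtain ⟨G, u, hG, hGC⟩ := hinv x
    have h1 : Filter.Tendsto (Prod.swap : ℝ × M → M × ℝ) (𝓝 (0, x)) (𝓝 (x, 0)) :=
      continuous_swap.continuousAt
    filter_upwards [h1.eventually hGC.eventually_nhds] with p hp hp0 hpε
    set s : Set (M × ℝ) := univ ×ˢ Icc 0 ε
    set q : M × ℝ := (p.2, p.1)
    have hqs : q ∈ s := ⟨mem_univ _, hp0, hpε⟩
    have hp' : ∀ᶠ p' in 𝓝 q, 0 ≤ p'.2 → C p' ∈ u ∧ G (C p') = p' := hp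
    set C' : EuclideanSpace ℝ (Fin m) × ℝ →L[ℝ] EuclideanSpace ℝ (Fin n) :=
      mfderivWithin ((𝓡 m).prod 𝓘(ℝ, ℝ)) (𝓡∂ n) C s q with hC'
    have hCd : HasMFDerivWithinAt ((𝓡 m).prod 𝓘(ℝ, ℝ)) (𝓡∂ n) C s q C' :=
      ((hCs q hqs).mdifferentiableWithinAt (by simp)).hasMFDerivWithinAt
    refine ⟨C', hCd, ?_⟩
    have hsu : UniqueMDiffWithinAt ((𝓡 m).prod 𝓘(ℝ, ℝ)) s q :=
      (uniqueMDiffOn_univ.prod (uniqueDiffOn_Icc hΘ.pos).uniqueMDiffOn) q hqs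
    have hqu := hp'.self_of_nhds hp0
    set G' : EuclideanSpace ℝ (Fin n) →L[ℝ] EuclideanSpace ℝ (Fin m) × ℝ :=
      mfderivWithin (𝓡∂ n) ((𝓡 m).prod 𝓘(ℝ, ℝ)) G u (C q) with hG'
    have hGd : HasMFDerivWithinAt (𝓡∂ n) ((𝓡 m).prod 𝓘(ℝ, ℝ)) G u (C q) G' :=
      (hG (C q) hqu.1).hasMFDerivWithinAt
    have h2 : HasMFDerivWithinAt ((𝓡 m).prod 𝓘(ℝ, ℝ)) ((𝓡 m).prod 𝓘(ℝ, ℝ)) (G ∘ C)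
        (s ∩ C ⁻¹' u) q (G'.comp C') :=
      HasMFDerivWithinAt.comp q hGd (hCd.mono inter_subset_left) fun y hy => hy.2
    have h3 : HasMFDerivWithinAt ((𝓡 m).prod 𝓘(ℝ, ℝ)) ((𝓡 m).prod 𝓘(ℝ, ℝ)) (G ∘ C)
        s q (G'.comp C') := by
      refine h2.mono_of_mem_nhdsWithin ?_
      filter_upwards [self_mem_nhdsWithin, mem_nhdsWithin_of_mem_nhds hp'] with y hy hy'
      exact ⟨hy, (hy' hy.2.1).1⟩
    have h4 : HasMFDerivWithinAt ((𝓡 m).prod 𝓘(ℝ, ℝ)) ((𝓡 m).prod 𝓘(ℝ, ℝ)) (id : M × ℝ → M × ℝ)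
        s q (G'.comp C') := by
      refine h3.congr_of_eventuallyEq ?_ (hqu.2).symm
      filter_upwards [self_mem_nhdsWithin, mem_nhdsWithin_of_mem_nhds hp'] with y hy hy'
      exact ((hy' hy.2.1).2).symm
    have h5 : (G'.comp C') = ContinuousLinearMap.id ℝ (EuclideanSpace ℝ (Fin m) × ℝ) :=
      hsu.eq h4 (hasMFDerivWithinAt_id _ _)
    intro a b hab
    have h6 := congrArg (fun T : EuclideanSpace ℝ (Fin m) × ℝ →L[ℝ] _ => T a) h5
    have h7 := congrArg (fun T : EuclideanSpace ℝ (Fin m) × ℝ →L[ℝ] _ => T b) h5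
    exact h6.symm.trans ((congrArg G' hab).trans h7)
  -- Near a diagonal point injectivity comes from the local left inverse. Off the diagonal it comes
  -- from injectivity of `ι`, since distinct values at time 0 stay distinct for a while. Compactness
  -- of `M × M` makes the time uniform.
  have e3 : ∀ᶠ τ in 𝓝 ((0 : ℝ), (0 : ℝ)), ∀ x ∈ (univ : Set (M × M)), τ.1 ∈ Icc 0 ε → τ.2 ∈ Icc 0 ε →
      C (x.1, τ.1) = C (x.2, τ.2) → (x.1, τ.1) = (x.2, τ.2) := by
    refine isCompact_univ.eventually_forall_of_forall_eventually fun x _ => ?_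
    obtain ⟨x, y⟩ := x
    have c1 : Continuous fun p : (ℝ × ℝ) × M × M => (p.2.1, p.1.1) := by fun_prop
    have c2 : Continuous fun p : (ℝ × ℝ) × M × M => (p.2.2, p.1.2) := by fun_prop
    by_cases hxy : x = y
    · subst hxy
      obtain ⟨G, u, -, hGC⟩ := hinv x
      filter_upwards [(c1.tendsto ((0, 0), x, x)).eventually hGC,
        (c2.tendsto ((0, 0), x, x)).eventually hGC] with p hp hp' h1 h2 h3
      rw [← (hp h1.1).2, ← (hp' h2.1).2]
      exact congrArg G h3
    · have h1 : Q (0, x) ≠ Q (0, y) := by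
        rw [hQC _ _ h0, hQC _ _ h0, hC0, hC0]
        exact fun h => hxy (hιi h)
      have c3 : Continuous fun p : (ℝ × ℝ) × M × M => Q (p.1.1, p.2.1) := hQc.comp (by fun_prop)
      have c4 : Continuous fun p : (ℝ × ℝ) × M × M => Q (p.1.2, p.2.2) := hQc.comp (by fun_prop)
      have h2 : ∀ᶠ p : (ℝ × ℝ) × M × M in 𝓝 ((0, 0), x, y), Q (p.1.1, p.2.1) ≠ Q (p.1.2, p.2.2) :=
        (isOpen_ne_fun c3 c4).mem_nhds h1
      filter_upwards [h2] with p hp h3 h4 h5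
      rw [hQC _ _ h3, hQC _ _ h4] at hp
      exact absurd h5 hp
  obtain ⟨δ₁, hδ₁, e1⟩ := Metric.eventually_nhds_iff.1 e1
  obtain ⟨δ₂, hδ₂, e2⟩ := Metric.eventually_nhds_iff.1 e2
  obtain ⟨δ₃, hδ₃, e3⟩ := Metric.eventually_nhds_iff.1 e3
  obtain ⟨ε', hε', hε''⟩ : ∃ ε' > 0, ε' < min (min δ₁ δ₂) (min δ₃ ε) :=
    exists_between (by simp only [lt_min_iff]; exact ⟨⟨hδ₁, hδ₂⟩, hδ₃, hΘ.pos⟩)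
  simp only [lt_min_iff] at hε''
  have hle : ε' ≤ ε := hε''.2.2.le
  have hsub : Icc 0 ε' ⊆ Icc 0 ε := Icc_subset_Icc_right hle
  have hdist : ∀ t ∈ Icc 0 ε', ∀ δ, ε' < δ → dist t 0 < δ := fun t ht δ hδ => by
    rw [Real.dist_eq, sub_zero, abs_of_nonneg ht.1]
    exact ht.2.trans_lt hδ
  refine ⟨ε', C, ⟨hε', hCs.mono (prod_mono_right hsub), hC0, ?_, fun x t ht =>
    hCi x t ⟨ht.1, ht.2.trans hle⟩, ?_, ?_⟩, fun x t ht => ?_⟩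
  · rintro ⟨x, t⟩ ⟨-, ht⟩ ⟨x', t'⟩ ⟨-, ht'⟩ h
    refine e3 (y := (t, t')) ?_ (x, x') (mem_univ _) (hsub ht) (hsub ht') h
    rw [Prod.dist_eq]
    exact max_lt (hdist t ht _ hε''.2.1) (hdist t' ht' _ hε''.2.1)
  · rintro ⟨x, t⟩ ⟨-, ht⟩
    obtain ⟨C', h1, h2⟩ := e2 (hdist t ht _ hε''.1.2) x (mem_univ _) ht.1 (ht.2.trans hle)
    exact ⟨C', h1.mono (prod_mono_right hsub), h2⟩
  · intro x
    obtain ⟨C', h1, -, h2⟩ := hder x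
    exact ⟨C', h1.mono (prod_mono_right hsub), h2⟩
  · have h1 := e1 (hdist t ht _ hε''.1.1) x (mem_univ _)
    rw [hQC x t (hsub ht)] at h1
    exact interior_subset h1

end Collar


/-! ### Neat graphs in a collar. -/

section Graph

variable {v m n : ℕ} [NeZero v] [NeZero n]
  {V : Type*} [TopologicalSpace V] [ChartedSpace (EuclideanHalfSpace v) V]
  {M : Type*} [TopologicalSpace M] [ChartedSpace (EuclideanSpace ℝ (Fin m)) M]
  {Y : Type*} [TopologicalSpace Y] [ChartedSpace (EuclideanHalfSpace n) Y]

/-- A map `V → M × [0, ε]` which is a neat embedding in the collar coordinates. -/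
structure IsNeatGraph (v m : ℕ) [NeZero v]
    {V : Type*} [TopologicalSpace V] [ChartedSpace (EuclideanHalfSpace v) V]
    {M : Type*} [TopologicalSpace M] [ChartedSpace (EuclideanSpace ℝ (Fin m)) M]
    (ε : ℝ) (pos : V → M) (ht : V → ℝ) : Prop where
  contMDiff_pos : ContMDiff (𝓡∂ v) (𝓡 m) ∞ pos
  contMDiff_ht : ContMDiff (𝓡∂ v) 𝓘(ℝ, ℝ) ∞ ht
  ht_mem : ∀ x, ht x ∈ Icc 0 ε
  ht_eq_zero_iff : ∀ x, ht x = 0 ↔ x ∈ (𝓡∂ v).boundary V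
  injective : ∀ x y, pos x = pos y → ht x = ht y → x = y
  injective_deriv : ∀ x, ∀ w : EuclideanSpace ℝ (Fin v),
    chartDeriv (𝓡∂ v) (𝓡 m) pos x w = 0 → chartDeriv (𝓡∂ v) 𝓘(ℝ, ℝ) ht x w = 0 → w = 0
  transverse : ∀ x ∈ (𝓡∂ v).boundary V, 0 < chartDeriv (𝓡∂ v) 𝓘(ℝ, ℝ) ht x (inwardNormal v)

variable {ι : M → Y} {ε : ℝ} {C : M × ℝ → Y}

theorem IsNeatGraph.chartDeriv_comp {pos : V → M} {ht : V → ℝ}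
    (hp : IsNeatGraph v m ε pos ht) (x : V)
    {C' : EuclideanSpace ℝ (Fin m) × ℝ →L[ℝ] EuclideanSpace ℝ (Fin n)}
    (hC' : HasMFDerivWithinAt ((𝓡 m).prod 𝓘(ℝ, ℝ)) (𝓡∂ n) C (univ ×ˢ Icc 0 ε) (pos x, ht x) C')
    (w : EuclideanSpace ℝ (Fin v)) :
    chartDeriv (𝓡∂ v) (𝓡∂ n) (fun x => C (pos x, ht x)) x w
      = C' (chartDeriv (𝓡∂ v) (𝓡 m) pos x w, chartDeriv (𝓡∂ v) 𝓘(ℝ, ℝ) ht x w) := by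
  have h1 : HasMFDerivAt (𝓡∂ v) (𝓡 m) pos x (chartDeriv (𝓡∂ v) (𝓡 m) pos x) :=
    (hp.contMDiff_pos.contMDiffAt.mdifferentiableAt (by simp)).hasMFDerivAt
  have h2 : HasMFDerivAt (𝓡∂ v) 𝓘(ℝ, ℝ) ht x (chartDeriv (𝓡∂ v) 𝓘(ℝ, ℝ) ht x) :=
    (hp.contMDiff_ht.contMDiffAt.mdifferentiableAt (by simp)).hasMFDerivAt
  have h3 := HasMFDerivWithinAt.comp (f := fun x => (pos x, ht x)) (g := C) x hC'
    ((h1.prodMk h2).hasMFDerivWithinAt (s := univ)) fun y _ => ⟨mem_univ _, hp.ht_mem y⟩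
  rw [chartDeriv, show (fun x => C (pos x, ht x)) = C ∘ fun x => (pos x, ht x) from rfl,
    (hasMFDerivWithinAt_univ.1 h3).mfderiv]
  rfl

/-- The collar is injective with injective differential, so everything can be tested on the pair of
position and height. At the boundary the normal component of the differential is a positive multiple
of that of the height. -/
theorem IsCollar.isNeatImmersion (hC : IsCollar m n ι ε C)
    (hιb : ∀ x, ι x ∈ (𝓡∂ n).boundary Y) {pos : V → M} {ht : V → ℝ}
    (hp : IsNeatGraph v m ε pos ht) : IsNeatImmersion v n fun x => C (pos x, ht x) where
  contMDiff := by
    rw [← contMDiffOn_univ]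
    exact hC.contMDiffOn.comp (hp.contMDiff_pos.prodMk hp.contMDiff_ht).contMDiffOn
      fun x _ => ⟨mem_univ _, hp.ht_mem x⟩
  injective x y hxy := by
    have h1 := hC.injOn ⟨mem_univ _, hp.ht_mem x⟩ ⟨mem_univ _, hp.ht_mem y⟩ hxy
    exact hp.injective x y (congrArg Prod.fst h1) (congrArg Prod.snd h1)
  injective_mfderiv x := by
    rw [injective_mfderiv_iff]
    intro w hw
    obtain ⟨C', h1, h2⟩ := hC.injective_deriv (pos x, ht x) ⟨mem_univ _, hp.ht_mem x⟩
    rw [hp.chartDeriv_comp x h1] at hw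
    have h3 := h2 (hw.trans (map_zero C').symm)
    exact hp.injective_deriv x w (congrArg Prod.fst h3) (congrArg Prod.snd h3)
  preimage_boundary := by
    ext x
    rw [mem_preimage, ← hp.ht_eq_zero_iff]
    constructor
    · intro h
      by_contra hne
      have h1 := hC.mem_interior (pos x) (ht x)
        ⟨lt_of_le_of_ne (hp.ht_mem x).1 (Ne.symm hne), (hp.ht_mem x).2⟩
      rw [← (𝓡∂ n).compl_boundary] at h1
      exact h1 h
    · intro h
      rw [h, hC.zero]
      exact hιb _
  transverse x hx := by
    obtain ⟨C', h1, c, hc, h2⟩ := hC.transverse (pos x)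
    have h3 : HasMFDerivWithinAt ((𝓡 m).prod 𝓘(ℝ, ℝ)) (𝓡∂ n) C (univ ×ˢ Icc 0 ε)
        (pos x, ht x) C' := by
      rw [(hp.ht_eq_zero_iff x).2 hx]
      exact h1
    rw [hp.chartDeriv_comp x h3, h2]
    exact mul_pos hc (hp.transverse x hx)

theorem IsCollar.neatlyIsotopic (hC : IsCollar m n ι ε C)
    (hιb : ∀ x, ι x ∈ (𝓡∂ n).boundary Y) {pos : V × ℝ → M} {ht : V × ℝ → ℝ}
    (hpos : ContMDiff ((𝓡∂ v).prod 𝓘(ℝ, ℝ)) (𝓡 m) ∞ pos)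
    (hht : ContMDiff ((𝓡∂ v).prod 𝓘(ℝ, ℝ)) 𝓘(ℝ, ℝ) ∞ ht)
    (hp : ∀ t, IsNeatGraph v m ε (fun x => pos (x, t)) (fun x => ht (x, t)))
    (hb : ∀ x ∈ (𝓡∂ v).boundary V, ∀ t, pos (x, t) = pos (x, 0)) :
    NeatlyIsotopic v n (fun x => C (pos (x, 0), ht (x, 0))) (fun x => C (pos (x, 1), ht (x, 1))) := by
  refine ⟨fun p => C (pos p, ht p), ?_, fun t => hC.isNeatImmersion hιb (hp t), fun _ => rfl,
    fun _ => rfl, fun x hx t => ?_⟩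
  · rw [← contMDiffOn_univ]
    exact hC.contMDiffOn.comp (hpos.prodMk hht).contMDiffOn
      fun p _ => ⟨mem_univ _, (hp p.2).ht_mem p.1⟩
  · change C (pos (x, t), ht (x, t)) = C (pos (x, 0), ht (x, 0))
    rw [hb x hx, ((hp t).ht_eq_zero_iff x).2 hx, ((hp 0).ht_eq_zero_iff x).2 hx]

end Graph


/-! ### Tube coordinates near the binding. -/

namespace OpenBook

variable {k : ℕ}
  {P : Type*} [TopologicalSpace P] [ChartedSpace (EuclideanHalfSpace (k + 1)) P]
  {ρ : DiffBdry (𝓡∂ (k + 1)) P}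
  {B : Type*} [TopologicalSpace B] [ChartedSpace (EuclideanSpace ℝ (Fin k)) B]
  {M : Type*} [TopologicalSpace M] [ChartedSpace (EuclideanSpace ℝ (Fin (k + 2))) M]
  (O : OpenBook k P ρ B M)

theorem injective_page : Function.Injective O.page := O.isSmoothEmbedding_page.isEmbedding.injective

theorem injective_tube : Function.Injective O.tube := O.isSmoothEmbedding_tube.isEmbedding.injective

theorem contMDiff_page [IsManifold (𝓡∂ (k + 1)) ∞ P] : ContMDiff (𝓡∂ (k + 1)) (𝓡 (k + 2)) ∞ O.page :=
  O.contMDiff_sweep.comp (contMDiff_id.prodMk contMDiff_const)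

theorem contMDiff_tube : ContMDiff ((𝓡 k).prod 𝓘(ℝ, ℂ)) (𝓡 (k + 2)) ∞ O.tube :=
  O.isSmoothEmbedding_tube.contMDiff

/-- The tube has codimension zero, so its injective differentials are bijective. -/
theorem exists_tube_localInverse [IsManifold (𝓡 k) ∞ B] [IsManifold (𝓡 (k + 2)) ∞ M] (p : B × ℂ) :
    ∃ G : M → B × ℂ, ContMDiffAt (𝓡 (k + 2)) ((𝓡 k).prod 𝓘(ℝ, ℂ)) ∞ G (O.tube p) ∧
      G (O.tube p) = p ∧ (∀ᶠ y in 𝓝 (O.tube p), O.tube (G y) = y) ∧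
      ∀ᶠ p' in 𝓝 p, G (O.tube p') = p' := by
  have hinj := O.isSmoothEmbedding_tube.injective_mfderiv p
  refine exists_localInverse_of_bijective_mfderiv (O.contMDiff_tube p)
    (BoundarylessManifold.isInteriorPoint) ⟨hinj, ?_⟩
  have hdim : Module.finrank ℝ (EuclideanSpace ℝ (Fin k) × ℂ)
      = Module.finrank ℝ (EuclideanSpace ℝ (Fin (k + 2))) := by
    rw [Module.finrank_prod]
    simp [Complex.finrank_real_complex]
  exact (LinearMap.injective_iff_surjective_of_finrank_eq_finrank
    (f := (chartDeriv ((𝓡 k).prod 𝓘(ℝ, ℂ)) (𝓡 (k + 2)) O.tube p).toLinearMap) hdim).1 hinj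

theorem mem_boundary_iff (x : P) :
    x ∈ (𝓡∂ (k + 1)).boundary P ↔ ∃ b, O.page x = O.tube (b, 0) := (O.mem_binding_iff x 0).symm

theorem mem_interior_of_page_eq_tube {x : P} {b : B} {z : ℂ} (h : O.page x = O.tube (b, z))
    (hz : z ≠ 0) : x ∈ (𝓡∂ (k + 1)).interior P := by
  rw [← (𝓡∂ (k + 1)).compl_boundary, mem_compl_iff, O.mem_boundary_iff]
  rintro ⟨b', hb'⟩
  exact hz (congrArg Prod.snd (O.injective_tube (h.symm.trans hb')))

theorem page_monodromy (x : P) : O.page ((ρ : Equiv.Perm P) x) = O.sweep (x, 1) := by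
  rw [page, ← O.sweep_add_one, zero_add]

/-- In the tube, the fixed page is the positive real half plane, its sweep is the rotation and
the monodromy is the identity. -/
theorem exists_of_page_eq_tube {x : P} {b : B} {z : ℂ} (h : O.page x = O.tube (b, z)) :
    ∃ r : ℝ, 0 ≤ r ∧ z = r ∧
      (∀ t : ℝ, O.sweep (x, t) = O.tube (b, (r : ℂ) * Complex.exp (2 * Real.pi * t * Complex.I))) ∧
      (ρ : Equiv.Perm P) x = x := by
  obtain ⟨x', hx'⟩ := O.sweep_tube b ‖z‖ (norm_nonneg z)
  -- With `θ` the argument of `z` in turns, the point `tube (b, z)` is reached from `x'` at time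
  -- `θ`. Since it also lies on the page at time 0, injectivity of the sweep on `[0, 1)` forces `θ =
  -- 0`. A full rotation then returns to the start, so the monodromy fixes the point.
  obtain ⟨θ, hθ0, hθ1, hθ⟩ : ∃ θ : ℝ, 0 ≤ θ ∧ θ < 1 ∧
      z = (‖z‖ : ℂ) * Complex.exp (2 * Real.pi * θ * Complex.I) := by
    refine ⟨Int.fract (z.arg / (2 * Real.pi)), Int.fract_nonneg _, Int.fract_lt_one _, ?_⟩
    have h1 : Complex.exp (2 * Real.pi * (Int.fract (z.arg / (2 * Real.pi)) : ℝ) * Complex.I)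
        = Complex.exp (z.arg * Complex.I) := by
      rw [Complex.exp_eq_exp_iff_exists_int]
      refine ⟨-⌊z.arg / (2 * Real.pi)⌋, ?_⟩
      have hpi : (Real.pi : ℂ) ≠ 0 := by exact_mod_cast Real.pi_ne_zero
      rw [← Int.self_sub_floor]
      push_cast
      field_simp
      ring
    rw [h1, Complex.norm_mul_exp_arg_mul_I]
  have hone : Complex.exp (2 * Real.pi * (1 : ℝ) * Complex.I) = 1 := by
    rw [Complex.ofReal_one, mul_one, Complex.exp_two_pi_mul_I]
  have hzero : Complex.exp (2 * Real.pi * (0 : ℝ) * Complex.I) = 1 := by simp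
  obtain ⟨hxx, hz⟩ : x = x' ∧ z = (‖z‖ : ℂ) := by
    rcases eq_or_ne z 0 with hz | hz
    · refine ⟨O.injective_page ?_, by simp [hz]⟩
      rw [h, page, hx', hz]
      simp
    · have h1 := O.mem_interior_of_page_eq_tube h hz
      have h2 : x' ∈ (𝓡∂ (k + 1)).interior P := by
        have h3 : O.page x' = O.tube (b, (‖z‖ : ℂ)) := by rw [page, hx', hzero, mul_one]
        exact O.mem_interior_of_page_eq_tube h3 (by simpa using hz)
      have h3 : O.sweep (x, 0) = O.sweep (x', θ) := by
        rw [hx', ← hθ]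
        exact h
      have h0 : (0 : ℝ) ∈ Ico (0 : ℝ) 1 := ⟨le_rfl, zero_lt_one⟩
      have h4 := O.injOn_sweep (mk_mem_prod h1 h0) (mk_mem_prod h2 ⟨hθ0, hθ1⟩) h3
      have h5 : 0 = θ := congrArg Prod.snd h4
      refine ⟨congrArg Prod.fst h4, ?_⟩
      rw [← h5, hzero, mul_one] at hθ
      exact hθ
  subst hxx
  refine ⟨‖z‖, norm_nonneg z, hz, hx', O.injective_page ?_⟩
  rw [page_monodromy, hx', hone, mul_one, h, ← hz]

open Classical in
/-- Multiplication by a complex number in the normal direction of the binding. -/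
def scale (y : M) (μ : ℂ) : M :=
  if h : ∃ p, O.tube p = y then O.tube (h.choose.1, h.choose.2 * μ) else y

open Classical in
/-- The squared distance from the binding, cut off at `5`. -/
def level (y : M) : ℝ := if h : ∃ p, O.tube p = y then min (‖h.choose.2‖ ^ 2) 5 else 5

theorem scale_tube (b : B) (z μ : ℂ) : O.scale (O.tube (b, z)) μ = O.tube (b, z * μ) := by
  have h : ∃ p, O.tube p = O.tube (b, z) := ⟨_, rfl⟩
  rw [scale, dif_pos h, O.injective_tube h.choose_spec]

theorem scale_one (y : M) : O.scale y 1 = y := by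
  by_cases h : ∃ p, O.tube p = y
  · obtain ⟨⟨b, z⟩, rfl⟩ := h
    rw [scale_tube, mul_one]
  · rw [scale, dif_neg h]

theorem level_tube (b : B) (z : ℂ) : O.level (O.tube (b, z)) = min (‖z‖ ^ 2) 5 := by
  have h : ∃ p, O.tube p = O.tube (b, z) := ⟨_, rfl⟩
  rw [level, dif_pos h, O.injective_tube h.choose_spec]

theorem exists_of_level_lt {y : M} (hy : O.level y < 5) :
    ∃ b z, y = O.tube (b, z) ∧ O.level y = ‖z‖ ^ 2 := by
  by_cases h : ∃ p, O.tube p = y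
  · obtain ⟨⟨b, z⟩, rfl⟩ := h
    refine ⟨b, z, rfl, ?_⟩
    rw [level_tube] at hy ⊢
    exact min_eq_left ((min_lt_iff.1 hy).resolve_right (lt_irrefl _)).le
  · rw [level, dif_neg h] at hy
    exact absurd hy (lt_irrefl _)

theorem level_nonneg (y : M) : 0 ≤ O.level y := by
  rcases lt_or_ge (O.level y) 5 with h | h
  · obtain ⟨b, z, -, h1⟩ := O.exists_of_level_lt h
    rw [h1]
    positivity
  · linarith

variable [IsManifold (𝓡 k) ∞ B] [IsManifold (𝓡 (k + 2)) ∞ M]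

theorem contMDiffAt_scale (b : B) (z μ : ℂ) :
    ContMDiffAt ((𝓡 (k + 2)).prod 𝓘(ℝ, ℂ)) (𝓡 (k + 2)) ∞ (fun q : M × ℂ => O.scale q.1 q.2)
      (O.tube (b, z), μ) := by
  obtain ⟨G, hG, -, hGr, -⟩ := O.exists_tube_localInverse (b, z)
  have h1 : ContMDiffAt ((𝓡 (k + 2)).prod 𝓘(ℝ, ℂ)) ((𝓡 k).prod 𝓘(ℝ, ℂ)) ∞
      (fun q : M × ℂ => G q.1) (O.tube (b, z), μ) :=
    ContMDiffAt.comp (f := Prod.fst) (g := G) (O.tube (b, z), μ) hG contMDiffAt_fst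
  have h2 : ContMDiffAt ((𝓡 (k + 2)).prod 𝓘(ℝ, ℂ)) 𝓘(ℝ, ℂ) ∞
      (fun q : M × ℂ => (G q.1).2 * q.2) (O.tube (b, z), μ) :=
    ContMDiffAt.comp (g := fun p : ℂ × ℂ => p.1 * p.2) (O.tube (b, z), μ)
      (contDiff_mul (𝕜 := ℝ) (n := ∞)).contMDiff.contMDiffAt (h1.snd.prodMk_space contMDiffAt_snd)
  have h3 : ContMDiffAt ((𝓡 (k + 2)).prod 𝓘(ℝ, ℂ)) (𝓡 (k + 2)) ∞
      (fun q : M × ℂ => O.tube ((G q.1).1, (G q.1).2 * q.2)) (O.tube (b, z), μ) :=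
    O.contMDiff_tube.contMDiffAt.comp _ (h1.fst.prodMk h2)
  refine h3.congr_of_eventuallyEq ?_
  filter_upwards [continuous_fst.continuousAt.eventually hGr] with q hq
  have h4 : O.tube ((G q.1).1, (G q.1).2) = q.1 := hq
  rw [← O.scale_tube, h4]

/-- Around a point outside the tube, remove the image of the closed disc bundle of radius 3, which
is compact. On what remains the level is constantly 5, because `3 ^ 2 > 5`. -/
theorem continuous_level [CompactSpace B] [T2Space M] : Continuous O.level := by
  rw [continuous_iff_continuousAt]
  intro y
  by_cases h : ∃ p, O.tube p = y
  · obtain ⟨⟨b, z⟩, rfl⟩ := h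
    obtain ⟨G, hG, -, hGr, -⟩ := O.exists_tube_localInverse (b, z)
    have h1 : ContinuousAt (fun y => min (‖(G y).2‖ ^ 2) 5) (O.tube (b, z)) :=
      ((hG.continuousAt.snd.norm.pow 2).min continuousAt_const)
    refine h1.congr ?_
    filter_upwards [hGr] with y hy
    have h4 : O.tube ((G y).1, (G y).2) = y := hy
    rw [← O.level_tube, h4]
  · have hK : IsCompact (O.tube '' (univ ×ˢ Metric.closedBall 0 3)) :=
      (isCompact_univ.prod (isCompact_closedBall _ _)).image O.contMDiff_tube.continuous
    have hy : y ∈ (O.tube '' (univ ×ˢ Metric.closedBall 0 3))ᶜ := by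
      rintro ⟨p, -, hp⟩
      exact h ⟨p, hp⟩
    refine (continuousAt_const (y := (5 : ℝ))).congr ?_
    filter_upwards [hK.isClosed.isOpen_compl.mem_nhds hy] with y' hy'
    by_contra hne
    by_cases h' : ∃ p, O.tube p = y'
    · obtain ⟨⟨b, z⟩, rfl⟩ := h'
      refine hy' ⟨(b, z), ⟨mem_univ _, ?_⟩, rfl⟩
      rw [level_tube] at hne
      rw [mem_closedBall_zero_iff]
      by_contra hz
      refine hne (min_eq_right ?_).symm
      nlinarith [not_le.1 hz]
    · rw [level, dif_neg h'] at hne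
      exact hne rfl

/-- Below 5 the level is the smooth squared norm in the tube. The cap at 5 is not smooth, but `g` is
already constant there. -/
theorem contMDiff_comp_level [CompactSpace B] [T2Space M] {g : ℝ → ℝ} (hg : ContDiff ℝ ∞ g)
    (hg4 : ∀ q, 4 ≤ q → g q = g 4) : ContMDiff (𝓡 (k + 2)) 𝓘(ℝ, ℝ) ∞ (fun y => g (O.level y)) := by
  intro y
  rcases lt_or_ge (O.level y) 5 with h | h
  · obtain ⟨b, z, rfl, -⟩ := O.exists_of_level_lt h
    obtain ⟨G, hG, -, hGr, -⟩ := O.exists_tube_localInverse (b, z)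
    have h1 : ContMDiffAt (𝓡 (k + 2)) 𝓘(ℝ, ℝ) ∞ (fun y => g (‖(G y).2‖ ^ 2)) (O.tube (b, z)) :=
      ContMDiffAt.comp (g := fun z : ℂ => g (‖z‖ ^ 2)) (O.tube (b, z))
        (hg.comp (contDiff_norm_sq ℝ)).contMDiff.contMDiffAt hG.snd
    refine h1.congr_of_eventuallyEq ?_
    filter_upwards [hGr, O.continuous_level.continuousAt.eventually (gt_mem_nhds h)] with y hy hy5
    have h4 : O.tube ((G y).1, (G y).2) = y := hy
    have h5 : O.level y = min (‖(G y).2‖ ^ 2) 5 := by rw [← O.level_tube, h4]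
    rw [h5] at hy5 ⊢
    rw [min_eq_left ((min_lt_iff.1 hy5).resolve_right (lt_irrefl _)).le]
  · refine (contMDiffAt_const (c := g 4)).congr_of_eventuallyEq ?_
    filter_upwards [O.continuous_level.continuousAt.eventually
      (lt_mem_nhds (show 4 < O.level y by linarith))] with y' hy'
    exact hg4 _ hy'.le

end OpenBook


/-! ### The page as a subset of `V`. -/

namespace OpenBook

variable {k : ℕ}
  {P : Type*} [TopologicalSpace P] [ChartedSpace (EuclideanHalfSpace (k + 1)) P]
  {ρ : DiffBdry (𝓡∂ (k + 1)) P}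
  {B : Type*} [TopologicalSpace B] [ChartedSpace (EuclideanSpace ℝ (Fin k)) B]
  {M : Type*} [TopologicalSpace M] [ChartedSpace (EuclideanSpace ℝ (Fin (k + 2))) M]
  {V : Type*} [TopologicalSpace V] [ChartedSpace (EuclideanHalfSpace (k + 1)) V]
  {O : OpenBook k P ρ B M} {j : V → M} {h : P ↪ V}

/-- The fixed page of `O` is contained in the submanifold `j : V → M`, with inclusion `h`. -/
structure IsPageLift (O : OpenBook k P ρ B M) (j : V → M) (h : P ↪ V) : Prop where
  isSmoothEmbedding : IsSmoothEmbedding (𝓡∂ (k + 1)) (𝓡 (k + 2)) ∞ j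
  comp_eq : ∀ x, j (h x) = O.page x

open Classical in
/-- The function `level` along the page, extended by zero to `V`. -/
def levelOn (O : OpenBook k P ρ B M) (j : V → M) (h : P ↪ V) (v : V) : ℝ :=
  if v ∈ range h then O.level (j v) else 0

/-- The sweep of the page, extended to `V` by the constant motion. -/
def sweepOn (O : OpenBook k P ρ B M) (j : V → M) (h : P ↪ V) (p : V × ℝ) : M :=
  Function.extend h (fun x => O.sweep (x, p.2)) j p.1

theorem sweepOn_apply {V : Type*} {j : V → M} {h : P ↪ V} (x : P) (t : ℝ) : O.sweepOn j h (h x, t) = O.sweep (x, t) :=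
  h.injective.extend_apply _ _ _

theorem levelOn_nonneg {V : Type*} {j : V → M} {h : P ↪ V} (v : V) : 0 ≤ O.levelOn j h v := by
  rw [levelOn]
  split_ifs
  · exact O.level_nonneg _
  · exact le_rfl

theorem monodromy_eq_of_level_lt {x : P} (hx : O.level (O.page x) < 5) :
    (ρ : Equiv.Perm P) x = x := by
  obtain ⟨b, z, h1, -⟩ := O.exists_of_level_lt hx
  obtain ⟨r, -, -, -, h4⟩ := O.exists_of_page_eq_tube h1
  exact h4

/-- The monodromy fixes every page point of level below 5. By injectivity it moves no other point
into that region, and outside it the level is at its cap. -/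
theorem level_page_monodromy (x : P) :
    O.level (O.page ((ρ : Equiv.Perm P) x)) = O.level (O.page x) := by
  by_cases h1 : O.level (O.page x) < 5
  · rw [monodromy_eq_of_level_lt h1]
  by_cases h2 : O.level (O.page ((ρ : Equiv.Perm P) x)) < 5
  · have h3 := (ρ : Equiv.Perm P).injective (monodromy_eq_of_level_lt h2)
    rw [h3]
  have h5 : ∀ y, O.level y ≤ 5 := by
    intro y
    rcases lt_or_ge (O.level y) 5 with h | h
    · exact h.le
    · by_cases hp : ∃ p, O.tube p = y
      · obtain ⟨⟨b, z⟩, rfl⟩ := hp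
        rw [level_tube]
        exact min_le_right _ _
      · rw [level, dif_neg hp]
  exact (le_antisymm (h5 _) (not_lt.1 h2)).trans (le_antisymm (h5 _) (not_lt.1 h1)).symm

namespace IsPageLift

theorem levelOn_apply (L : O.IsPageLift j h) (x : P) : O.levelOn j h (h x) = O.level (O.page x) := by
  rw [levelOn, if_pos (mem_range_self x), L.comp_eq]

theorem levelOn_apply_of_mem_boundary (L : O.IsPageLift j h) {x : P} (hx : x ∈ (𝓡∂ (k + 1)).boundary P) :
    O.levelOn j h (h x) = 0 := by
  obtain ⟨b, hb⟩ := (O.mem_boundary_iff x).1 hx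
  rw [L.levelOn_apply, hb, level_tube]
  simp

theorem exists_of_levelOn_pos (L : O.IsPageLift j h) {v : V} (hv : 0 < O.levelOn j h v) :
    ∃ x ∈ (𝓡∂ (k + 1)).interior P, v = h x := by
  by_cases hr : v ∈ range h
  · obtain ⟨x, rfl⟩ := hr
    refine ⟨x, ?_, rfl⟩
    rw [← (𝓡∂ (k + 1)).compl_boundary]
    intro hx
    rw [L.levelOn_apply_of_mem_boundary hx] at hv
    exact lt_irrefl _ hv
  · rw [levelOn, if_neg hr] at hv
    exact absurd hv (lt_irrefl _)

/-- Where the level is positive but small, `V` is the real half plane in the tube. -/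
theorem exists_tube_of_levelOn (L : O.IsPageLift j h) {v : V} (hv : 0 < O.levelOn j h v) (hv' : O.levelOn j h v < 5) :
    ∃ x ∈ (𝓡∂ (k + 1)).interior P, v = h x ∧ ∃ (b : B) (r : ℝ), 0 < r ∧ O.levelOn j h v = r ^ 2 ∧
      j v = O.tube (b, r) ∧
      (∀ t : ℝ, O.sweep (x, t) = O.tube (b, (r : ℂ) * Complex.exp (2 * Real.pi * t * Complex.I))) ∧
      (ρ : Equiv.Perm P) x = x := by
  obtain ⟨x, hx, rfl⟩ := L.exists_of_levelOn_pos hv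
  rw [L.levelOn_apply] at hv hv' ⊢
  obtain ⟨b, z, h1, h2⟩ := O.exists_of_level_lt hv'
  obtain ⟨r, hr, rfl, h3, h4⟩ := O.exists_of_page_eq_tube h1
  rw [Complex.norm_real, Real.norm_eq_abs, sq_abs] at h2
  refine ⟨x, hx, rfl, b, r, lt_of_le_of_ne hr ?_, h2, by rw [L.comp_eq, h1], h3, h4⟩
  rintro rfl
  rw [h2] at hv
  simp at hv

variable [IsManifold (𝓡∂ (k + 1)) ∞ P]

theorem continuous (L : O.IsPageLift j h) : Continuous h := by
  rw [L.isSmoothEmbedding.isEmbedding.isInducing.continuous_iff]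
  have h1 : j ∘ h = O.page := funext L.comp_eq
  rw [h1]
  exact O.contMDiff_page.continuous

theorem contMDiff (L : O.IsPageLift j h) : ContMDiff (𝓡∂ (k + 1)) (𝓡∂ (k + 1)) ∞ h := by
  intro x
  rw [ContMDiffAt.iff_comp_isImmersionAt (L.isSmoothEmbedding.isImmersion.isImmersionAt (h x))]
  refine ⟨L.continuous.continuousAt, ?_⟩
  rw [show j ∘ h = O.page from funext L.comp_eq]
  exact O.contMDiff_page x

theorem injective_mfderiv (L : O.IsPageLift j h) (x : P) :
    Function.Injective (mfderiv (𝓡∂ (k + 1)) (𝓡∂ (k + 1)) h x) := by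
  refine injective_mfderiv_of_comp_within (G := j) (K := O.page) (J' := 𝓡 (k + 2)) (u := univ)
    (L.contMDiff.contMDiffAt.mdifferentiableAt (by simp))
    (L.isSmoothEmbedding.contMDiff.contMDiffAt.mdifferentiableAt (by simp)).mdifferentiableWithinAt
    (by simp) (Filter.Eventually.of_forall L.comp_eq) ?_
  exact O.isSmoothEmbedding_page.injective_mfderiv x

theorem bijective_mfderiv (L : O.IsPageLift j h) (x : P) :
    Function.Bijective (mfderiv (𝓡∂ (k + 1)) (𝓡∂ (k + 1)) h x) :=
  ⟨L.injective_mfderiv x, (LinearMap.injective_iff_surjective (K := ℝ)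
    (f := (chartDeriv (𝓡∂ (k + 1)) (𝓡∂ (k + 1)) h x).toLinearMap)).1 (L.injective_mfderiv x)⟩

theorem apply_mem_interior (L : O.IsPageLift j h) {x : P} (hx : x ∈ (𝓡∂ (k + 1)).interior P) :
    h x ∈ (𝓡∂ (k + 1)).interior V :=
  (L.contMDiff.contMDiffAt.mdifferentiableAt (by simp)).isInteriorPoint_of_surjective_mfderiv
    (L.bijective_mfderiv x).2 hx

/-- A point of positive level is the image of an interior point of the page, and `h` has bijective
differentials, so it is interior in `V`. -/
theorem levelOn_of_mem_boundary (L : O.IsPageLift j h) {v : V} (hv : v ∈ (𝓡∂ (k + 1)).boundary V) :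
    O.levelOn j h v = 0 := by
  by_contra hne
  obtain ⟨x, hx, rfl⟩ := L.exists_of_levelOn_pos (lt_of_le_of_ne (levelOn_nonneg v) (Ne.symm hne))
  have h1 := L.apply_mem_interior hx
  rw [← (𝓡∂ (k + 1)).compl_boundary] at h1
  exact h1 hv

variable [IsManifold (𝓡∂ (k + 1)) ∞ V]

theorem exists_localInverse (L : O.IsPageLift j h) {x : P} (hx : x ∈ (𝓡∂ (k + 1)).interior P) :
    ∃ G : V → P, ContMDiffAt (𝓡∂ (k + 1)) (𝓡∂ (k + 1)) ∞ G (h x) ∧ G (h x) = x ∧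
      (∀ᶠ v in 𝓝 (h x), h (G v) = v) ∧ ∀ᶠ x' in 𝓝 x, G (h x') = x' :=
  exists_localInverse_of_bijective_mfderiv (L.contMDiff x) hx (L.bijective_mfderiv x)

theorem range_mem_nhds (L : O.IsPageLift j h) {x : P} (hx : x ∈ (𝓡∂ (k + 1)).interior P) : range h ∈ 𝓝 (h x) := by
  obtain ⟨G, -, -, h1, -⟩ := L.exists_localInverse hx
  filter_upwards [h1] with v hv
  exact ⟨_, hv⟩

theorem contMDiffAt_sweepOn (L : O.IsPageLift j h) {x : P} (hx : x ∈ (𝓡∂ (k + 1)).interior P) (t : ℝ) :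
    ContMDiffAt ((𝓡∂ (k + 1)).prod 𝓘(ℝ, ℝ)) (𝓡 (k + 2)) ∞ (O.sweepOn j h) (h x, t) := by
  obtain ⟨G, hG, hGx, h1, -⟩ := L.exists_localInverse hx
  have h2 : ContMDiffAt ((𝓡∂ (k + 1)).prod 𝓘(ℝ, ℝ)) (𝓡∂ (k + 1)) ∞ (fun p : V × ℝ => G p.1)
      (h x, t) :=
    ContMDiffAt.comp (f := Prod.fst) (g := G) (h x, t) hG contMDiffAt_fst
  have h3 : ContMDiffAt ((𝓡∂ (k + 1)).prod 𝓘(ℝ, ℝ)) (𝓡 (k + 2)) ∞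
      (fun p : V × ℝ => O.sweep (G p.1, p.2)) (h x, t) :=
    O.contMDiff_sweep.contMDiffAt.comp _ (h2.prodMk contMDiffAt_snd)
  refine h3.congr_of_eventuallyEq ?_
  filter_upwards [continuous_fst.continuousAt.eventually h1] with p hp
  rw [← O.sweepOn_apply (j := j) (h := h), hp]

theorem injective_mfderiv_sweepOn (L : O.IsPageLift j h) {x : P} (hx : x ∈ (𝓡∂ (k + 1)).interior P) (t : ℝ) :
    Function.Injective
      (mfderiv (𝓡∂ (k + 1)) (𝓡 (k + 2)) (fun v => O.sweepOn j h (v, t)) (h x)) := by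
  rw [injective_mfderiv_iff]
  intro w hw
  have hs : MDifferentiableAt (𝓡∂ (k + 1)) (𝓡 (k + 2)) (fun v => O.sweepOn j h (v, t)) (h x) :=
    ((L.contMDiffAt_sweepOn hx t).comp (h x)
      (contMDiffAt_id.prodMk contMDiffAt_const)).mdifferentiableAt (by simp)
  obtain ⟨w', rfl⟩ : ∃ w', chartDeriv (𝓡∂ (k + 1)) (𝓡∂ (k + 1)) h x w' = w :=
    (L.bijective_mfderiv x).2 w
  have h1 := chartDeriv_apply_of_comp (K := fun x' => O.sweep (x', t))
    (L.contMDiff.contMDiffAt.mdifferentiableAt (by simp)) hs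
    (Filter.Eventually.of_forall fun x' => O.sweepOn_apply x' t) w'
  rw [hw] at h1
  have h2 : HasMFDerivAt (𝓡∂ (k + 1)) ((𝓡∂ (k + 1)).prod 𝓘(ℝ, ℝ)) (fun x' : P => (x', t)) x
      ((ContinuousLinearMap.id ℝ (EuclideanSpace ℝ (Fin (k + 1)))).prod 0) :=
    (hasMFDerivAt_id x).prodMk (hasMFDerivAt_const t x)
  have h3 := HasMFDerivAt.comp (f := fun x' : P => (x', t)) (g := O.sweep) x
    (O.contMDiff_sweep.contMDiffAt.mdifferentiableAt (by simp)).hasMFDerivAt h2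
  have h4 : chartDeriv ((𝓡∂ (k + 1)).prod 𝓘(ℝ, ℝ)) (𝓡 (k + 2)) O.sweep (x, t) (w', 0) = 0 := by
    rw [← h1]
    exact (congrArg (fun T : EuclideanSpace ℝ (Fin (k + 1)) →L[ℝ] EuclideanSpace ℝ (Fin (k + 2)) =>
      T w') (show chartDeriv (𝓡∂ (k + 1)) (𝓡 (k + 2)) (fun x' => O.sweep (x', t)) x = _ from
        h3.mfderiv)).symm
  have h5 := injective_mfderiv_iff.1 (O.injective_mfderiv_sweep x hx t) (w', 0) h4
  have h6 : w' = 0 := congrArg Prod.fst h5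
  rw [h6, map_zero]

variable [IsManifold (𝓡 k) ∞ B] [IsManifold (𝓡 (k + 2)) ∞ M] [CompactSpace B] [T2Space M]
  [CompactSpace P] [T2Space V]

/-- The image of the interior of the page is open in `V`, so the frontier of the page consists of
binding points, where the level is zero and matches the extension. -/
theorem continuous_levelOn (L : O.IsPageLift j h) : Continuous (O.levelOn j h) := by
  classical
  refine Continuous.if (p := fun v => v ∈ range h) (fun v hv => ?_) (O.continuous_level.comp L.isSmoothEmbedding.contMDiff.continuous)
    continuous_const
  have hcl : IsClosed (range h) := (isCompact_range L.continuous).isClosed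
  have hv' : v ∈ frontier (range h) := hv
  obtain ⟨x, rfl⟩ := hcl.frontier_subset hv'
  have hx : x ∈ (𝓡∂ (k + 1)).boundary P := by
    rw [← (𝓡∂ (k + 1)).compl_interior]
    intro hx
    exact hv'.2 (mem_interior_iff_mem_nhds.2 (L.range_mem_nhds hx))
  have h1 := L.levelOn_apply_of_mem_boundary hx
  rwa [levelOn, if_pos (mem_range_self x)] at h1

/-- Vanishing up to 1 hides the extension by zero across the binding, and constancy from 4 on hides
the cap at 5. -/
theorem contMDiff_comp_levelOn (L : O.IsPageLift j h) {g : ℝ → ℝ} (hg : ContDiff ℝ ∞ g) (hg1 : ∀ q ≤ 1, g q = 0)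
    (hg4 : ∀ q, 4 ≤ q → g q = g 4) :
    ContMDiff (𝓡∂ (k + 1)) 𝓘(ℝ, ℝ) ∞ (fun v => g (O.levelOn j h v)) := by
  intro v
  rcases lt_or_ge 0 (O.levelOn j h v) with hv | hv
  · obtain ⟨x, hx, rfl⟩ := L.exists_of_levelOn_pos hv
    have h1 : ContMDiffAt (𝓡∂ (k + 1)) 𝓘(ℝ, ℝ) ∞ (fun v => g (O.level (j v))) (h x) :=
      ((O.contMDiff_comp_level hg hg4).comp L.isSmoothEmbedding.contMDiff) (h x)
    refine h1.congr_of_eventuallyEq ?_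
    filter_upwards [L.range_mem_nhds hx] with v hv
    rw [levelOn, if_pos hv]
  · refine (contMDiffAt_const (c := (0 : ℝ))).congr_of_eventuallyEq ?_
    filter_upwards [L.continuous_levelOn.continuousAt.eventually
      (gt_mem_nhds (show O.levelOn j h v < 1 by linarith))] with v' hv'
    exact hg1 _ hv'.le

end IsPageLift

end OpenBook


/-! ### Cutoff profiles for raising and turning the page. -/

/-- The profile that is `0` on `(-∞, 1]` and `1` on `[2, ∞)`. -/
def cutoffProfile (q : ℝ) : ℝ := Real.smoothTransition (q - 1)

/-- The profile that is `0` on `(-∞, 9/4]` and `1` on `[11/4, ∞)`. -/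
def turnProfile (q : ℝ) : ℝ := Real.smoothTransition (2 * q - 9 / 2)

/-- A profile that is `0` on `(-∞, 1]`, the identity on `[2, 3]` and `5` on `[4, ∞)`. -/
def heightProfile (q : ℝ) : ℝ :=
  Real.smoothTransition (q - 1) *
    ((1 - Real.smoothTransition (q - 3)) * q + Real.smoothTransition (q - 3) * 5)

section Profiles

variable {q : ℝ}

theorem contDiff_cutoffProfile : ContDiff ℝ ∞ cutoffProfile :=
  Real.smoothTransition.contDiff.comp (by fun_prop)

theorem contDiff_turnProfile : ContDiff ℝ ∞ turnProfile :=
  Real.smoothTransition.contDiff.comp (by fun_prop)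

theorem contDiff_heightProfile : ContDiff ℝ ∞ heightProfile := by
  have h1 : ContDiff ℝ ∞ fun q : ℝ => Real.smoothTransition (q - 1) :=
    Real.smoothTransition.contDiff.comp (by fun_prop)
  have h3 : ContDiff ℝ ∞ fun q : ℝ => Real.smoothTransition (q - 3) :=
    Real.smoothTransition.contDiff.comp (by fun_prop)
  exact h1.mul (((contDiff_const.sub h3).mul contDiff_id).add (h3.mul contDiff_const))

theorem cutoffProfile_of_le (hq : q ≤ 1) : cutoffProfile q = 0 :=
  Real.smoothTransition.zero_of_nonpos (by linarith)

theorem cutoffProfile_of_ge (hq : 2 ≤ q) : cutoffProfile q = 1 :=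
  Real.smoothTransition.one_of_one_le (by linarith)

theorem cutoffProfile_nonneg (q : ℝ) : 0 ≤ cutoffProfile q := Real.smoothTransition.nonneg _

theorem cutoffProfile_le_one (q : ℝ) : cutoffProfile q ≤ 1 := Real.smoothTransition.le_one _

theorem turnProfile_of_le (hq : q ≤ 9 / 4) : turnProfile q = 0 :=
  Real.smoothTransition.zero_of_nonpos (by linarith)

theorem turnProfile_of_ge (hq : 11 / 4 ≤ q) : turnProfile q = 1 :=
  Real.smoothTransition.one_of_one_le (by linarith)

theorem heightProfile_of_le (hq : q ≤ 1) : heightProfile q = 0 := by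
  rw [heightProfile, Real.smoothTransition.zero_of_nonpos (by linarith), zero_mul]

theorem heightProfile_of_mem (hq : 2 ≤ q) (hq' : q ≤ 3) : heightProfile q = q := by
  rw [heightProfile, Real.smoothTransition.one_of_one_le (by linarith),
    Real.smoothTransition.zero_of_nonpos (by linarith)]
  ring

theorem heightProfile_of_ge (hq : 4 ≤ q) : heightProfile q = 5 := by
  rw [heightProfile, Real.smoothTransition.one_of_one_le (by linarith),
    Real.smoothTransition.one_of_one_le (by linarith)]
  ring

theorem heightProfile_lt_two (hq : q < 2) : heightProfile q < 2 := by
  rcases le_or_gt q 1 with h | h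
  · rw [heightProfile_of_le h]
    norm_num
  · rw [heightProfile, Real.smoothTransition.zero_of_nonpos (x := q - 3) (by linarith)]
    have h1 := Real.smoothTransition.le_one (q - 1)
    nlinarith

/-- Past 3 the profile is a mixture of `q` and 5. Only this lower bound is needed there, since those
levels are swept by the flow itself and the height need not separate them from one another. -/
theorem three_lt_heightProfile (hq : 3 < q) : 3 < heightProfile q := by
  rw [heightProfile, Real.smoothTransition.one_of_one_le (x := q - 1) (by linarith)]
  have h1 := Real.smoothTransition.le_one (q - 3)
  have h2 := Real.smoothTransition.nonneg (q - 3)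
  have h3 := mul_nonneg (sub_nonneg.2 h1) (sub_nonneg.2 hq.le)
  rcases h2.eq_or_lt with h4 | h4
  · rw [← h4]
    linarith
  · linarith

theorem heightProfile_nonneg (q : ℝ) : 0 ≤ heightProfile q := by
  rcases le_or_gt q 1 with h | h
  · rw [heightProfile_of_le h]
  · have h1 := Real.smoothTransition.le_one (q - 3)
    have h2 := Real.smoothTransition.nonneg (q - 3)
    exact mul_nonneg (Real.smoothTransition.nonneg _) (by nlinarith)

theorem heightProfile_le_five (q : ℝ) : heightProfile q ≤ 5 := by
  rcases le_or_gt q 1 with h | h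
  · rw [heightProfile_of_le h]
    norm_num
  rcases le_or_gt 4 q with h' | h'
  · rw [heightProfile_of_ge h']
  have h1 := Real.smoothTransition.le_one (q - 3)
  have h2 := Real.smoothTransition.nonneg (q - 3)
  have h3 := Real.smoothTransition.le_one (q - 1)
  have h5 : (1 - Real.smoothTransition (q - 3)) * q + Real.smoothTransition (q - 3) * 5 ≤ 5 := by
    nlinarith
  have h6 : 0 ≤ (1 - Real.smoothTransition (q - 3)) * q + Real.smoothTransition (q - 3) * 5 := by
    nlinarith
  exact (mul_le_of_le_one_left h6 h3).trans h5

end Profiles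

theorem chartDeriv_prodMk_apply {E E' E'' : Type*} [NormedAddCommGroup E] [NormedSpace ℝ E]
    [NormedAddCommGroup E'] [NormedSpace ℝ E'] [NormedAddCommGroup E''] [NormedSpace ℝ E'']
    {H H' H'' : Type*} [TopologicalSpace H] [TopologicalSpace H'] [TopologicalSpace H'']
    {I : ModelWithCorners ℝ E H} {J : ModelWithCorners ℝ E' H'} {J' : ModelWithCorners ℝ E'' H''}
    {M N N' : Type*} [TopologicalSpace M] [ChartedSpace H M] [TopologicalSpace N]
    [ChartedSpace H' N] [TopologicalSpace N'] [ChartedSpace H'' N'] {f : M → N} {g : M → N'} {x : M}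
    (hf : MDifferentiableAt I J f x) (hg : MDifferentiableAt I J' g x) (w : E) :
    chartDeriv I (J.prod J') (fun y => (f y, g y)) x w
      = (chartDeriv I J f x w, chartDeriv I J' g x w) := by
  rw [chartDeriv, (hf.hasMFDerivAt.prodMk hg.hasMFDerivAt).mfderiv]
  rfl

/-! ### Raising the page and turning it around the binding. -/

namespace OpenBook

variable {k : ℕ}
  {P : Type*} [TopologicalSpace P] [ChartedSpace (EuclideanHalfSpace (k + 1)) P]
  {ρ : DiffBdry (𝓡∂ (k + 1)) P}
  {B : Type*} [TopologicalSpace B] [ChartedSpace (EuclideanSpace ℝ (Fin k)) B]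
  {M : Type*} [TopologicalSpace M] [ChartedSpace (EuclideanSpace ℝ (Fin (k + 2))) M]
  {V : Type*}

/-- The height function `f`, modified along the page. -/
def pageHeight (O : OpenBook k P ρ B M) (j : V → M) (h : P ↪ V) (f : V → ℝ) (ε : ℝ) (v : V) : ℝ :=
  (1 - cutoffProfile (O.levelOn j h v)) * f v + cutoffProfile (O.levelOn j h v) * (ε / 4)
    + ε / 20 * heightProfile (O.levelOn j h v)

/-- The complex factor which describes the motion of the page near the binding. -/
def turnFactor (p : ℝ × ℝ) : ℂ :=
  1 + (p.1 : ℂ) * (Complex.exp (2 * Real.pi * p.2 * Complex.I) - 1)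

open Classical in
/-- The motion of `V` in `M` which sweeps the page once around the open book away from the binding,
and keeps the rest of `V` fixed. -/
def motion (O : OpenBook k P ρ B M) (j : V → M) (h : P ↪ V) (p : V × ℝ) : M :=
  if O.levelOn j h p.1 < 3 then
    O.scale (j p.1) (turnFactor (turnProfile (O.levelOn j h p.1), p.2))
  else O.sweepOn j h p

theorem contDiff_turnFactor : ContDiff ℝ ∞ turnFactor := by
  have h1 : ContDiff ℝ ∞ fun p : ℝ × ℝ => (p.1 : ℂ) := Complex.ofRealCLM.contDiff.comp contDiff_fst
  have h2 : ContDiff ℝ ∞ fun p : ℝ × ℝ => (p.2 : ℂ) := Complex.ofRealCLM.contDiff.comp contDiff_snd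
  have h3 : ContDiff ℝ ∞ fun p : ℝ × ℝ => Complex.exp (2 * Real.pi * p.2 * Complex.I) :=
    ((contDiff_const.mul h2).mul contDiff_const).cexp
  exact contDiff_const.add (h1.mul (h3.sub contDiff_const))

theorem turnFactor_zero_left (t : ℝ) : turnFactor (0, t) = 1 := by simp [turnFactor]

theorem turnFactor_one_left (t : ℝ) :
    turnFactor (1, t) = Complex.exp (2 * Real.pi * t * Complex.I) := by simp [turnFactor]

theorem turnFactor_zero_right (a : ℝ) : turnFactor (a, 0) = 1 := by simp [turnFactor]

theorem turnFactor_one_right (a : ℝ) : turnFactor (a, 1) = 1 := by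
  simp [turnFactor, Complex.exp_two_pi_mul_I]

variable {O : OpenBook k P ρ B M} {j : V → M} {h : P ↪ V} {f : V → ℝ} {ε : ℝ}

theorem motion_of_le {v : V} (hv : O.levelOn j h v ≤ 9 / 4) (t : ℝ) :
    O.motion j h (v, t) = j v := by
  rw [motion, if_pos (show O.levelOn j h v < 3 by linarith), turnProfile_of_le hv,
    turnFactor_zero_left, scale_one]

theorem motion_of_three_le {v : V} (hv : 3 ≤ O.levelOn j h v) (t : ℝ) :
    O.motion j h (v, t) = O.sweepOn j h (v, t) := if_neg (not_lt.2 hv)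

theorem pageHeight_of_le {v : V} (hv : O.levelOn j h v ≤ 1) : O.pageHeight j h f ε v = f v := by
  rw [pageHeight, cutoffProfile_of_le hv, heightProfile_of_le hv]
  ring

theorem pageHeight_of_ge {v : V} (hv : 2 ≤ O.levelOn j h v) :
    O.pageHeight j h f ε v = ε / 4 + ε / 20 * heightProfile (O.levelOn j h v) := by
  rw [pageHeight, cutoffProfile_of_ge hv]
  ring

/-- The first two terms of the height form a convex combination of `f v` and `ε / 4`, hence
contribute at most `ε / 4`; the last term exceeds `ε / 20 * 2` only from level 2 on. -/
theorem pageHeight_lt (hε : 0 < ε) (hf : ∀ v, f v ≤ ε / 4) {v : V} (hv : O.levelOn j h v < 2) :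
    O.pageHeight j h f ε v < ε / 4 + ε / 20 * 2 := by
  have h1 := heightProfile_lt_two hv
  have h2 := cutoffProfile_le_one (O.levelOn j h v)
  have h3 : (1 - cutoffProfile (O.levelOn j h v)) * f v
      ≤ (1 - cutoffProfile (O.levelOn j h v)) * (ε / 4) :=
    mul_le_mul_of_nonneg_left (hf v) (by linarith)
  have h4 : ε / 20 * heightProfile (O.levelOn j h v) < ε / 20 * 2 :=
    mul_lt_mul_of_pos_left h1 (by positivity)
  rw [pageHeight]
  linarith

theorem pageHeight_le (hε : 0 < ε) (hf : ∀ v, f v ≤ ε / 4) (v : V) :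
    O.pageHeight j h f ε v ≤ ε := by
  have h2 := cutoffProfile_le_one (O.levelOn j h v)
  have h3 : (1 - cutoffProfile (O.levelOn j h v)) * f v
      ≤ (1 - cutoffProfile (O.levelOn j h v)) * (ε / 4) :=
    mul_le_mul_of_nonneg_left (hf v) (by linarith)
  have h4 : ε / 20 * heightProfile (O.levelOn j h v) ≤ ε / 20 * 5 :=
    mul_le_mul_of_nonneg_left (heightProfile_le_five _) (by positivity)
  rw [pageHeight]
  linarith

theorem pageHeight_pos (hε : 0 < ε) {v : V} (hv : 0 < f v) : 0 < O.pageHeight j h f ε v := by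
  have h1 := cutoffProfile_nonneg (O.levelOn j h v)
  have h2 := cutoffProfile_le_one (O.levelOn j h v)
  have h4 : 0 ≤ ε / 20 * heightProfile (O.levelOn j h v) :=
    mul_nonneg (by positivity) (heightProfile_nonneg _)
  have h5 : 0 < (1 - cutoffProfile (O.levelOn j h v)) * f v
      + cutoffProfile (O.levelOn j h v) * (ε / 4) := by
    rcases h2.lt_or_eq with h | h
    · exact add_pos_of_pos_of_nonneg (mul_pos (by linarith) hv) (mul_nonneg h1 (by positivity))
    · rw [h]
      simpa using hε
  rw [pageHeight]
  linarith

theorem pageHeight_nonneg (hε : 0 < ε) {v : V} (hv : 0 ≤ f v) : 0 ≤ O.pageHeight j h f ε v := by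
  have h1 := cutoffProfile_nonneg (O.levelOn j h v)
  have h2 := cutoffProfile_le_one (O.levelOn j h v)
  exact add_nonneg (add_nonneg (mul_nonneg (by linarith) hv) (mul_nonneg h1 (by positivity)))
    (mul_nonneg (by positivity) (heightProfile_nonneg _))

/-- The modified height determines the level in the region where the page is turned partially. -/
theorem level_trichotomy_of_pageHeight_eq (hε : 0 < ε) (hf : ∀ v, f v ≤ ε / 4) {v v' : V}
    (hvv : O.pageHeight j h f ε v = O.pageHeight j h f ε v') :
    (O.levelOn j h v < 2 ∧ O.levelOn j h v' < 2) ∨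
    (2 ≤ O.levelOn j h v ∧ O.levelOn j h v < 3 ∧ O.levelOn j h v' = O.levelOn j h v) ∨
    (3 ≤ O.levelOn j h v ∧ 3 ≤ O.levelOn j h v') := by
  -- The value `ε / 4 + ε / 20 * 2` separates levels below 2 from the others. From 2 to 3 the height
  -- is affine in the level, and beyond 3 it stays above its value at 3.
  have key : ∀ {u : V}, 2 ≤ O.levelOn j h u → 2 ≤ heightProfile (O.levelOn j h u) := by
    intro u hu
    rcases le_or_gt (O.levelOn j h u) 3 with h3 | h3
    · rwa [heightProfile_of_mem hu h3]
    · linarith [three_lt_heightProfile h3]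
  have hge : ∀ {u : V}, 2 ≤ O.levelOn j h u → ε / 4 + ε / 20 * 2 ≤ O.pageHeight j h f ε u := by
    intro u hu
    rw [pageHeight_of_ge hu]
    have := mul_le_mul_of_nonneg_left (key hu) (show 0 ≤ ε / 20 by positivity)
    linarith
  rcases lt_or_ge (O.levelOn j h v) 2 with hv | hv <;>
    rcases lt_or_ge (O.levelOn j h v') 2 with hv' | hv'
  · exact Or.inl ⟨hv, hv'⟩
  · linarith [pageHeight_lt hε hf hv, hge hv']
  · linarith [pageHeight_lt hε hf hv', hge hv]
  right
  rw [pageHeight_of_ge hv, pageHeight_of_ge hv'] at hvv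
  have hH : heightProfile (O.levelOn j h v) = heightProfile (O.levelOn j h v') :=
    mul_left_cancel₀ (show ε / 20 ≠ 0 by positivity) (add_left_cancel hvv)
  rcases lt_or_ge (O.levelOn j h v) 3 with h3 | h3
  · left
    rw [heightProfile_of_mem hv h3.le] at hH
    have h4 : O.levelOn j h v' ≤ 3 := by
      by_contra hlt
      linarith [three_lt_heightProfile (not_le.1 hlt)]
    rw [heightProfile_of_mem hv' h4] at hH
    exact ⟨hv, h3, hH.symm⟩
  · right
    refine ⟨h3, ?_⟩
    by_contra hlt
    rw [heightProfile_of_mem hv' (not_le.1 hlt).le] at hH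
    rcases h3.lt_or_eq with h4 | h4
    · linarith [three_lt_heightProfile h4]
    · rw [← h4, heightProfile_of_mem (by norm_num) le_rfl] at hH
      linarith

end OpenBook


/-! ### The sweep as an isotopy of neat graphs. -/

namespace OpenBook.IsPageLift

variable {k : ℕ}
  {P : Type*} [TopologicalSpace P] [ChartedSpace (EuclideanHalfSpace (k + 1)) P]
  {ρ : DiffBdry (𝓡∂ (k + 1)) P}
  {B : Type*} [TopologicalSpace B] [ChartedSpace (EuclideanSpace ℝ (Fin k)) B]
  {M : Type*} [TopologicalSpace M] [ChartedSpace (EuclideanSpace ℝ (Fin (k + 2))) M]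
  {V : Type*} [TopologicalSpace V] [ChartedSpace (EuclideanHalfSpace (k + 1)) V]
  {O : OpenBook k P ρ B M} {j : V → M} {h : P ↪ V} {f : V → ℝ} {ε : ℝ}

/-- From level 11/4 on the factor is a full rotation, which in the tube is the flow of the book. The
two formulas for the motion thus agree up to level 3, which makes it smooth across that level. -/
theorem motion_of_ge (L : O.IsPageLift j h) {v : V} (hv : 11 / 4 ≤ O.levelOn j h v) (t : ℝ) :
    O.motion j h (v, t) = O.sweepOn j h (v, t) := by
  rcases lt_or_ge (O.levelOn j h v) 3 with h3 | h3
  · obtain ⟨x, -, rfl, b, r, -, -, h1, h2, -⟩ :=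
      L.exists_tube_of_levelOn (show 0 < O.levelOn j h v by linarith) (by linarith)
    rw [motion, if_pos h3, turnProfile_of_ge hv, turnFactor_one_left, sweepOn_apply, h2]
    change O.scale (j (h x)) _ = _
    rw [h1, scale_tube]
  · exact motion_of_three_le h3 t

theorem motion_zero (L : O.IsPageLift j h) (v : V) : O.motion j h (v, 0) = j v := by
  rcases lt_or_ge (O.levelOn j h v) 3 with h3 | h3
  · rw [motion, if_pos h3, turnFactor_zero_right, scale_one]
  · rw [motion_of_three_le h3]
    obtain ⟨x, -, rfl⟩ := L.exists_of_levelOn_pos (show 0 < O.levelOn j h v by linarith)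
    rw [sweepOn_apply, L.comp_eq, page]

theorem viaEmbedding_of_levelOn_lt (L : O.IsPageLift j h) {v : V} (hv : O.levelOn j h v < 5) :
    Equiv.Perm.viaEmbedding (ρ : Equiv.Perm P) h v = v := by
  by_cases hr : v ∈ range h
  · obtain ⟨x, rfl⟩ := hr
    rw [L.levelOn_apply] at hv
    rw [Equiv.Perm.viaEmbedding_apply, monodromy_eq_of_level_lt hv]
  · exact Equiv.Perm.viaEmbedding_apply_of_notMem _ _ _ hr

theorem motion_one (L : O.IsPageLift j h) (v : V) :
    O.motion j h (v, 1) = j (Equiv.Perm.viaEmbedding (ρ : Equiv.Perm P) h v) := by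
  rcases lt_or_ge (O.levelOn j h v) 3 with h3 | h3
  · rw [motion, if_pos h3, turnFactor_one_right, scale_one,
      L.viaEmbedding_of_levelOn_lt (by linarith)]
  · rw [motion_of_three_le h3]
    obtain ⟨x, -, rfl⟩ := L.exists_of_levelOn_pos (show 0 < O.levelOn j h v by linarith)
    rw [sweepOn_apply, Equiv.Perm.viaEmbedding_apply, L.comp_eq, page_monodromy]

/-- From level 2 on `f` has dropped out of the height, which then depends on the level alone, and
the monodromy preserves the level. At lower levels the extended monodromy is the identity. -/
theorem pageHeight_viaEmbedding (L : O.IsPageLift j h) (v : V) :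
    O.pageHeight j h f ε (Equiv.Perm.viaEmbedding (ρ : Equiv.Perm P) h v)
      = O.pageHeight j h f ε v := by
  rcases lt_or_ge (O.levelOn j h v) 3 with h3 | h3
  · rw [L.viaEmbedding_of_levelOn_lt (by linarith)]
  · obtain ⟨x, -, rfl⟩ := L.exists_of_levelOn_pos (show 0 < O.levelOn j h v by linarith)
    have h1 : O.levelOn j h (Equiv.Perm.viaEmbedding (ρ : Equiv.Perm P) h (h x))
        = O.levelOn j h (h x) := by
      rw [Equiv.Perm.viaEmbedding_apply, L.levelOn_apply, L.levelOn_apply, level_page_monodromy]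
    rw [pageHeight_of_ge (by rw [h1]; linarith), pageHeight_of_ge (by linarith), h1]

/-- Equal heights put both points in the same zone. Below level 2 nothing moves. From 2 to 3 the
levels are equal, so both tube coordinates are multiplied by the same factor and the points of the
binding agree; the factor may vanish, but the radius is already known from the height. From 3 on the
sweep is injective at each fixed time. -/
theorem motion_injective (L : O.IsPageLift j h) (hε : 0 < ε) (hf : ∀ v, f v ≤ ε / 4) {t : ℝ}
    (ht : t ∈ Icc 0 1) {v v' : V} (hm : O.motion j h (v, t) = O.motion j h (v', t))
    (hh : O.pageHeight j h f ε v = O.pageHeight j h f ε v') : v = v' := by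
  rcases level_trichotomy_of_pageHeight_eq hε hf hh with ⟨h1, h2⟩ | ⟨h1, h2, h3⟩ | ⟨h1, h2⟩
  · rw [motion_of_le (by linarith), motion_of_le (by linarith)] at hm
    exact L.isSmoothEmbedding.isEmbedding.injective hm
  · obtain ⟨x, -, -, b, r, hr, hr1, hr2, -⟩ :=
      L.exists_tube_of_levelOn (show 0 < O.levelOn j h v by linarith) (by linarith)
    obtain ⟨x', -, -, b', r', hr', hr1', hr2', -⟩ :=
      L.exists_tube_of_levelOn (show 0 < O.levelOn j h v' by linarith) (by linarith)
    have hrr : r = r' := by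
      have h4 : r ^ 2 = r' ^ 2 := by rw [← hr1, ← hr1', h3]
      exact (sq_eq_sq₀ hr.le hr'.le).1 h4
    have h3' : O.levelOn j h v' < 3 := by rw [h3]; exact h2
    have hm1 : O.motion j h (v, t)
        = O.tube (b, r * turnFactor (turnProfile (O.levelOn j h v), t)) := by
      rw [motion, if_pos h2, ← scale_tube, ← hr2]
    have hm2 : O.motion j h (v', t)
        = O.tube (b', r * turnFactor (turnProfile (O.levelOn j h v), t)) := by
      rw [motion, if_pos h3', ← scale_tube, hrr, ← hr2', ← h3]
    have hb : b = b' := congrArg Prod.fst (O.injective_tube (hm1.symm.trans (hm.trans hm2)))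
    refine L.isSmoothEmbedding.isEmbedding.injective ?_
    rw [hr2, hr2', hb, hrr]
  · rw [motion_of_three_le h1, motion_of_three_le h2] at hm
    obtain ⟨x, hx, rfl⟩ := L.exists_of_levelOn_pos (show 0 < O.levelOn j h v by linarith)
    obtain ⟨x', hx', rfl⟩ := L.exists_of_levelOn_pos (show 0 < O.levelOn j h v' by linarith)
    rw [sweepOn_apply, sweepOn_apply] at hm
    -- The open book gives injectivity only for times in `[0, 1)`. At time 1 the sweep is the page
    -- composed with the monodromy.
    rcases ht.2.lt_or_eq with ht1 | rfl
    · have ht' : t ∈ Ico (0 : ℝ) 1 := ⟨ht.1, ht1⟩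
      exact congrArg h (congrArg Prod.fst (O.injOn_sweep (mk_mem_prod hx ht') (mk_mem_prod hx' ht') hm))
    · rw [← page_monodromy, ← page_monodromy] at hm
      exact congrArg h ((ρ : Equiv.Perm P).injective (O.injective_page hm))

variable [IsManifold (𝓡∂ (k + 1)) ∞ P]

theorem pageHeight_eq_zero_iff (L : O.IsPageLift j h) (hε : 0 < ε)
    (hf : IsBoundaryDefiningOn (k + 1) f univ) (v : V) :
    O.pageHeight j h f ε v = 0 ↔ v ∈ (𝓡∂ (k + 1)).boundary V := by
  constructor
  · intro h0
    by_contra hv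
    have h1 : v ∈ (𝓡∂ (k + 1)).interior V := by
      rw [← (𝓡∂ (k + 1)).compl_boundary]
      exact hv
    exact (pageHeight_pos hε (hf.2.2.2.1 v (mem_univ _) h1)).ne' h0
  · intro hv
    rw [pageHeight_of_le (by rw [L.levelOn_of_mem_boundary hv]; exact zero_le_one),
      hf.2.2.1 v hv]

variable [IsManifold (𝓡∂ (k + 1)) ∞ V]
  [IsManifold (𝓡 k) ∞ B] [IsManifold (𝓡 (k + 2)) ∞ M] [CompactSpace B] [T2Space M]
  [CompactSpace P] [T2Space V]

/-- The extension is locally the identity at levels below 3, which covers the frontier of the page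
and the boundary of `V`. At higher levels `h` is a local diffeomorphism and carries the smoothness
of the monodromy and of its inverse to `V`. -/
theorem viaEmbedding_mem_diffBdry (L : O.IsPageLift j h) :
    Equiv.Perm.viaEmbedding (ρ : Equiv.Perm P) h ∈ DiffBdry (𝓡∂ (k + 1)) V := by
  set η := Equiv.Perm.viaEmbedding (ρ : Equiv.Perm P) h with hη
  have hid : ∀ v, O.levelOn j h v < 3 → ∀ᶠ v' in 𝓝 v, η v' = v' := by
    intro v hv
    filter_upwards [L.continuous_levelOn.continuousAt.eventually (gt_mem_nhds hv)] with v' hv'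
    exact L.viaEmbedding_of_levelOn_lt (by linarith)
  have hηs : ∀ x, η.symm (h x) = h ((ρ : Equiv.Perm P).symm x) := by
    intro x
    rw [Equiv.symm_apply_eq, hη, Equiv.Perm.viaEmbedding_apply, Equiv.apply_symm_apply]
  have hlift : ∀ {a : P → P} {b : V → V}, ContMDiff (𝓡∂ (k + 1)) (𝓡∂ (k + 1)) ∞ a →
      (∀ x, b (h x) = h (a x)) → ∀ v, 3 ≤ O.levelOn j h v →
      ContMDiffAt (𝓡∂ (k + 1)) (𝓡∂ (k + 1)) ∞ b v := by
    intro a b ha hab v hv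
    obtain ⟨x, hx, rfl⟩ := L.exists_of_levelOn_pos (show 0 < O.levelOn j h v by linarith)
    obtain ⟨G, hG, -, hGr, -⟩ := L.exists_localInverse hx
    refine ((L.contMDiff.comp ha).contMDiffAt.comp (h x) hG).congr_of_eventuallyEq ?_
    filter_upwards [hGr] with v' hv'
    change b v' = h (a (G v'))
    rw [← hab, hv']
  refine ⟨fun v => ?_, fun v => ?_, ?_⟩
  · rcases lt_or_ge (O.levelOn j h v) 3 with h3 | h3
    · exact contMDiffAt_id.congr_of_eventuallyEq (hid v h3)
    · exact hlift ρ.2.1 (fun x => Equiv.Perm.viaEmbedding_apply _ _ _) v h3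
  · rcases lt_or_ge (O.levelOn j h v) 3 with h3 | h3
    · refine contMDiffAt_id.congr_of_eventuallyEq ?_
      filter_upwards [hid v h3] with v' hv'
      rw [Equiv.symm_apply_eq, id, hv']
    · exact hlift ρ.2.2.1 hηs v h3
  · rw [Filter.eventually_iff, mem_nhdsSet_iff_forall]
    intro v hv
    exact hid v (by rw [L.levelOn_of_mem_boundary hv]; norm_num)

theorem contMDiff_pageHeight (L : O.IsPageLift j h) (hf : ContMDiff (𝓡∂ (k + 1)) 𝓘(ℝ, ℝ) ∞ f) :
    ContMDiff (𝓡∂ (k + 1)) 𝓘(ℝ, ℝ) ∞ (O.pageHeight j h f ε) := by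
  have h1 := L.contMDiff_comp_levelOn contDiff_cutoffProfile (fun q => cutoffProfile_of_le)
    fun q hq => by
      rw [cutoffProfile_of_ge (by linarith), cutoffProfile_of_ge (by norm_num)]
  have h2 := L.contMDiff_comp_levelOn contDiff_heightProfile (fun q => heightProfile_of_le)
    fun q hq => by rw [heightProfile_of_ge hq, heightProfile_of_ge le_rfl]
  exact (((contMDiff_const.sub h1).mul hf).add (h1.mul contMDiff_const)).add
    (contMDiff_const.mul h2)

theorem contMDiff_turnProfile (L : O.IsPageLift j h) :
    ContMDiff (𝓡∂ (k + 1)) 𝓘(ℝ, ℝ) ∞ fun v => turnProfile (O.levelOn j h v) :=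
  L.contMDiff_comp_levelOn contDiff_turnProfile (fun q hq => turnProfile_of_le (by linarith))
    fun q hq => by rw [turnProfile_of_ge (by linarith), turnProfile_of_ge (by norm_num)]

/-- The motion is at rest below level 9/4, a smooth scaling in the tube up to level 3, and the
smooth sweep above 11/4; these descriptions overlap on open sets. -/
theorem contMDiff_motion (L : O.IsPageLift j h) :
    ContMDiff ((𝓡∂ (k + 1)).prod 𝓘(ℝ, ℝ)) (𝓡 (k + 2)) ∞ (O.motion j h) := by
  rintro ⟨v, t⟩
  have hlt : ∀ {c : ℝ}, O.levelOn j h v < c →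
      ∀ᶠ p : V × ℝ in 𝓝 (v, t), O.levelOn j h p.1 < c := fun hc =>
    (L.continuous_levelOn.comp continuous_fst).continuousAt.eventually (gt_mem_nhds hc)
  rcases lt_or_ge (O.levelOn j h v) (9 / 4) with h1 | h1
  · have h2 : ContMDiffAt ((𝓡∂ (k + 1)).prod 𝓘(ℝ, ℝ)) (𝓡 (k + 2)) ∞ (fun p : V × ℝ => j p.1)
        (v, t) := (L.isSmoothEmbedding.contMDiff.comp contMDiff_fst) (v, t)
    refine h2.congr_of_eventuallyEq ?_
    filter_upwards [hlt h1] with p hp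
    exact motion_of_le hp.le p.2
  rcases lt_or_ge (O.levelOn j h v) 3 with h3 | h3
  · obtain ⟨x, -, -, b, r, -, -, hr, -⟩ :=
      L.exists_tube_of_levelOn (show 0 < O.levelOn j h v by linarith) (by linarith)
    have e1 : ContMDiff ((𝓡∂ (k + 1)).prod 𝓘(ℝ, ℝ)) 𝓘(ℝ, ℂ) ∞
        (fun p : V × ℝ => turnFactor (turnProfile (O.levelOn j h p.1), p.2)) :=
      contDiff_turnFactor.contMDiff.comp
        ((L.contMDiff_turnProfile.comp contMDiff_fst).prodMk_space contMDiff_snd)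
    have e2 : ContMDiffAt ((𝓡∂ (k + 1)).prod 𝓘(ℝ, ℝ)) (𝓡 (k + 2)) ∞
        (fun p : V × ℝ => O.scale (j p.1) (turnFactor (turnProfile (O.levelOn j h p.1), p.2)))
        (v, t) := by
      refine ContMDiffAt.comp (g := fun q : M × ℂ => O.scale q.1 q.2) (v, t) ?_
        ((L.isSmoothEmbedding.contMDiff.comp contMDiff_fst).prodMk e1).contMDiffAt
      change ContMDiffAt _ _ _ _ (j v, _)
      rw [hr]
      exact O.contMDiffAt_scale _ _ _
    refine e2.congr_of_eventuallyEq ?_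
    filter_upwards [hlt h3] with p hp
    exact if_pos hp
  · obtain ⟨x, hx, rfl⟩ := L.exists_of_levelOn_pos (show 0 < O.levelOn j h v by linarith)
    refine (L.contMDiffAt_sweepOn hx t).congr_of_eventuallyEq ?_
    filter_upwards [(L.continuous_levelOn.comp continuous_fst).continuousAt.eventually
      (lt_mem_nhds (show 11 / 4 < O.levelOn j h (h x) by linarith))] with p hp
    exact L.motion_of_ge (le_of_lt hp) p.2

/-- In the region where the page is turned partially, the motion is an immersion together with the
height. -/
theorem chartDeriv_eq_zero_of_turning (L : O.IsPageLift j h) (hε : 0 < ε)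
    (hf : ContMDiff (𝓡∂ (k + 1)) 𝓘(ℝ, ℝ) ∞ f) (t : ℝ) {v : V}
    (hv : 2 < O.levelOn j h v) (hv' : O.levelOn j h v < 3) {w : EuclideanSpace ℝ (Fin (k + 1))}
    (hw : chartDeriv (𝓡∂ (k + 1)) (𝓡 (k + 2)) (fun v => O.motion j h (v, t)) v w = 0)
    (hw' : chartDeriv (𝓡∂ (k + 1)) 𝓘(ℝ, ℝ) (O.pageHeight j h f ε) v w = 0) : w = 0 := by
  obtain ⟨-, -, -, b, r, hr0, hr1, hr2, -⟩ :=
    L.exists_tube_of_levelOn (show 0 < O.levelOn j h v by linarith) (by linarith)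
  have hjs := L.isSmoothEmbedding.contMDiff
  have hms : ContMDiff (𝓡∂ (k + 1)) (𝓡 (k + 2)) ∞ (fun v => O.motion j h (v, t)) :=
    L.contMDiff_motion.comp (contMDiff_id.prodMk contMDiff_const)
  have hhs := L.contMDiff_pageHeight (ε := ε) hf
  have hev : ∀ᶠ v' in 𝓝 v, 2 < O.levelOn j h v' ∧ O.levelOn j h v' < 3 :=
    (L.continuous_levelOn.continuousAt.eventually (lt_mem_nhds hv)).and
      (L.continuous_levelOn.continuousAt.eventually (gt_mem_nhds hv'))
  -- tube coordinates on `V`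
  obtain ⟨G, hG, hGp, hGr, -⟩ := O.exists_tube_localInverse (b, (r : ℂ))
  rw [← hr2] at hG hGp hGr
  set β : V → B := fun v' => (G (j v')).1 with hβ
  set R : V → ℝ := fun v' => ((G (j v')).2).re with hR
  have hGj : ContMDiffAt (𝓡∂ (k + 1)) ((𝓡 k).prod 𝓘(ℝ, ℂ)) ∞ (fun v' => G (j v')) v :=
    ContMDiffAt.comp (g := G) v hG hjs.contMDiffAt
  have hβs : ContMDiffAt (𝓡∂ (k + 1)) (𝓡 k) ∞ β v := hGj.fst
  have hRs : ContMDiffAt (𝓡∂ (k + 1)) 𝓘(ℝ, ℝ) ∞ R v :=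
    Complex.reCLM.contMDiff.contMDiffAt.comp v hGj.snd
  have hcoord : ∀ᶠ v' in 𝓝 v, 0 < R v' ∧ O.levelOn j h v' = R v' ^ 2 ∧
      j v' = O.tube (β v', (R v' : ℂ)) := by
    filter_upwards [hev, hjs.continuous.continuousAt.eventually hGr] with v' h1 h2
    obtain ⟨-, -, -, b', r', h3, h4, h5, -⟩ :=
      L.exists_tube_of_levelOn (show 0 < O.levelOn j h v' by linarith) (by linarith)
    have h6 : G (j v') = (b', (r' : ℂ)) := O.injective_tube (h2.trans h5)
    have h7 : β v' = b' := congrArg Prod.fst h6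
    have h8 : R v' = r' := by
      change ((G (j v')).2).re = r'
      rw [h6, Complex.ofReal_re]
    rw [h7, h8]
    exact ⟨h3, h4, h5⟩
  -- The height is affine in `R ^ 2` here and `R` is positive, so `R` is a differentiable function
  -- of the height and its differential also kills `w`.
  have hdR : chartDeriv (𝓡∂ (k + 1)) 𝓘(ℝ, ℝ) R v w = 0 := by
    set g : ℝ → ℝ := fun y => Real.sqrt ((y - ε / 4) * (20 / ε)) with hg
    have hgh : ∀ v', 2 < O.levelOn j h v' ∧ O.levelOn j h v' < 3 →
        (O.pageHeight j h f ε v' - ε / 4) * (20 / ε) = O.levelOn j h v' := by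
      intro v' h1
      rw [pageHeight_of_ge h1.1.le, heightProfile_of_mem h1.1.le h1.2.le]
      field_simp
      ring
    have hgd : DifferentiableAt ℝ g (O.pageHeight j h f ε v) := by
      refine DifferentiableAt.sqrt (by fun_prop) ?_
      rw [hgh v ⟨hv, hv'⟩]
      linarith
    refine chartDeriv_apply_eq_zero_of_comp (hhs.contMDiffAt.mdifferentiableAt (by simp))
      (G := g) hgd.mdifferentiableAt ?_ hw'
    filter_upwards [hev, hcoord] with v' h1 h2
    change Real.sqrt _ = _
    rw [hgh v' h1, h2.2.1, Real.sqrt_sq h2.1.le]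
  -- The turning changes only the normal coordinate, so `β` is the first tube coordinate of the
  -- motion, whatever the factor is.
  have hdβ : chartDeriv (𝓡∂ (k + 1)) (𝓡 k) β v w = 0 := by
    set a : V → B × ℂ := fun v' =>
      (β v', (R v' : ℂ) * turnFactor (turnProfile (O.levelOn j h v'), t)) with ha
    have hma : ∀ᶠ v' in 𝓝 v, O.motion j h (v', t) = O.tube (a v') := by
      filter_upwards [hev, hcoord] with v' h1 h2
      rw [motion, if_pos h1.2]
      change O.scale (j v') _ = _
      rw [h2.2.2, scale_tube]
    obtain ⟨G₂, hG₂, -, -, hG₂l⟩ := O.exists_tube_localInverse (a v)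
    have hac : ContinuousAt a v := by
      refine hβs.continuousAt.prodMk ?_
      refine (Complex.continuous_ofReal.continuousAt.comp hRs.continuousAt).mul ?_
      exact (contDiff_turnFactor.continuous.comp
        (L.contMDiff_turnProfile.continuous.prodMk continuous_const)).continuousAt
    rw [← hma.self_of_nhds] at hG₂
    refine chartDeriv_apply_eq_zero_of_comp (hms.contMDiffAt.mdifferentiableAt (by simp))
      (G := fun y => (G₂ y).1) (hG₂.fst.mdifferentiableAt (by simp)) ?_ hw
    filter_upwards [hma, hac.eventually hG₂l] with v' h1 h2
    rw [h1, h2]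
  have hpair := chartDeriv_prodMk_apply (hβs.mdifferentiableAt (by simp))
    (hRs.mdifferentiableAt (by simp)) w
  rw [hdR, hdβ] at hpair
  have htr : ContMDiff ((𝓡 k).prod 𝓘(ℝ, ℝ)) (𝓡 (k + 2)) ∞
      (fun p : B × ℝ => O.tube (p.1, (p.2 : ℂ))) :=
    O.contMDiff_tube.comp (contMDiff_fst.prodMk (Complex.ofRealCLM.contMDiff.comp contMDiff_snd))
  -- `j` is a smooth function of `(β, R)`, whose differential kills `w`, and `j` is an immersion.
  refine injective_mfderiv_iff.1 (L.isSmoothEmbedding.injective_mfderiv v) w ?_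
  refine chartDeriv_apply_eq_zero_of_comp
    ((hβs.prodMk hRs).mdifferentiableAt (by simp))
    (G := fun p : B × ℝ => O.tube (p.1, (p.2 : ℂ)))
    (htr.contMDiffAt.mdifferentiableAt (by simp)) ?_ hpair
  filter_upwards [hcoord] with v' h1
  exact h1.2.2.symm

theorem pageHeight_eventuallyEq (L : O.IsPageLift j h) {v : V}
    (hv : v ∈ (𝓡∂ (k + 1)).boundary V) : O.pageHeight j h f ε =ᶠ[𝓝 v] f := by
  have h1 : O.levelOn j h v < 1 := by rw [L.levelOn_of_mem_boundary hv]; exact one_pos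
  filter_upwards [L.continuous_levelOn.continuousAt.eventually (gt_mem_nhds h1)] with v' hv'
  exact pageHeight_of_le hv'.le

/-- Immersivity is checked zone by zone: `j` below level 9/4, the turning zone up to 3, and the
sweep beyond, where the motion alone is already an immersion. Near the boundary of `V` the height is
`f`, which gives transversality. -/
theorem isNeatGraph_motion (L : O.IsPageLift j h) (hε : 0 < ε)
    (hf : IsBoundaryDefiningOn (k + 1) f univ) (hfε : ∀ v, f v ≤ ε / 4) {t : ℝ}
    (ht : t ∈ Icc (0 : ℝ) 1) :
    IsNeatGraph (k + 1) (k + 2) ε (fun v => O.motion j h (v, t)) (O.pageHeight j h f ε) where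
  contMDiff_pos := L.contMDiff_motion.comp (contMDiff_id.prodMk contMDiff_const)
  contMDiff_ht := L.contMDiff_pageHeight hf.1
  ht_mem v := ⟨pageHeight_nonneg hε (hf.2.1 v), pageHeight_le hε hfε v⟩
  ht_eq_zero_iff := L.pageHeight_eq_zero_iff hε hf
  injective v v' h1 h2 := L.motion_injective hε hfε ht h1 h2
  injective_deriv v w h1 h2 := by
    rcases lt_or_ge (O.levelOn j h v) (9 / 4) with hv | hv
    · have h3 : (fun v => O.motion j h (v, t)) =ᶠ[𝓝 v] j := by
        filter_upwards [L.continuous_levelOn.continuousAt.eventually (gt_mem_nhds hv)] with v' hv'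
        exact motion_of_le hv'.le t
      rw [h3.chartDeriv_eq] at h1
      exact injective_mfderiv_iff.1 (L.isSmoothEmbedding.injective_mfderiv v) w h1
    rcases lt_or_ge (O.levelOn j h v) 3 with hv' | hv'
    · exact L.chartDeriv_eq_zero_of_turning hε hf.1 t (by linarith) hv' h1 h2
    · obtain ⟨x, hx, rfl⟩ := L.exists_of_levelOn_pos (show 0 < O.levelOn j h v by linarith)
      have h3 : (fun v => O.motion j h (v, t)) =ᶠ[𝓝 (h x)] fun v => O.sweepOn j h (v, t) := by
        filter_upwards [L.continuous_levelOn.continuousAt.eventually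
          (lt_mem_nhds (show 11 / 4 < O.levelOn j h (h x) by linarith))] with v' hv'
        exact L.motion_of_ge hv'.le t
      rw [h3.chartDeriv_eq] at h1
      exact injective_mfderiv_iff.1 (L.injective_mfderiv_sweepOn hx t) w h1
  transverse v hv := by
    rw [(L.pageHeight_eventuallyEq hv).chartDeriv_eq]
    exact hf.2.2.2.2 v (mem_univ _) hv

/-- The position is the embedding `j` throughout, so only the height matters; both heights are
positive in the interior and coincide near the boundary, and convex combinations keep this. -/
theorem isNeatGraph_interpolation (L : O.IsPageLift j h) (hε : 0 < ε)
    (hf : IsBoundaryDefiningOn (k + 1) f univ) (hfε : ∀ v, f v ≤ ε / 4) {t : ℝ}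
    (ht : t ∈ Icc (0 : ℝ) 1) :
    IsNeatGraph (k + 1) (k + 2) ε j (fun v => (1 - t) * f v + t * O.pageHeight j h f ε v) where
  contMDiff_pos := L.isSmoothEmbedding.contMDiff
  contMDiff_ht := (contMDiff_const.mul hf.1).add (contMDiff_const.mul (L.contMDiff_pageHeight hf.1))
  ht_mem v := by
    have h1 := pageHeight_nonneg (O := O) (j := j) (h := h) hε (hf.2.1 v)
    have h2 := pageHeight_le (O := O) (j := j) (h := h) hε hfε v
    have h3 := hf.2.1 v
    have h4 := hfε v
    obtain ⟨h5, h6⟩ := ht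
    exact ⟨by nlinarith, by nlinarith⟩
  ht_eq_zero_iff v := by
    constructor
    · intro h0
      by_contra hv
      have h1 : v ∈ (𝓡∂ (k + 1)).interior V := by
        rw [← (𝓡∂ (k + 1)).compl_boundary]
        exact hv
      have h2 := hf.2.2.2.1 v (mem_univ _) h1
      have h3 := pageHeight_pos (O := O) (j := j) (h := h) hε h2
      obtain ⟨h5, h6⟩ := ht
      rcases h6.lt_or_eq with h7 | rfl
      · have := mul_pos (sub_pos.2 h7) h2
        have := mul_nonneg h5 h3.le
        linarith
      · linarith
    · intro hv
      rw [(L.pageHeight_eq_zero_iff hε hf v).2 hv, hf.2.2.1 v hv]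
      ring
  injective v v' h1 _ := L.isSmoothEmbedding.isEmbedding.injective h1
  injective_deriv v w h1 _ :=
    injective_mfderiv_iff.1 (L.isSmoothEmbedding.injective_mfderiv v) w h1
  transverse v hv := by
    have h1 : (fun v => (1 - t) * f v + t * O.pageHeight j h f ε v) =ᶠ[𝓝 v] f := by
      filter_upwards [L.pageHeight_eventuallyEq hv] with v' hv'
      rw [hv']
      ring
    rw [h1.chartDeriv_eq]
    exact hf.2.2.2.2 v (mem_univ _) hv

/-- Raise, sweep, lower: the raising isotopy precomposed with the monodromy, then the sweep run
backwards, then the raising isotopy run backwards. -/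
theorem neatlyIsotopic_comp_viaEmbedding (L : O.IsPageLift j h)
    {n : ℕ} [NeZero n] {Y : Type*} [TopologicalSpace Y] [ChartedSpace (EuclideanHalfSpace n) Y]
    {ι : M → Y} {C : M × ℝ → Y} (hC : IsCollar (k + 2) n ι ε C)
    (hιb : ∀ x, ι x ∈ (𝓡∂ n).boundary Y) (hf : IsBoundaryDefiningOn (k + 1) f univ)
    (hfε : ∀ v, f v ≤ ε / 4) :
    NeatlyIsotopic (k + 1) n
      ((fun v => C (j v, f v)) ∘ Equiv.Perm.viaEmbedding (ρ : Equiv.Perm P) h)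
      (fun v => C (j v, f v)) := by
  -- Isotopies are parametrized by the whole real line, but the graphs are controlled only for times
  -- in `[0, 1]`. The smooth transition maps the line into that interval and fixes 0 and 1.
  have hS : ∀ t, Real.smoothTransition t ∈ Icc (0 : ℝ) 1 := fun t =>
    ⟨Real.smoothTransition.nonneg t, Real.smoothTransition.le_one t⟩
  have hSs : ContMDiff ((𝓡∂ (k + 1)).prod 𝓘(ℝ, ℝ)) 𝓘(ℝ, ℝ) ∞
      (fun p : V × ℝ => Real.smoothTransition p.2) :=
    Real.smoothTransition.contDiff.contMDiff.comp contMDiff_snd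
  have hhs := L.contMDiff_pageHeight (ε := ε) hf.1
  have h1 : NeatlyIsotopic (k + 1) n (fun v => C (j v, f v))
      (fun v => C (j v, O.pageHeight j h f ε v)) := by
    have h2 := hC.neatlyIsotopic (V := V) hιb (pos := fun p => j p.1)
      (ht := fun p => (1 - Real.smoothTransition p.2) * f p.1
        + Real.smoothTransition p.2 * O.pageHeight j h f ε p.1)
      (L.isSmoothEmbedding.contMDiff.comp contMDiff_fst)
      (((contMDiff_const.sub hSs).mul (hf.1.comp contMDiff_fst)).add
        (hSs.mul (hhs.comp contMDiff_fst)))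
      (fun t => L.isNeatGraph_interpolation hC.pos hf hfε (hS t)) (fun _ _ _ => rfl)
    simpa using h2
  have h3 : NeatlyIsotopic (k + 1) n (fun v => C (j v, O.pageHeight j h f ε v))
      ((fun v => C (j v, O.pageHeight j h f ε v))
        ∘ Equiv.Perm.viaEmbedding (ρ : Equiv.Perm P) h) := by
    have h2 : NeatlyIsotopic (k + 1) n
        (fun v => C (O.motion j h (v, Real.smoothTransition 0), O.pageHeight j h f ε v))
        (fun v => C (O.motion j h (v, Real.smoothTransition 1), O.pageHeight j h f ε v)) := by
      have e1 : ContMDiff ((𝓡∂ (k + 1)).prod 𝓘(ℝ, ℝ)) (𝓡 (k + 2)) ∞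
          (fun p : V × ℝ => O.motion j h (p.1, Real.smoothTransition p.2)) :=
        L.contMDiff_motion.comp (contMDiff_fst.prodMk hSs)
      have e2 : ContMDiff ((𝓡∂ (k + 1)).prod 𝓘(ℝ, ℝ)) 𝓘(ℝ, ℝ) ∞
          (fun p : V × ℝ => O.pageHeight j h f ε p.1) := hhs.comp contMDiff_fst
      have e3 : ∀ v ∈ (𝓡∂ (k + 1)).boundary V, ∀ t s, O.motion j h (v, t) = O.motion j h (v, s) := by
        intro v hv t s
        have h0 : O.levelOn j h v ≤ 9 / 4 := by rw [L.levelOn_of_mem_boundary hv]; norm_num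
        rw [motion_of_le h0, motion_of_le h0]
      have e4 : ∀ t, IsNeatGraph (k + 1) (k + 2) ε
          (fun v => O.motion j h (v, Real.smoothTransition t)) (O.pageHeight j h f ε) :=
        fun t => L.isNeatGraph_motion hC.pos hf hfε (hS t)
      have e5 := hC.neatlyIsotopic hιb e1 e2
      exact e5 e4 fun v hv t => e3 v hv _ _
    have h4 : (fun v => C (O.motion j h (v, Real.smoothTransition 1), O.pageHeight j h f ε v))
        = (fun v => C (j v, O.pageHeight j h f ε v))
          ∘ Equiv.Perm.viaEmbedding (ρ : Equiv.Perm P) h := by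
      ext v
      rw [Real.smoothTransition.one, L.motion_one, Function.comp_apply, L.pageHeight_viaEmbedding]
    have h5 : (fun v => C (O.motion j h (v, Real.smoothTransition 0), O.pageHeight j h f ε v))
        = (fun v => C (j v, O.pageHeight j h f ε v)) := by
      ext v
      rw [Real.smoothTransition.zero, L.motion_zero]
    rw [← h4, ← h5]
    exact h2
  exact ((h1.comp_diffBdry L.viaEmbedding_mem_diffBdry).trans h3.symm).trans h1.symm

end OpenBook.IsPageLift


/-! ### Small defining functions and the conclusion. -/

/-- Boundary defining functions can be chosen arbitrarily small. -/
theorem exists_boundaryDefining_le (n : ℕ) [NeZero n] (X : Type*) [TopologicalSpace X]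
    [ChartedSpace (EuclideanHalfSpace n) X] [IsManifold (𝓡∂ n) ∞ X] [T2Space X] [CompactSpace X]
    {δ : ℝ} (hδ : 0 < δ) : ∃ d : X → ℝ, IsBoundaryDefiningOn n d univ ∧ ∀ x, d x ≤ δ := by
  obtain ⟨d, hd⟩ := exists_boundaryDefining n X
  obtain ⟨c, hc⟩ := isCompact_univ.exists_bound_of_continuousOn hd.1.continuous.continuousOn
  have hb : ∀ x, d x ≤ |c| + 1 := fun x => by
    have h1 := hc x (mem_univ _)
    rw [Real.norm_eq_abs] at h1
    linarith [le_abs_self (d x), le_abs_self c]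
  have ha : 0 < δ / (|c| + 1) := by positivity
  set ℓ : ℝ →L[ℝ] ℝ := (δ / (|c| + 1)) • ContinuousLinearMap.id ℝ ℝ with hℓ
  have hℓx : ∀ y, ℓ y = δ / (|c| + 1) * y := fun y => by simp [hℓ]
  refine ⟨fun x => ℓ (d x), ⟨ℓ.contMDiff.comp hd.1, fun x => ?_, fun x hx => ?_, fun x hx hi => ?_,
    fun x hx hb => ?_⟩, fun x => ?_⟩
  · change 0 ≤ ℓ (d x)
    rw [hℓx]
    exact mul_nonneg ha.le (hd.2.1 x)
  · change ℓ (d x) = 0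
    rw [hd.2.2.1 x hx, map_zero]
  · change 0 < ℓ (d x)
    rw [hℓx]
    exact mul_pos ha (hd.2.2.2.1 x hx hi)
  · rw [chartDeriv_apply_of_comp (J' := 𝓘(ℝ, ℝ)) (G := ℓ)
      (hd.1.contMDiffAt.mdifferentiableAt (by simp))
      ℓ.differentiableAt.mdifferentiableAt (Filter.Eventually.of_forall fun _ => rfl),
      chartDeriv_clm, hℓx]
    exact mul_pos ha (hd.2.2.2.2 x hx hb)
  · change ℓ (d x) ≤ δ
    rw [hℓx, div_mul_eq_mul_div, div_le_iff₀ (by positivity)]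
    exact mul_le_mul_of_nonneg_left (hb x) hδ.le

end

/-- `Σ` is written `S`. The hypotheses `hh₁`, `hh₂` say that the two fixed pages lie in the
submanifold `V` of `M`, and `Equiv.Perm.viaEmbedding ρᵢ hᵢ` is the extension of `ρᵢ` by the identity
to a permutation of `V`. -/
theorem lemma4p1 (k : ℕ)
    (S : Type*) [TopologicalSpace S] [ChartedSpace (EuclideanHalfSpace (k + 3)) S]
    [IsManifold (𝓡∂ (k + 3)) ∞ S] [T2Space S] [CompactSpace S]
    (φ : DiffBdry (𝓡∂ (k + 3)) S)
    (M : Type*) [TopologicalSpace M] [ChartedSpace (EuclideanSpace ℝ (Fin (k + 2))) M]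
    [IsManifold (𝓡 (k + 2)) ∞ M] [T2Space M] [CompactSpace M]
    (ι : M → S) (hι : IsSmoothEmbedding (𝓡 (k + 2)) (𝓡∂ (k + 3)) ∞ ι)
    (hιM : ∃ s ∈ (𝓡∂ (k + 3)).boundary S,
      range ι = connectedComponentIn ((𝓡∂ (k + 3)).boundary S) s)
    (P₁ : Type*) [TopologicalSpace P₁] [ChartedSpace (EuclideanHalfSpace (k + 1)) P₁]
    [IsManifold (𝓡∂ (k + 1)) ∞ P₁] [T2Space P₁] [CompactSpace P₁]
    (ρ₁ : DiffBdry (𝓡∂ (k + 1)) P₁)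
    (B₁ : Type*) [TopologicalSpace B₁] [ChartedSpace (EuclideanSpace ℝ (Fin k)) B₁]
    [IsManifold (𝓡 k) ∞ B₁] [T2Space B₁] [CompactSpace B₁]
    (O₁ : OpenBook k P₁ ρ₁ B₁ M)
    (P₂ : Type*) [TopologicalSpace P₂] [ChartedSpace (EuclideanHalfSpace (k + 1)) P₂]
    [IsManifold (𝓡∂ (k + 1)) ∞ P₂] [T2Space P₂] [CompactSpace P₂]
    (ρ₂ : DiffBdry (𝓡∂ (k + 1)) P₂)
    (B₂ : Type*) [TopologicalSpace B₂] [ChartedSpace (EuclideanSpace ℝ (Fin k)) B₂]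
    [IsManifold (𝓡 k) ∞ B₂] [T2Space B₂] [CompactSpace B₂]
    (O₂ : OpenBook k P₂ ρ₂ B₂ M)
    (V : Type*) [TopologicalSpace V] [ChartedSpace (EuclideanHalfSpace (k + 1)) V]
    [IsManifold (𝓡∂ (k + 1)) ∞ V] [T2Space V] [CompactSpace V]
    (j : V → M) (hj : IsSmoothEmbedding (𝓡∂ (k + 1)) (𝓡 (k + 2)) ∞ j)
    (h₁ : P₁ ↪ V) (hh₁ : ∀ x, j (h₁ x) = O₁.page x)
    (h₂ : P₂ ↪ V) (hh₂ : ∀ x, j (h₂ x) = O₂.page x) :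
    ∀ η ∈ Subgroup.closure {Equiv.Perm.viaEmbedding (ρ₁ : Equiv.Perm P₁) h₁,
        Equiv.Perm.viaEmbedding (ρ₂ : Equiv.Perm P₂) h₂},
      ∃ hη : η ∈ DiffBdry (𝓡∂ (k + 1)) V,
        SpunEmbeds (⟨η, hη⟩ : DiffBdry (𝓡∂ (k + 1)) V) φ := by
  have L₁ : O₁.IsPageLift j h₁ := ⟨hj, hh₁⟩
  have L₂ : O₂.IsPageLift j h₂ := ⟨hj, hh₂⟩
  obtain ⟨s, -, hs⟩ := hιM
  have hιb : ∀ x, ι x ∈ (𝓡∂ (k + 3)).boundary S := fun x =>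
    connectedComponentIn_subset _ s (hs ▸ mem_range_self x)
  -- The set of fixed points of `φ` is a neighbourhood of the boundary, and the collar is taken
  -- inside it.
  obtain ⟨ε, C, hC, hCφ⟩ := exists_isCollar rfl hι.contMDiff hι.isEmbedding.injective hιb
    hι.injective_mfderiv φ.2.2.2
  obtain ⟨f, hf, hfε⟩ := exists_boundaryDefining_le (k + 1) V
    (show 0 < ε / 4 by linarith [hC.pos])
  set g : V → S := fun v => C (j v, f v) with hg
  have hgn : IsNeatImmersion (k + 1) (k + 3) g := by
    -- At parameter 0 the interpolated height is `f` itself, so this is the neat graph that defines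
    -- `g`, whichever open book is used.
    have h1 := L₁.isNeatGraph_interpolation hC.pos hf hfε (t := 0) ⟨le_rfl, zero_le_one⟩
    simp only [sub_zero, one_mul, zero_mul, add_zero] at h1
    exact hC.isNeatImmersion hιb h1
  have hsub : {Equiv.Perm.viaEmbedding (ρ₁ : Equiv.Perm P₁) h₁,
      Equiv.Perm.viaEmbedding (ρ₂ : Equiv.Perm P₂) h₂} ⊆
      (DiffBdry (𝓡∂ (k + 1)) V : Set (Equiv.Perm V)) := by
    rintro η (rfl | rfl)
    · exact L₁.viaEmbedding_mem_diffBdry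
    · exact L₂.viaEmbedding_mem_diffBdry
  intro η hη
  refine ⟨(Subgroup.closure_le _).2 hsub hη, g, hgn.isProperEmbedding (by omega), ?_⟩
  have hφg : (φ : Equiv.Perm S) ∘ g = g := by
    ext v
    exact hCφ (j v) (f v) ⟨hf.2.1 v, (hfε v).trans (by linarith [hC.pos])⟩
  rw [hφg]
  refine (neatlyIsotopic_comp_of_mem_closure hgn hsub ?_ hη).isotopicRelBoundary (by omega)
  rintro η (rfl | rfl)
  · exact L₁.neatlyIsotopic_comp_viaEmbedding hC hιb hf hfε
  · exact L₂.neatlyIsotopic_comp_viaEmbedding hC hιb hf hfε
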